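/- Let $n\ge 3$, $q>n$, $p>1$ and let $c=c(n)$ be a real constant. There is a constant $C>0$, depending only on $n,q,p$ (and on the value $c=c(n)$), with the following property. Let $M$ be a smooth $n$-dimensional manifold without boundary, $g_0$ a smooth Riemannian metric on $M$ and $g(t)$, $0\le t\le T$ $(T>0)$, a smooth family of complete Riemannian metrics on $M$ with $$\tfrac12 g_0\le g(t)\le 2g_0\quad\text{on } M,\qquad 0\le t\le T .$$ Write $dv_t$, $\nabla$, $\Delta$ for the volume measure, gradient and Laplace–Beltrami operator of $g(t)$. Let $x\in M$, $r>0$ and let $B_r(x)$ be the open geodesic ball of $g_0$. Suppose that $A>0$ is a constant such that for all $t\in[0,T]$ $$\Big(\int_{B_r(x)}|\varphi|^{\frac{2n}{n-2}}dv_t\Big)^{\frac{n-2}{n}}\le A\int_{B_r(x)}|\nabla\varphi|^2dv_t\qquad\text{for all }\varphi\in C_0^\infty(B_r(x)).$$ Let $u\ge 0$ be a function on $B_r(x)\times[0,T]$, measurable in space for each $t$, with $$\frac{\partial}{\partial t}dv_t\le c\,u\,dv_t\quad\text{on }B_r(x)\times(0,T),\qquad \Big(\int_{B_r(x)}u^{\frac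 q2}dv_t\Big)^{\frac2q}\le\mu\,t^{-\frac{q-n}{q}}\quad(0<t\le T)$$ for some constant $\mu>0$. Let $f\ge0$ be a continuous function on $B_r(x)\times[0,T]$ which, at the points of $B_r(x)\times(0,T)$ where $f>0$, is $C^2$ in space, has a continuous time derivative, and satisfies $$\frac{\partial f}{\partial t}\le\Delta f+uf .$$ (Every nonnegative continuous function on $B_r(x)\times[0,T]$ that is $C^2$ in space and $C^1$ in time and satisfies this inequality on all of $B_r(x)\times(0,T)$ is of this kind.) Then for every $t\in(0,T]$ $$f(x,t)\le C A^{\frac{n}{2p}}\left(\frac{1+A^{\frac{n}{q-n}}\mu^{\frac{q}{q-n}}}{t}+\frac1{r^2}\right)^{\frac{n+2}{2p}}\left(\int_0^T\!\!\int_{B_r(x)}f^p\,dv_s\,ds\right)^{\frac1p},$$ where the right-hand side may be $+\infty$. -/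

import Mathlib

open Set MeasureTheory Filter Topology Manifold Bundle
open scoped ContDiff ENNReal Manifold

noncomputable section

namespace MoserFlow

theorem exists_chart_cover {n : ℕ} {M : Type*} [TopologicalSpace M]
    [ChartedSpace (EuclideanSpace ℝ (Fin n)) M] [SecondCountableTopology M] [Nonempty M] :
    ∃ c : ℕ → M, ⋃ k, (chartAt (EuclideanSpace ℝ (Fin n)) (c k)).source = univ := by
  obtain ⟨s, hs, hU⟩ := TopologicalSpace.countable_cover_nhds
    (fun x : M ↦ chart_source_mem_nhds (EuclideanSpace ℝ (Fin n)) x)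
  have hne : s.Nonempty := by
    rw [nonempty_iff_ne_empty]
    rintro rfl
    simp at hU
    exact (empty_ne_univ hU)
  obtain ⟨c, rfl⟩ := hs.exists_eq_range hne
  exact ⟨c, by simpa using hU⟩

/-- Smooth Riemannian metrics on an `n`-dimensional smooth manifold without boundary. -/
abbrev SmoothMetric (n : ℕ) (M : Type*) [TopologicalSpace M] [ChartedSpace (EuclideanSpace ℝ (Fin n)) M]
    [IsManifold (𝓡 n) ∞ M] :=
  ContMDiffRiemannianMetric (𝓡 n) ∞ (EuclideanSpace ℝ (Fin n))
    (fun y : M ↦ TangentSpace (𝓡 n) y)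

variable {n : ℕ} {M : Type*} [TopologicalSpace M] [ChartedSpace (EuclideanSpace ℝ (Fin n)) M]
  [IsManifold (𝓡 n) ∞ M]

/-- The Riemannian distance of `g`: the infimum of the `g`-lengths of `C^1` paths
(`∞` between points in different components). -/
def rdist (g : SmoothMetric n M) (x y : M) : ℝ≥0∞ :=
  letI : RiemannianBundle (fun y : M ↦ TangentSpace (𝓡 n) y) := ⟨g.toRiemannianMetric⟩
  riemannianEDist (𝓡 n) x y

/-- The open geodesic ball of `g`. -/
def ball (g : SmoothMetric n M) (x : M) (r : ℝ) : Set M :=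
  {y | rdist g x y < ENNReal.ofReal r}

/-- Metric completeness of `(M, g)`: every sequence that is Cauchy for the Riemannian distance
converges. -/
def IsCompleteMetric (g : SmoothMetric n M) : Prop :=
  ∀ s : ℕ → M, (∀ ε : ℝ≥0∞, 0 < ε → ∃ N, ∀ i ≥ N, ∀ j ≥ N, rdist g (s i) (s j) < ε) →
    ∃ y, Tendsto s atTop (𝓝 y)

/-- The `i`-th standard basis vector of `ℝⁿ`. -/
def basisVec (i : Fin n) : EuclideanSpace ℝ (Fin n) := EuclideanSpace.single i 1

/-- The `i`-th coordinate vector field of the chart `φ` preferred at `x`, at the point `φ⁻¹(z)`. -/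
def coordVec (x : M) (z : EuclideanSpace ℝ (Fin n)) (i : Fin n) :
    TangentSpace (𝓡 n) ((chartAt (EuclideanSpace ℝ (Fin n)) x).symm z) :=
  mfderiv (𝓡 n) (𝓡 n) (chartAt (EuclideanSpace ℝ (Fin n)) x).symm z (basisVec i)

/-- The matrix `g_{ij}` of `g` in the chart preferred at `x`, as a function of the coordinates. -/
def gram (g : SmoothMetric n M) (x : M) (z : EuclideanSpace ℝ (Fin n)) : Matrix (Fin n) (Fin n) ℝ :=
  Matrix.of fun i j ↦
    g.inner ((chartAt (EuclideanSpace ℝ (Fin n)) x).symm z) (coordVec x z i) (coordVec x z j)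

/-- The volume density `√(det g_{ij})` in the chart preferred at `x`. -/
def volDensity (g : SmoothMetric n M) (x : M) (z : EuclideanSpace ℝ (Fin n)) : ℝ :=
  Real.sqrt (gram g x z).det

/-- The measure `√(det g_{ij}) dz` of the chart preferred at `x`, transported to the domain of that
chart and extended by zero to `M`. -/
def chartVol [MeasurableSpace M] (g : SmoothMetric n M) (x : M) : Measure M :=
  ((volume.restrict (chartAt (EuclideanSpace ℝ (Fin n)) x).target).withDensity
    (fun z ↦ ENNReal.ofReal (volDensity g x z))).map (chartAt (EuclideanSpace ℝ (Fin n)) x).symm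

open Classical in
/-- The Riemannian volume measure `dv_g`. Cut `M` into countably many disjoint Borel pieces, each
inside the domain of a chart, and use `√(det g_{ij}) dz` on each piece; by the change of variables
formula the result does not depend on the cover. A countable cover by charts exists for every
nonempty second countable `M` (see `exists_chart_cover`). -/
def vol [MeasurableSpace M] (g : SmoothMetric n M) : Measure M :=
  if h : ∃ c : ℕ → M, ⋃ k, (chartAt (EuclideanSpace ℝ (Fin n)) (c k)).source = univ then
    Measure.sum fun k ↦ (chartVol g (h.choose k)).restrict
      (disjointed (fun k ↦ (chartAt (EuclideanSpace ℝ (Fin n)) (h.choose k)).source) k)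
  else 0

/-- The partial derivative `∂_i F` on `ℝⁿ`. -/
def pd (i : Fin n) (F : EuclideanSpace ℝ (Fin n) → ℝ) (z : EuclideanSpace ℝ (Fin n)) : ℝ :=
  fderiv ℝ F z (basisVec i)

/-- `|∇h|²_g = g^{ij} ∂_i h ∂_j h` at `y`, computed in the chart preferred at `y`. -/
def gradSq (g : SmoothMetric n M) (h : M → ℝ) (y : M) : ℝ :=
  let φ := chartAt (EuclideanSpace ℝ (Fin n)) y
  ∑ i, ∑ j, (gram g y (φ y))⁻¹ i j * pd i (h ∘ φ.symm) (φ y) * pd j (h ∘ φ.symm) (φ y)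

/-- The Laplace-Beltrami operator `Δ_g h = (det g)^{-1/2} ∂_i ((det g)^{1/2} g^{ij} ∂_j h)` at `y`,
computed in the chart preferred at `y`. -/
def laplacian (g : SmoothMetric n M) (h : M → ℝ) (y : M) : ℝ :=
  let φ := chartAt (EuclideanSpace ℝ (Fin n)) y
  (volDensity g y (φ y))⁻¹ *
    ∑ i, pd i (fun z ↦ volDensity g y z * ∑ j, (gram g y z)⁻¹ i j * pd j (h ∘ φ.symm) z) (φ y)

/-- `g(t)`, `t ∈ [0,T]`, is a smooth family: `(y,t) ↦ g(t)_y` is smooth on `M × [0,T]`. -/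
def SmoothFamily (g : ℝ → SmoothMetric n M) (T : ℝ) : Prop :=
  ContMDiffOn ((𝓡 n).prod 𝓘(ℝ, ℝ))
    ((𝓡 n).prod 𝓘(ℝ, EuclideanSpace ℝ (Fin n) →L[ℝ] EuclideanSpace ℝ (Fin n) →L[ℝ] ℝ)) ∞
    (fun z : M × ℝ ↦ TotalSpace.mk' (EuclideanSpace ℝ (Fin n) →L[ℝ] EuclideanSpace ℝ (Fin n) →L[ℝ] ℝ)
      (E := fun y : M ↦ TangentSpace (𝓡 n) y →L[ℝ] TangentSpace (𝓡 n) y →L[ℝ] ℝ)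
      z.1 ((g z.2).inner z.1))
    (univ ×ˢ Icc 0 T)

/-- `½ g₀ ≤ g ≤ 2 g₀` as quadratic forms on every tangent space. -/
def TwoEquivalent (g₀ g : SmoothMetric n M) : Prop :=
  ∀ (y : M) (v : TangentSpace (𝓡 n) y),
    (1 / 2) * g₀.inner y v v ≤ g.inner y v v ∧ g.inner y v v ≤ 2 * g₀.inner y v v

/-- The Sobolev inequality with constant `A` for `φ ∈ C_0^∞(B)`, with respect to `g`:
`(∫_B |φ|^{2n/(n-2)} dv_g)^{(n-2)/n} ≤ A ∫_B |∇φ|²_g dv_g`. -/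
def SobolevOn [MeasurableSpace M] (g : SmoothMetric n M) (B : Set M) (A : ℝ) : Prop :=
  ∀ φ : M → ℝ, ContMDiff (𝓡 n) 𝓘(ℝ, ℝ) ∞ φ → HasCompactSupport φ → tsupport φ ⊆ B →
    (∫ y in B, |φ y| ^ (2 * (n : ℝ) / ((n : ℝ) - 2)) ∂(vol g)) ^ (((n : ℝ) - 2) / (n : ℝ)) ≤
      A * ∫ y in B, gradSq g φ y ∂(vol g)

/-- `∂_t dv_t ≤ c u dv_t` on `B × (0,T)`, as an inequality between the densities of these measures
in coordinates; at `y` the chart preferred at `y` is used. -/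
def VolumeGrowth (g : ℝ → SmoothMetric n M) (B : Set M) (T c : ℝ) (u : ℝ → M → ℝ) : Prop :=
  ∀ t ∈ Ioo 0 T, ∀ y ∈ B,
    deriv (fun s ↦ volDensity (g s) y (chartAt (EuclideanSpace ℝ (Fin n)) y y)) t ≤
      c * u t y * volDensity (g t) y (chartAt (EuclideanSpace ℝ (Fin n)) y y)

/-- `f ≥ 0` is a subsolution of `∂_t f ≤ Δ_{g(t)} f + u f` on `B × [0,T]`: `f` is continuous and
nonnegative there and, at the points with `0 < t < T` and `f > 0`, it is `C²` in space with a
continuous time derivative, and the inequality holds. At an interior zero of a nonnegative `f`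
which is `C²` in space and `C¹` in time the inequality is automatic, because
`∂_t f = 0 ≤ Δ f` there. -/
structure IsSubsolution (g : ℝ → SmoothMetric n M) (B : Set M) (T : ℝ) (u f : ℝ → M → ℝ) : Prop where
  nonneg : ∀ t ∈ Icc 0 T, ∀ y ∈ B, 0 ≤ f t y
  continuousOn : ContinuousOn (fun z : M × ℝ ↦ f z.2 z.1) (B ×ˢ Icc 0 T)
  contMDiffAt_space : ∀ t ∈ Ioo 0 T, ∀ y ∈ B, 0 < f t y → ContMDiffAt (𝓡 n) 𝓘(ℝ, ℝ) 2 (f t) y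
  differentiableAt_time : ∀ t ∈ Ioo 0 T, ∀ y ∈ B, 0 < f t y →
    DifferentiableAt ℝ (fun s ↦ f s y) t
  continuousOn_deriv_time : ContinuousOn (fun z : M × ℝ ↦ deriv (fun s ↦ f s z.1) z.2)
    {z | z.1 ∈ B ∧ z.2 ∈ Ioo 0 T ∧ 0 < f z.2 z.1}
  inequality : ∀ t ∈ Ioo 0 T, ∀ y ∈ B, 0 < f t y →
    deriv (fun s ↦ f s y) t ≤ laplacian (g t) (f t) y + u t y * f t y

end MoserFlow

end

open MoserFlow

/-! This is Moser's iteration for a subsolution on a ball with a moving metric. Multiply `f ^ a`,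
with `a ≥ p`, by a squared cutoff `η²`, integrate against `dv_t` and differentiate in time.
Integration by parts (`green`, `caccioppoli`) produces a negative multiple of `∫ |∇(η f^{a/2})|²`
and a term with `|∇η|²`. The zero order term `u f` and the growth `∂_t dv_t ≤ c u dv_t` both
contribute multiples of `∫ u η² f^a`. Hölder's inequality interpolates this integral between `∫ η²
f^a` and the Sobolev norm, the latter with power `n/q < 1`, so Young's inequality absorbs it into
the gradient term. The price is a factor `a^{q/(q-n)} A^{n/(q-n)} μ^{q/(q-n)} / t` (up to a
constant) in front of `∫ η² f^a`: the rate assumed for `u` is the one that turns into `1/t`. This is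
`energy_inequality`.

The energy inequality bounds `sup_t ∫ η² f^a` and the time integral of the Sobolev norm on a smaller
cylinder by `∫∫ f^a` on a larger one, and interpolation then bounds `∫∫ f^{a(1+2/n)}` on the smaller
cylinder. Repeating this along `a_k = p (1+2/n)^k` over cylinders shrinking to a fixed one, the
coefficients grow geometrically, and the superlinear recursion still yields a bound on `f(x,t)^p`
(`moser_iteration`).

Since `f` is regular only where it is positive, powers of `f` are replaced by powers of `regCube δ
f`, which is constant for `f ≤ δ` and bounded below by `δ³`. Its powers satisfy the same
differential inequalities as pure powers, with constants independent of `δ`, and `δ → 0` is taken at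
the end (`rpow_le_integral`).

The geometric input is obtained as follows. The volume measures are all written as densities over
`vol g₀` (`vol_eq_withDensity`), so that time derivatives pass under the integral. Completeness of
one `g(t)` gives compact `g₀`-balls by the Hopf–Rinow argument. Mollifying in charts and gluing
(`exists_smooth_approx`) serves twice: it smooths the truncated distance into a cutoff with gradient
at most `6/r`, and it extends the Sobolev inequality from smooth to `C¹` test functions. -/

noncomputable section

namespace MoserFlow

set_option linter.unusedSectionVars false

/-! ### Metric, volume density and gradients: dependence on the chart. -/

section ChartCalculus

variable {n : ℕ} {M : Type*} [TopologicalSpace M] [ChartedSpace (EuclideanSpace ℝ (Fin n)) M]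
  [IsManifold (𝓡 n) ∞ M]

/-- The model space `ℝⁿ`. -/
abbrev Coord (n : ℕ) := EuclideanSpace ℝ (Fin n)

/-- The differential of the inverse of the chart preferred at `a`. -/
def chartSymmDeriv (a : M) (z : Coord n) : Coord n →L[ℝ] Coord n :=
  mfderiv (𝓡 n) (𝓡 n) (chartAt (Coord n) a).symm z

/-- The differential of the chart preferred at `a`. -/
def chartDeriv (a : M) (y : M) : Coord n →L[ℝ] Coord n :=
  mfderiv (𝓡 n) (𝓡 n) (chartAt (Coord n) a) y

/-- The differential of a real function. -/
def dM (h : M → ℝ) (y : M) : Coord n →L[ℝ] ℝ :=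
  mfderiv (𝓡 n) 𝓘(ℝ, ℝ) h y

/-- The inner product on the tangent space at `y`, as a bilinear form on the model space. -/
def innerM (g : SmoothMetric n M) (y : M) : Coord n →L[ℝ] Coord n →L[ℝ] ℝ :=
  g.inner y

/-- The matrix of the metric at `y` in the basis given by the chart preferred at `y`. -/
def metricMatrix (g : SmoothMetric n M) (y : M) : Matrix (Fin n) (Fin n) ℝ :=
  Matrix.of fun i j ↦ innerM g y (basisVec i) (basisVec j)

/-- The inner product of the gradients of two functions. -/
def gradPair (g : SmoothMetric n M) (h k : M → ℝ) (y : M) : ℝ :=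
  ∑ i, ∑ j, (metricMatrix g y)⁻¹ i j * dM h y (basisVec i) * dM k y (basisVec j)

lemma mdifferentiableAt_chart_symm (a : M) {z : Coord n} (hz : z ∈ (chartAt (Coord n) a).target) :
    MDifferentiableAt (𝓡 n) (𝓡 n) (chartAt (Coord n) a).symm z :=
  mdifferentiableAt_atlas_symm (chart_mem_atlas _ a) hz

lemma mdifferentiableAt_chart (a : M) {y : M} (hy : y ∈ (chartAt (Coord n) a).source) :
    MDifferentiableAt (𝓡 n) (𝓡 n) (chartAt (Coord n) a) y :=
  mdifferentiableAt_atlas (chart_mem_atlas _ a) hy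

lemma fderiv_comp_chart_symm (a : M) {z : Coord n} (hz : z ∈ (chartAt (Coord n) a).target)
    {h : M → ℝ} (hh : MDifferentiableAt (𝓡 n) 𝓘(ℝ, ℝ) h ((chartAt (Coord n) a).symm z)) :
    fderiv ℝ (h ∘ (chartAt (Coord n) a).symm) z =
      (dM h ((chartAt (Coord n) a).symm z)).comp (chartSymmDeriv a z) := by
  have := mfderiv_comp z hh (mdifferentiableAt_chart_symm a hz)
  rw [mfderiv_eq_fderiv] at this
  exact this

lemma chartSymmDeriv_comp_chartDeriv (a : M) {y : M} (hy : y ∈ (chartAt (Coord n) a).source) :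
    (chartSymmDeriv a (chartAt (Coord n) a y)).comp (chartDeriv a y) =
      ContinuousLinearMap.id ℝ (Coord n) :=
  (mdifferentiable_chart (I := 𝓡 n) a).symm_comp_deriv hy

lemma chartDeriv_comp_chartSymmDeriv (a : M) {z : Coord n}
    (hz : z ∈ (chartAt (Coord n) a).target) :
    (chartDeriv a ((chartAt (Coord n) a).symm z)).comp (chartSymmDeriv a z) =
      ContinuousLinearMap.id ℝ (Coord n) :=
  (mdifferentiable_chart (I := 𝓡 n) a).comp_symm_deriv hz

/-- The tangent space at `y` is identified with `ℝⁿ` by the chart preferred at `y`, so this chart is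
invisible at its own base point. Chart-free objects at `y` can therefore be expressed in the
standard basis. -/
lemma chartDeriv_self (y : M) : chartDeriv y y = ContinuousLinearMap.id ℝ (Coord n) := by
  have h := mfderiv_extChartAt_self (I := 𝓡 n) (x := y)
  have h2 : (extChartAt (𝓡 n) y : M → Coord n) = chartAt (Coord n) y := by
    ext z; simp
  rw [h2] at h
  exact h

lemma chartSymmDeriv_self (y : M) :
    chartSymmDeriv y (chartAt (Coord n) y y) = ContinuousLinearMap.id ℝ (Coord n) := by
  have h := chartSymmDeriv_comp_chartDeriv (n := n) y (mem_chart_source _ y)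
  rwa [chartDeriv_self, ContinuousLinearMap.comp_id] at h

lemma gram_apply (g : SmoothMetric n M) (a : M) (z : Coord n) (i j : Fin n) :
    gram g a z i j = innerM g ((chartAt (Coord n) a).symm z) (chartSymmDeriv a z (basisVec i))
      (chartSymmDeriv a z (basisVec j)) := rfl

lemma coord_eq_sum (v : Coord n) : v = ∑ i, v i • basisVec i := by
  have := (EuclideanSpace.basisFun (Fin n) ℝ).sum_repr v
  simpa [basisVec] using this.symm

/-- The Jacobian matrix of the inverse chart, in the standard basis. -/
def chartMatrix (a : M) (z : Coord n) : Matrix (Fin n) (Fin n) ℝ :=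
  Matrix.of fun i j ↦ chartSymmDeriv a z (basisVec j) i

/-- Pulling back a bilinear form is a congruence by the Jacobian. All dependence on the chart at `a`
sits in `chartMatrix`; positivity, volume density and gradient products are read off from this
identity. -/
lemma gram_eq (g : SmoothMetric n M) (a : M) (z : Coord n) :
    gram g a z = (chartMatrix a z).transpose * metricMatrix g ((chartAt (Coord n) a).symm z) *
      chartMatrix a z := by
  ext i j
  rw [gram_apply, Matrix.mul_assoc, Matrix.mul_apply]
  conv_lhs => rw [coord_eq_sum (chartSymmDeriv a z (basisVec i))]
  simp only [map_sum, map_smul, sum_apply, smul_apply,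
    smul_eq_mul]
  refine Finset.sum_congr rfl fun k _ ↦ ?_
  rw [Matrix.mul_apply]
  conv_lhs => rw [coord_eq_sum (chartSymmDeriv a z (basisVec j))]
  simp only [map_sum, map_smul, smul_eq_mul]
  simp only [Matrix.transpose_apply, chartMatrix, metricMatrix, Matrix.of_apply]
  congr 1
  exact Finset.sum_congr rfl fun l _ ↦ mul_comm _ _

lemma det_chartMatrix (a : M) (z : Coord n) :
    (chartMatrix a z).det = (chartSymmDeriv a z).det := by
  rw [ContinuousLinearMap.det,
    ← LinearMap.det_toMatrix (EuclideanSpace.basisFun (Fin n) ℝ).toBasis]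
  congr 1

lemma innerM_symm (g : SmoothMetric n M) (y : M) (v w : Coord n) :
    innerM g y v w = innerM g y w v := g.symm y v w

lemma innerM_pos (g : SmoothMetric n M) (y : M) {v : Coord n} (hv : v ≠ 0) :
    0 < innerM g y v v := g.pos y v hv

lemma innerM_self_nonneg (g : SmoothMetric n M) (y : M) (v : Coord n) : 0 ≤ innerM g y v v := by
  by_cases hv : v = 0
  · simp [hv]
  · exact (innerM_pos g y hv).le

lemma innerM_eq_sum (g : SmoothMetric n M) (y : M) (v w : Coord n) :
    innerM g y v w = ∑ i, ∑ j, v i * metricMatrix g y i j * w j := by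
  conv_lhs => rw [coord_eq_sum v, coord_eq_sum w]
  simp only [map_sum, map_smul, sum_apply, smul_apply,
    smul_eq_mul, metricMatrix, Matrix.of_apply]
  rw [Finset.sum_comm]
  refine Finset.sum_congr rfl fun i _ ↦ ?_
  rw [Finset.mul_sum]
  refine Finset.sum_congr rfl fun j _ ↦ by ring

lemma posDef_metricMatrix (g : SmoothMetric n M) (y : M) : (metricMatrix g y).PosDef := by
  refine Matrix.PosDef.of_dotProduct_mulVec_pos ?_ ?_
  · ext i j
    simp only [Matrix.conjTranspose_apply, star_trivial, metricMatrix, Matrix.of_apply]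
    exact innerM_symm g y _ _
  · intro v hv
    have h := innerM_pos g y (v := WithLp.toLp 2 v) (by simpa using hv)
    rw [innerM_eq_sum] at h
    simpa [dotProduct, Matrix.mulVec, Finset.mul_sum, mul_assoc] using h

lemma det_metricMatrix_pos (g : SmoothMetric n M) (y : M) : 0 < (metricMatrix g y).det :=
  (posDef_metricMatrix g y).det_pos

lemma det_chartSymmDeriv_ne_zero (a : M) {z : Coord n}
    (hz : z ∈ (chartAt (Coord n) a).target) : (chartSymmDeriv a z).det ≠ 0 := by
  intro h
  have h1 := congrArg ContinuousLinearMap.det (chartDeriv_comp_chartSymmDeriv (n := n) a hz)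
  have h2 : ((chartDeriv a ((chartAt (Coord n) a).symm z)).comp (chartSymmDeriv a z)).det =
      (chartDeriv a ((chartAt (Coord n) a).symm z)).det * (chartSymmDeriv a z).det :=
    LinearMap.det_comp _ _
  rw [h2, h, mul_zero] at h1
  simp [ContinuousLinearMap.det] at h1

/-- The chart enters only through a Jacobian factor that does not involve the metric. It cancels in
the ratio of two metrics and is the substitution factor between two charts. -/
lemma volDensity_eq (g : SmoothMetric n M) (a : M) (z : Coord n) :
    volDensity g a z = |(chartSymmDeriv a z).det| *
      Real.sqrt (metricMatrix g ((chartAt (Coord n) a).symm z)).det := by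
  rw [volDensity, gram_eq, Matrix.det_mul, Matrix.det_mul, Matrix.det_transpose, det_chartMatrix]
  rw [show ∀ x y : ℝ, x * y * x = x ^ 2 * y from fun x y ↦ by ring,
    Real.sqrt_mul (sq_nonneg _), Real.sqrt_sq_eq_abs]

lemma volDensity_pos (g : SmoothMetric n M) (a : M) {z : Coord n}
    (hz : z ∈ (chartAt (Coord n) a).target) : 0 < volDensity g a z := by
  rw [volDensity_eq]
  exact mul_pos (abs_pos.2 (det_chartSymmDeriv_ne_zero a hz))
    (Real.sqrt_pos.2 (det_metricMatrix_pos g _))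

lemma posDef_gram (g : SmoothMetric n M) (a : M) {z : Coord n}
    (hz : z ∈ (chartAt (Coord n) a).target) : (gram g a z).PosDef := by
  rw [gram_eq]
  have := (posDef_metricMatrix g ((chartAt (Coord n) a).symm z)).conjTranspose_mul_mul_same
    (B := chartMatrix a z) ?_
  · rwa [Matrix.conjTranspose_eq_transpose_of_trivial] at this
  · refine Matrix.mulVec_injective_of_isUnit ?_
    rw [Matrix.isUnit_iff_isUnit_det, det_chartMatrix]
    exact (det_chartSymmDeriv_ne_zero a hz).isUnit

lemma dM_chartSymmDeriv_basis (h : M → ℝ) (a : M) (z : Coord n) (i : Fin n) :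
    dM h ((chartAt (Coord n) a).symm z) (chartSymmDeriv a z (basisVec i)) =
      Matrix.vecMul (fun k ↦ dM h ((chartAt (Coord n) a).symm z) (basisVec k))
        (chartMatrix a z) i := by
  conv_lhs => rw [coord_eq_sum (chartSymmDeriv a z (basisVec i))]
  simp [Matrix.vecMul, dotProduct, chartMatrix, mul_comm]

lemma pd_comp_chart_symm (a : M) {z : Coord n} (hz : z ∈ (chartAt (Coord n) a).target)
    {h : M → ℝ} (hh : MDifferentiableAt (𝓡 n) 𝓘(ℝ, ℝ) h ((chartAt (Coord n) a).symm z))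
    (i : Fin n) :
    pd i (h ∘ (chartAt (Coord n) a).symm) z =
      dM h ((chartAt (Coord n) a).symm z) (chartSymmDeriv a z (basisVec i)) := by
  rw [pd, fderiv_comp_chart_symm a hz hh]
  rfl

lemma sum_inv_eq_dotProduct {G : Matrix (Fin n) (Fin n) ℝ} (ξ ζ : Fin n → ℝ) :
    ∑ i, ∑ j, G i j * ξ i * ζ j = dotProduct ξ (G.mulVec ζ) := by
  simp only [dotProduct, Matrix.mulVec, Finset.mul_sum]
  exact Finset.sum_congr rfl fun i _ ↦ Finset.sum_congr rfl fun j _ ↦ by ring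

/-- The inner product of gradients, computed in the chart preferred at `a`. -/
lemma gradPair_chart (g : SmoothMetric n M) (a : M) {z : Coord n}
    (hz : z ∈ (chartAt (Coord n) a).target) {h k : M → ℝ}
    (hh : MDifferentiableAt (𝓡 n) 𝓘(ℝ, ℝ) h ((chartAt (Coord n) a).symm z))
    (hk : MDifferentiableAt (𝓡 n) 𝓘(ℝ, ℝ) k ((chartAt (Coord n) a).symm z)) :
    gradPair g h k ((chartAt (Coord n) a).symm z) =
      ∑ i, ∑ j, (gram g a z)⁻¹ i j * pd i (h ∘ (chartAt (Coord n) a).symm) z *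
        pd j (k ∘ (chartAt (Coord n) a).symm) z := by
  have hu : IsUnit (chartMatrix a z) := by
    rw [Matrix.isUnit_iff_isUnit_det, det_chartMatrix]
    exact (det_chartSymmDeriv_ne_zero a hz).isUnit
  have hu' : IsUnit (chartMatrix a z).det := (Matrix.isUnit_iff_isUnit_det _).1 hu
  have hut : IsUnit (chartMatrix a z).transpose.det := by rwa [Matrix.det_transpose]
  simp only [gradPair, pd_comp_chart_symm a hz hh, pd_comp_chart_symm a hz hk,
    dM_chartSymmDeriv_basis]
  -- With Jacobian `J` and metric `G`, the covectors become `ξJ` and `ζJ` and the inverse metric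
  -- `J⁻¹ G⁻¹ J⁻ᵀ`, so every `J` cancels.
  rw [sum_inv_eq_dotProduct, sum_inv_eq_dotProduct, gram_eq, Matrix.mul_inv_rev,
    Matrix.mul_inv_rev]
  rw [← Matrix.mulVec_transpose (chartMatrix a z) (fun k_1 ↦ dM k _ (basisVec k_1)),
    Matrix.mulVec_mulVec, ← Matrix.dotProduct_mulVec, Matrix.mulVec_mulVec]
  congr 2
  rw [Matrix.mul_assoc, Matrix.mul_assoc, Matrix.nonsing_inv_mul _ hut, Matrix.mul_one,
    ← Matrix.mul_assoc, Matrix.mul_nonsing_inv _ hu', Matrix.one_mul]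

/-- The Sobolev hypothesis is phrased with `gradSq`; all later estimates use the bilinear
`gradPair`. -/
lemma gradSq_eq_gradPair (g : SmoothMetric n M) {h : M → ℝ} {y : M}
    (hh : MDifferentiableAt (𝓡 n) 𝓘(ℝ, ℝ) h y) : gradSq g h y = gradPair g h h y := by
  have hy : (chartAt (Coord n) y).symm (chartAt (Coord n) y y) = y :=
    (chartAt (Coord n) y).left_inv (mem_chart_source _ y)
  have := gradPair_chart g y (mem_chart_target _ y) (h := h) (k := h)
    (by rwa [hy]) (by rwa [hy])
  rw [hy] at this
  rw [this]
  rfl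

end ChartCalculus

/-! ### Gradients as dual norms, rules of differentiation, smoothness of the metric coefficients. -/

section Gradient

variable {n : ℕ} {M : Type*} [TopologicalSpace M] [ChartedSpace (EuclideanSpace ℝ (Fin n)) M]
  [IsManifold (𝓡 n) ∞ M]

/-- The gradient of `h` at `y`. -/
def gradVec (g : SmoothMetric n M) (h : M → ℝ) (y : M) : Coord n :=
  WithLp.toLp 2 ((metricMatrix g y)⁻¹.mulVec fun i ↦ dM h y (basisVec i))

lemma dM_eq_sum (h : M → ℝ) (y : M) (v : Coord n) :
    dM h y v = ∑ i, v i * dM h y (basisVec i) := by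
  conv_lhs => rw [coord_eq_sum v]
  simp

lemma isUnit_det_metricMatrix (g : SmoothMetric n M) (y : M) : IsUnit (metricMatrix g y).det :=
  (det_metricMatrix_pos g y).ne'.isUnit

lemma innerM_gradVec (g : SmoothMetric n M) (h : M → ℝ) (y : M) (v : Coord n) :
    innerM g y v (gradVec g h y) = dM h y v := by
  rw [innerM_eq_sum, dM_eq_sum]
  refine Finset.sum_congr rfl fun i _ ↦ ?_
  have h1 : (metricMatrix g y).mulVec (gradVec g h y) i = dM h y (basisVec i) := by
    rw [gradVec, Matrix.mulVec_mulVec, Matrix.mul_nonsing_inv _ (isUnit_det_metricMatrix g y),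
      Matrix.one_mulVec]
  rw [← h1, Matrix.mulVec, dotProduct, Finset.mul_sum]
  exact Finset.sum_congr rfl fun j _ ↦ by ring

lemma gradPair_eq_dM (g : SmoothMetric n M) (h k : M → ℝ) (y : M) :
    gradPair g h k y = dM h y (gradVec g k y) := by
  rw [gradPair, sum_inv_eq_dotProduct, dM_eq_sum, dotProduct]
  exact Finset.sum_congr rfl fun i _ ↦ mul_comm _ _

lemma gradPair_eq_inner (g : SmoothMetric n M) (h k : M → ℝ) (y : M) :
    gradPair g h k y = innerM g y (gradVec g k y) (gradVec g h y) := by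
  rw [gradPair_eq_dM, innerM_gradVec]

lemma gradPair_comm (g : SmoothMetric n M) (h k : M → ℝ) (y : M) :
    gradPair g h k y = gradPair g k h y := by
  rw [gradPair_eq_inner, gradPair_eq_inner, innerM_symm]

lemma gradPair_self_nonneg (g : SmoothMetric n M) (h : M → ℝ) (y : M) :
    0 ≤ gradPair g h h y := by
  rw [gradPair_eq_inner]; exact innerM_self_nonneg g y _

/-- Expand the square of the vector `⟨v,w⟩ v - ⟨v,v⟩ w`. -/
lemma innerM_cauchy_schwarz (g : SmoothMetric n M) (y : M) (v w : Coord n) :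
    innerM g y v w ^ 2 ≤ innerM g y v v * innerM g y w w := by
  by_cases hv : v = 0
  · simp [hv]
  have hp := innerM_pos g y hv
  have h := innerM_self_nonneg g y (innerM g y v w • v - innerM g y v v • w)
  simp only [map_sub, map_smul, sub_apply, smul_apply, smul_eq_mul,
    innerM_symm g y w v] at h
  nlinarith

lemma dM_sq_le (g : SmoothMetric n M) (h : M → ℝ) (y : M) (v : Coord n) :
    dM h y v ^ 2 ≤ gradPair g h h y * innerM g y v v := by
  rw [← innerM_gradVec g, gradPair_eq_inner, mul_comm]
  exact innerM_cauchy_schwarz g y _ _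

/-- Testing on the gradient itself gives `|∇h|⁴ ≤ L |∇h|²`. Together with `dM_sq_le` this identifies
`|∇h|²` as the squared dual norm of `dh`, so gradient bounds can be proved without inverting a
matrix. -/
lemma gradPair_self_le (g : SmoothMetric n M) {h : M → ℝ} {y : M} {L : ℝ} (hL : 0 ≤ L)
    (H : ∀ v, dM h y v ^ 2 ≤ L * innerM g y v v) : gradPair g h h y ≤ L := by
  have h1 := H (gradVec g h y)
  rw [← gradPair_eq_dM, ← gradPair_eq_inner] at h1
  rcases (gradPair_self_nonneg g h y).eq_or_lt with h0 | h0
  · rwa [← h0]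
  · nlinarith

/-- By duality the lower bound `½ g₀ ≤ g` on vectors is an upper bound with factor two on covectors.
-/
lemma gradPair_self_le_of_twoEquivalent {g₀ g : SmoothMetric n M} (hg : TwoEquivalent g₀ g)
    (h : M → ℝ) (y : M) : gradPair g h h y ≤ 2 * gradPair g₀ h h y := by
  refine gradPair_self_le g (by have := gradPair_self_nonneg g₀ h y; positivity) fun v ↦ ?_
  have h1 := dM_sq_le g₀ h y v
  have h2 : (1 / 2) * innerM g₀ y v v ≤ innerM g y v v := (hg y v).1
  have h3 := gradPair_self_nonneg g₀ h y
  nlinarith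

/-- Because the preferred chart has identity differential at its own point, no Jacobian appears, and
the product, sum and chain rules for `dM` reduce to those for `fderiv`. -/
lemma dM_eq_fderiv {h : M → ℝ} {y : M} (hh : MDifferentiableAt (𝓡 n) 𝓘(ℝ, ℝ) h y) :
    dM h y = fderiv ℝ (h ∘ (chartAt (Coord n) y).symm) (chartAt (Coord n) y y) := by
  have hy : (chartAt (Coord n) y).symm (chartAt (Coord n) y y) = y :=
    (chartAt (Coord n) y).left_inv (mem_chart_source _ y)
  rw [fderiv_comp_chart_symm y (mem_chart_target _ y) (by rwa [hy]), chartSymmDeriv_self, hy]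
  rfl

lemma differentiableAt_comp_chart_symm (a : M) {z : Coord n}
    (hz : z ∈ (chartAt (Coord n) a).target) {h : M → ℝ}
    (hh : MDifferentiableAt (𝓡 n) 𝓘(ℝ, ℝ) h ((chartAt (Coord n) a).symm z)) :
    DifferentiableAt ℝ (h ∘ (chartAt (Coord n) a).symm) z :=
  (hh.comp z (mdifferentiableAt_chart_symm a hz)).differentiableAt

lemma differentiableAt_comp_chart_symm_self {h : M → ℝ} {y : M}
    (hh : MDifferentiableAt (𝓡 n) 𝓘(ℝ, ℝ) h y) :
    DifferentiableAt ℝ (h ∘ (chartAt (Coord n) y).symm) (chartAt (Coord n) y y) := by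
  have hy : (chartAt (Coord n) y).symm (chartAt (Coord n) y y) = y :=
    (chartAt (Coord n) y).left_inv (mem_chart_source _ y)
  exact differentiableAt_comp_chart_symm y (mem_chart_target _ y) (by rwa [hy])

lemma dM_mul {h k : M → ℝ} {y : M} (hh : MDifferentiableAt (𝓡 n) 𝓘(ℝ, ℝ) h y)
    (hk : MDifferentiableAt (𝓡 n) 𝓘(ℝ, ℝ) k y) :
    dM (n := n) (fun y ↦ h y * k y) y = h y • dM k y + k y • dM h y := by
  have hhk : MDifferentiableAt (𝓡 n) 𝓘(ℝ, ℝ) (fun y ↦ h y * k y) y := hh.mul hk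
  have hy : (chartAt (Coord n) y).symm (chartAt (Coord n) y y) = y :=
    (chartAt (Coord n) y).left_inv (mem_chart_source _ y)
  rw [dM_eq_fderiv hhk, dM_eq_fderiv hh, dM_eq_fderiv hk]
  have := fderiv_mul (differentiableAt_comp_chart_symm_self hh)
    (differentiableAt_comp_chart_symm_self hk)
  simp only [Function.comp_apply, hy] at this
  exact this

lemma dM_sum {ι : Type*} (s : Finset ι) {h : ι → M → ℝ} {y : M}
    (hh : ∀ i ∈ s, MDifferentiableAt (𝓡 n) 𝓘(ℝ, ℝ) (h i) y) :
    dM (n := n) (fun y ↦ ∑ i ∈ s, h i y) y = ∑ i ∈ s, dM (h i) y := by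
  have hs : MDifferentiableAt (𝓡 n) 𝓘(ℝ, ℝ) (fun y ↦ ∑ i ∈ s, h i y) y := by
    classical
    induction s using Finset.induction_on with
    | empty => simpa using mdifferentiableAt_const
    | insert i s hi ih =>
      simp only [Finset.sum_insert hi]
      exact (hh i (Finset.mem_insert_self i s)).add
        (ih fun j hj ↦ hh j (Finset.mem_insert_of_mem hj))
  rw [dM_eq_fderiv hs, Finset.sum_congr rfl fun i hi ↦ dM_eq_fderiv (hh i hi)]
  have := fderiv_fun_sum (u := s) fun i hi ↦ differentiableAt_comp_chart_symm_self (hh i hi)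
  exact this

lemma dM_comp {χ : ℝ → ℝ} {χ' : ℝ} {h : M → ℝ} {y : M}
    (hh : MDifferentiableAt (𝓡 n) 𝓘(ℝ, ℝ) h y) (hχ : HasDerivAt χ χ' (h y)) :
    dM (n := n) (fun y ↦ χ (h y)) y = χ' • dM h y := by
  have hc : MDifferentiableAt (𝓡 n) 𝓘(ℝ, ℝ) (fun y ↦ χ (h y)) y :=
    hχ.differentiableAt.mdifferentiableAt.comp y hh
  have hy : (chartAt (Coord n) y).symm (chartAt (Coord n) y y) = y :=
    (chartAt (Coord n) y).left_inv (mem_chart_source _ y)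
  rw [dM_eq_fderiv hc, dM_eq_fderiv hh]
  have h1 : HasDerivAt χ χ' ((h ∘ (chartAt (Coord n) y).symm) (chartAt (Coord n) y y)) := by
    simpa [hy] using hχ
  exact (h1.comp_hasFDerivAt _ (differentiableAt_comp_chart_symm_self hh).hasFDerivAt).fderiv

lemma dM_const (c : ℝ) (y : M) : dM (n := n) (fun _ : M ↦ c) y = 0 :=
  mfderiv_const

lemma dM_congr {h k : M → ℝ} {y : M} (H : h =ᶠ[𝓝 y] k) : dM (n := n) h y = dM k y :=
  H.mfderiv_eq

lemma smoothFamily_const (g : SmoothMetric n M) (T : ℝ) : SmoothFamily (fun _ ↦ g) T :=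
  (g.contMDiff.comp contMDiff_fst).contMDiffOn

/-- A coordinate field is the tangent map of the inverse chart applied to a constant section. -/
lemma contMDiffOn_coordVec (a : M) (i : Fin n) :
    ContMDiffOn (𝓡 n) ((𝓡 n).prod 𝓘(ℝ, Coord n)) ∞
      (fun z : Coord n ↦ TotalSpace.mk' (Coord n) (E := fun y : M ↦ TangentSpace (𝓡 n) y)
        ((chartAt (Coord n) a).symm z) (coordVec a z i)) (chartAt (Coord n) a).target := by
  have hopen := (chartAt (Coord n) a).open_target
  have h1 : ContMDiffOn (𝓡 n) (𝓡 n) ∞ (chartAt (Coord n) a).symm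
      (chartAt (Coord n) a).target := contMDiffOn_chart_symm
  have h2 := h1.contMDiffOn_tangentMapWithin (m := ∞) (by simp) hopen.uniqueMDiffOn
  have h3 : ContMDiff (𝓡 n) ((𝓡 n).prod 𝓘(ℝ, Coord n)) ∞
      (fun z : Coord n ↦ (⟨z, basisVec i⟩ : TangentBundle (𝓡 n) (Coord n))) := by
    have := contMDiff_vectorSpace_iff_contDiff (𝕜 := ℝ) (E := Coord n) (n := ∞)
      (V := fun _ ↦ basisVec i)
    exact this.2 contDiff_const
  refine (ContMDiffOn.comp h2 (h3.contMDiffOn (s := (chartAt (Coord n) a).target))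
    (fun z hz ↦ hz)).congr fun z hz ↦ ?_
  simp only [Function.comp_apply, tangentMapWithin]
  rw [mfderivWithin_of_isOpen hopen hz]
  rfl

/-- The metric coefficients of a smooth family are jointly smooth in the coordinates and time. -/
lemma contDiffOn_gram {g : ℝ → SmoothMetric n M} {T : ℝ} (hg : SmoothFamily g T) (a : M)
    (i j : Fin n) :
    ContDiffOn ℝ ∞ (fun q : Coord n × ℝ ↦ gram (g q.2) a q.1 i j)
      ((chartAt (Coord n) a).target ×ˢ Icc 0 T) := by
  have hb : ContMDiffOn ((𝓡 n).prod 𝓘(ℝ, ℝ)) ((𝓡 n).prod 𝓘(ℝ, ℝ)) ∞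
      (fun q : Coord n × ℝ ↦ ((chartAt (Coord n) a).symm q.1, q.2))
      ((chartAt (Coord n) a).target ×ˢ Icc 0 T) := by
    refine ContMDiffOn.prodMk ?_ contMDiffOn_snd
    exact contMDiffOn_chart_symm.comp contMDiffOn_fst fun q hq ↦ hq.1
  have hψ := hg.comp hb (fun q hq ↦ ⟨mem_univ _, hq.2⟩)
  have hv (i : Fin n) := (contMDiffOn_coordVec (M := M) a i).comp
    (contMDiffOn_fst (I := 𝓡 n) (J := 𝓘(ℝ, ℝ)) (s := (chartAt (Coord n) a).target ×ˢ Icc 0 T))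
    (fun q hq ↦ hq.1)
  have hR : ContMDiffOn ((𝓡 n).prod 𝓘(ℝ, ℝ)) ((𝓡 n).prod 𝓘(ℝ, ℝ)) ∞
      (fun q : Coord n × ℝ ↦ TotalSpace.mk' ℝ (E := Bundle.Trivial M ℝ)
        ((chartAt (Coord n) a).symm q.1) (gram (g q.2) a q.1 i j))
      ((chartAt (Coord n) a).target ×ˢ Icc 0 T) := by
    refine ContMDiffOn.clm_bundle_apply₂ (F₁ := Coord n) (F₂ := Coord n) ?_ (hv i) (hv j)
    exact hψ
  intro q hq
  have h1 := hR q hq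
  simp only [contMDiffWithinAt_totalSpace] at h1
  have h2 : ContMDiffWithinAt ((𝓡 n).prod 𝓘(ℝ, ℝ)) 𝓘(ℝ, ℝ) ∞
      (fun q : Coord n × ℝ ↦ gram (g q.2) a q.1 i j)
      ((chartAt (Coord n) a).target ×ˢ Icc 0 T) q := h1.2
  -- The product of the two models is rewritten as the model of the product vector space, where
  -- manifold smoothness is ordinary smoothness.
  rw [← modelWithCornersSelf_prod, chartedSpaceSelf_prod] at h2
  exact h2.contDiffWithinAt

end Gradient

/-! ### The Riemannian volume measure: independence of charts, density over a fixed metric. -/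

section Volume

variable {n : ℕ} {M : Type*} [TopologicalSpace M] [ChartedSpace (EuclideanSpace ℝ (Fin n)) M]
  [IsManifold (𝓡 n) ∞ M]

lemma contDiffOn_det {F : Type*} [NormedAddCommGroup F] [NormedSpace ℝ F] {s : Set F}
    {G : F → Matrix (Fin n) (Fin n) ℝ} {k : WithTop ℕ∞}
    (hG : ∀ i j, ContDiffOn ℝ k (fun q ↦ G q i j) s) :
    ContDiffOn ℝ k (fun q ↦ (G q).det) s := by
  simp only [Matrix.det_apply]
  exact ContDiffOn.sum fun σ _ ↦ (contDiffOn_prod fun i _ ↦ hG _ _).const_smul _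

lemma contDiffOn_volDensity {g : ℝ → SmoothMetric n M} {T : ℝ} (hg : SmoothFamily g T) (a : M) :
    ContDiffOn ℝ ∞ (fun q : Coord n × ℝ ↦ volDensity (g q.2) a q.1)
      ((chartAt (Coord n) a).target ×ˢ Icc 0 T) := by
  refine ContDiffOn.sqrt (contDiffOn_det fun i j ↦ contDiffOn_gram hg a i j) fun q hq ↦ ?_
  exact (posDef_gram (g q.2) a hq.1).det_pos.ne'

lemma contDiffOn_slice {F : Coord n × ℝ → ℝ} {S : Set (Coord n)} {T t : ℝ}
    (hF : ContDiffOn ℝ ∞ F (S ×ˢ Icc 0 T)) (ht : t ∈ Icc 0 T) :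
    ContDiffOn ℝ ∞ (fun z ↦ F (z, t)) S :=
  hF.comp (contDiff_id.prodMk contDiff_const).contDiffOn fun _ hz ↦ ⟨hz, ht⟩

lemma contDiffOn_gram_const (g : SmoothMetric n M) (a : M) (i j : Fin n) :
    ContDiffOn ℝ ∞ (fun z ↦ gram g a z i j) (chartAt (Coord n) a).target :=
  contDiffOn_slice (contDiffOn_gram (smoothFamily_const g 1) a i j)
    (t := 0) ⟨le_rfl, zero_le_one⟩

lemma contDiffOn_volDensity_const (g : SmoothMetric n M) (a : M) :
    ContDiffOn ℝ ∞ (volDensity g a) (chartAt (Coord n) a).target :=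
  contDiffOn_slice (contDiffOn_volDensity (smoothFamily_const g 1) a)
    (t := 0) ⟨le_rfl, zero_le_one⟩

lemma continuousOn_volDensity (g : SmoothMetric n M) (a : M) :
    ContinuousOn (volDensity g a) (chartAt (Coord n) a).target :=
  (contDiffOn_volDensity_const g a).continuousOn

/-- The ratio of the volume densities of two metrics. -/
def densRatio (g₀ g : SmoothMetric n M) (y : M) : ℝ :=
  Real.sqrt (metricMatrix g y).det / Real.sqrt (metricMatrix g₀ y).det

lemma densRatio_pos (g₀ g : SmoothMetric n M) (y : M) : 0 < densRatio g₀ g y :=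
  div_pos (Real.sqrt_pos.2 (det_metricMatrix_pos g y))
    (Real.sqrt_pos.2 (det_metricMatrix_pos g₀ y))

/-- The Jacobian factor of the chart cancels, so the quotient of densities is the same function on
`M` in every chart. -/
lemma densRatio_chart (g₀ g : SmoothMetric n M) (a : M) {z : Coord n}
    (hz : z ∈ (chartAt (Coord n) a).target) :
    densRatio g₀ g ((chartAt (Coord n) a).symm z) = volDensity g a z / volDensity g₀ a z := by
  rw [volDensity_eq, volDensity_eq, densRatio, mul_div_mul_left]
  exact abs_ne_zero.2 (det_chartSymmDeriv_ne_zero a hz)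

lemma densRatio_chart' (g₀ g : SmoothMetric n M) (a : M) {y : M}
    (hy : y ∈ (chartAt (Coord n) a).source) :
    densRatio g₀ g y = volDensity g a (chartAt (Coord n) a y) /
      volDensity g₀ a (chartAt (Coord n) a y) := by
  rw [← densRatio_chart g₀ g a ((chartAt (Coord n) a).map_source hy),
    (chartAt (Coord n) a).left_inv hy]

lemma continuousOn_chart_pullback (φ : OpenPartialHomeomorph M (Coord n))
    {F : Coord n × ℝ → ℝ} {I : Set ℝ} (hF : ContinuousOn F (φ.target ×ˢ I)) :
    ContinuousOn (fun q : M × ℝ ↦ F (φ q.1, q.2)) (φ.source ×ˢ I) :=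
  hF.comp ((φ.continuousOn.comp continuousOn_fst fun _ hq ↦ hq.1).prodMk continuousOn_snd)
    fun _ hq ↦ ⟨φ.map_source hq.1, hq.2⟩

/-- `metricMatrix` may jump where the preferred chart changes, so joint continuity is read off from
the quotient of densities in one chart kept fixed near the given point. -/
lemma continuousOn_densRatio (g₀ : SmoothMetric n M) {g : ℝ → SmoothMetric n M} {T : ℝ}
    (hg : SmoothFamily g T) :
    ContinuousOn (fun q : M × ℝ ↦ densRatio g₀ (g q.2) q.1) (univ ×ˢ Icc 0 T) := by
  rintro ⟨y, t⟩ ⟨-, ht⟩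
  set φ := chartAt (Coord n) y
  have h1 : ContinuousOn (fun q : M × ℝ ↦ volDensity (g q.2) y (φ q.1) /
      volDensity g₀ y (φ q.1)) (φ.source ×ˢ Icc 0 T) := by
    refine ContinuousOn.div ?_ ?_ ?_
    · exact continuousOn_chart_pullback φ (F := fun q ↦ volDensity (g q.2) y q.1)
        (contDiffOn_volDensity hg y).continuousOn
    · exact continuousOn_chart_pullback φ (F := fun q ↦ volDensity g₀ y q.1)
        ((continuousOn_volDensity g₀ y).comp continuousOn_fst fun q hq ↦ hq.1)
    · exact fun q hq ↦ (volDensity_pos g₀ y (φ.map_source hq.1)).ne'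
  have h2 : ContinuousOn (fun q : M × ℝ ↦ densRatio g₀ (g q.2) q.1) (φ.source ×ˢ Icc 0 T) :=
    h1.congr fun q hq ↦ densRatio_chart' g₀ _ y hq.1
  refine (h2 (y, t) ⟨mem_chart_source _ y, ht⟩).mono_of_mem_nhdsWithin ?_
  rw [show (univ : Set M) ×ˢ Icc 0 T = univ ×ˢ Icc 0 T from rfl, nhdsWithin_prod_eq]
  refine prod_mem_prod ?_ self_mem_nhdsWithin
  rw [nhdsWithin_univ]
  exact φ.open_source.mem_nhds (mem_chart_source _ y)

lemma continuous_densRatio (g₀ g : SmoothMetric n M) : Continuous (densRatio g₀ g) := by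
  have h : ContinuousOn (fun q : M × ℝ ↦ densRatio g₀ g q.1) (univ ×ˢ Icc 0 1) :=
    continuousOn_densRatio g₀ (g := fun _ ↦ g) (smoothFamily_const g 1)
  have h2 : Continuous fun y : M ↦ (y, (0 : ℝ)) := by fun_prop
  exact h.comp_continuous h2 fun y ↦ ⟨mem_univ _, le_rfl, zero_le_one⟩

/-! ### Time derivative of the volume density. -/

section TimeDerivative

variable {g : ℝ → SmoothMetric n M} {T : ℝ}

lemma hasDerivAt_volDensity (hg : SmoothFamily g T) (a : M) {z : Coord n}
    (hz : z ∈ (chartAt (Coord n) a).target) {t : ℝ} (ht : t ∈ Ioo 0 T) :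
    HasDerivAt (fun s ↦ volDensity (g s) a z)
      (fderiv ℝ (fun q : Coord n × ℝ ↦ volDensity (g q.2) a q.1) (z, t) (0, 1)) t := by
  have hn : (chartAt (Coord n) a).target ×ˢ Icc 0 T ∈ 𝓝 (z, t) :=
    prod_mem_nhds ((chartAt (Coord n) a).open_target.mem_nhds hz) (Icc_mem_nhds ht.1 ht.2)
  have h1 := ((contDiffOn_volDensity hg a).contDiffAt hn).differentiableAt (by simp)
  have h2 : HasDerivAt (fun s : ℝ ↦ (z, s)) ((0 : Coord n), (1 : ℝ)) t :=
    (hasDerivAt_const t z).prodMk (hasDerivAt_id t)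
  exact h1.hasFDerivAt.comp_hasDerivAt t h2

lemma differentiableAt_densRatio (g₀ : SmoothMetric n M) (hg : SmoothFamily g T) (y : M) {t : ℝ}
    (ht : t ∈ Ioo 0 T) : DifferentiableAt ℝ (fun s ↦ densRatio g₀ (g s) y) t := by
  simp only [densRatio_chart' g₀ _ y (mem_chart_source _ y)]
  exact (hasDerivAt_volDensity hg y (mem_chart_target _ y) ht).differentiableAt.div_const _

lemma continuousOn_deriv_densRatio (g₀ : SmoothMetric n M) (hg : SmoothFamily g T) :
    ContinuousOn (fun q : M × ℝ ↦ deriv (fun s ↦ densRatio g₀ (g s) q.1) q.2)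
      (univ ×ˢ Ioo 0 T) := by
  rintro ⟨y, t⟩ ⟨-, ht⟩
  set φ := chartAt (Coord n) y
  have hF : ContinuousOn (fderiv ℝ (fun q : Coord n × ℝ ↦ volDensity (g q.2) y q.1))
      (φ.target ×ˢ Ioo 0 T) := by
    refine ContDiffOn.continuousOn_fderiv_of_isOpen (n := ∞)
      ((contDiffOn_volDensity hg y).mono (prod_mono subset_rfl Ioo_subset_Icc_self))
      (φ.open_target.prod isOpen_Ioo) (by simp)
  have h1 : ContinuousOn (fun q : M × ℝ ↦
      fderiv ℝ (fun q : Coord n × ℝ ↦ volDensity (g q.2) y q.1) (φ q.1, q.2) (0, 1) /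
      volDensity g₀ y (φ q.1)) (φ.source ×ˢ Ioo 0 T) := by
    refine ContinuousOn.div ?_ ?_ ?_
    · exact continuousOn_chart_pullback φ
        (F := fun q ↦ fderiv ℝ (fun q : Coord n × ℝ ↦ volDensity (g q.2) y q.1) q (0, 1))
        (hF.clm_apply continuousOn_const)
    · exact continuousOn_chart_pullback φ (F := fun q ↦ volDensity g₀ y q.1)
        ((continuousOn_volDensity g₀ y).comp continuousOn_fst fun q hq ↦ hq.1)
    · exact fun q hq ↦ (volDensity_pos g₀ y (φ.map_source hq.1)).ne'
  have h2 : ContinuousOn (fun q : M × ℝ ↦ deriv (fun s ↦ densRatio g₀ (g s) q.1) q.2)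
      (φ.source ×ˢ Ioo 0 T) := by
    refine h1.congr fun q hq ↦ ?_
    simp only [densRatio_chart' g₀ _ y hq.1]
    exact ((hasDerivAt_volDensity hg y (φ.map_source hq.1) hq.2).div_const _).deriv
  refine ((h2 (y, t) ⟨mem_chart_source _ y, ht⟩).continuousAt ?_).continuousWithinAt
  exact (φ.open_source.prod isOpen_Ioo).mem_nhds ⟨mem_chart_source _ y, ht⟩

/-- Dividing by the density of `g₀`, which does not depend on time, turns the growth hypothesis in
the preferred chart into a statement free of charts. -/
lemma deriv_densRatio_le (g₀ : SmoothMetric n M) (hg : SmoothFamily g T) {B : Set M} {c : ℝ}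
    {u : ℝ → M → ℝ} (hV : VolumeGrowth g B T c u) {t : ℝ} (ht : t ∈ Ioo 0 T) {y : M}
    (hy : y ∈ B) :
    deriv (fun s ↦ densRatio g₀ (g s) y) t ≤ c * u t y * densRatio g₀ (g t) y := by
  simp only [densRatio_chart' g₀ _ y (mem_chart_source _ y)]
  rw [((hasDerivAt_volDensity hg y (mem_chart_target _ y) ht).div_const _).deriv,
    ← (hasDerivAt_volDensity hg y (mem_chart_target _ y) ht).deriv, ← mul_div_assoc]
  exact div_le_div_of_nonneg_right (hV t ht y hy)
    (volDensity_pos g₀ y (mem_chart_target _ y)).le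

end TimeDerivative

variable [MeasurableSpace M] [BorelSpace M]

lemma aemeasurable_volDensity (g : SmoothMetric n M) (a : M) :
    AEMeasurable (fun z ↦ ENNReal.ofReal (volDensity g a z))
      (volume.restrict (chartAt (Coord n) a).target) :=
  ((continuousOn_volDensity g a).aemeasurable
    (chartAt (Coord n) a).open_target.measurableSet).ennreal_ofReal

lemma aemeasurable_chart_symm (g : SmoothMetric n M) (a : M) :
    AEMeasurable (chartAt (Coord n) a).symm
      ((volume.restrict (chartAt (Coord n) a).target).withDensity
        (fun z ↦ ENNReal.ofReal (volDensity g a z))) :=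
  ((chartAt (Coord n) a).continuousOn_symm.aemeasurable
    (chartAt (Coord n) a).open_target.measurableSet).mono_ac (withDensity_absolutelyContinuous _ _)

lemma measurableSet_chart_preimage (a : M) {s : Set M} (hs : MeasurableSet s) :
    MeasurableSet ((chartAt (Coord n) a).target ∩ (chartAt (Coord n) a).symm ⁻¹' s) := by
  have h := (chartAt (Coord n) a).continuousOn_symm.domRestrict.measurable hs
  have h2 := (MeasurableEmbedding.subtype_coe
    (chartAt (Coord n) a).open_target.measurableSet).measurableSet_image.2 h
  convert h2 using 1
  ext z
  simp only [mem_inter_iff, mem_preimage, mem_image, Subtype.exists, exists_and_right,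
    exists_eq_right]
  exact ⟨fun h ↦ ⟨h.1, h.2⟩, fun ⟨h1, h2⟩ ↦ ⟨h1, h2⟩⟩

lemma lintegral_chartVol (g : SmoothMetric n M) (a : M) {F : M → ℝ≥0∞} (hF : Measurable F) :
    ∫⁻ y, F y ∂(chartVol g a) = ∫⁻ z in (chartAt (Coord n) a).target,
      ENNReal.ofReal (volDensity g a z) * F ((chartAt (Coord n) a).symm z) := by
  rw [chartVol, lintegral_map' hF.aemeasurable (aemeasurable_chart_symm g a)]
  rw [lintegral_withDensity_eq_lintegral_mul₀ (aemeasurable_volDensity g a)]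
  · rfl
  · exact hF.comp_aemeasurable ((chartAt (Coord n) a).continuousOn_symm.aemeasurable
      (chartAt (Coord n) a).open_target.measurableSet)

lemma chartVol_apply (g : SmoothMetric n M) (a : M) {s : Set M} (hs : MeasurableSet s) :
    chartVol g a s = ∫⁻ z in (chartAt (Coord n) a).target ∩ (chartAt (Coord n) a).symm ⁻¹' s,
      ENNReal.ofReal (volDensity g a z) := by
  have h1 : chartVol g a s = ∫⁻ y, s.indicator (fun _ ↦ (1 : ℝ≥0∞)) y ∂(chartVol g a) := by
    rw [lintegral_indicator hs]; simp
  rw [h1, lintegral_chartVol g a (measurable_const.indicator hs),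
    ← lintegral_indicator (chartAt (Coord n) a).open_target.measurableSet,
    ← lintegral_indicator (measurableSet_chart_preimage a hs)]
  congr 1
  ext z
  by_cases h1 : z ∈ (chartAt (Coord n) a).target <;>
  by_cases h2 : (chartAt (Coord n) a).symm z ∈ s <;> simp [indicator, h1, h2]

/-- The volume measures of two charts agree on the intersection of their domains. -/
lemma chartVol_eq_chartVol (g : SmoothMetric n M) (a b : M) {s : Set M} (hs : MeasurableSet s)
    (ha : s ⊆ (chartAt (Coord n) a).source) (hb : s ⊆ (chartAt (Coord n) b).source) :
    chartVol g b s = chartVol g a s := by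
  rw [chartVol_apply g a hs, chartVol_apply g b hs]
  set φ := chartAt (Coord n) a
  set ψ := chartAt (Coord n) b
  have hS : MeasurableSet (φ.target ∩ φ.symm ⁻¹' s) := measurableSet_chart_preimage a hs
  have himg : ψ.target ∩ ψ.symm ⁻¹' s = (ψ ∘ φ.symm) '' (φ.target ∩ φ.symm ⁻¹' s) := by
    ext w
    constructor
    · rintro ⟨hw, hws⟩
      refine ⟨φ (ψ.symm w), ⟨φ.map_source (ha hws), ?_⟩, ?_⟩
      · simpa [φ.left_inv (ha hws)] using hws
      · simp [φ.left_inv (ha hws), ψ.right_inv hw]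
    · rintro ⟨z, ⟨hz, hzs⟩, rfl⟩
      refine ⟨ψ.map_source (hb hzs), ?_⟩
      simpa [ψ.left_inv (hb hzs)] using hzs
  -- Change of variables along the transition map; its Jacobian is exactly the discrepancy between
  -- the two densities in `volDensity_eq`.
  rw [himg, lintegral_image_eq_lintegral_abs_det_fderiv_mul volume hS
    (f' := fun z ↦ (chartDeriv b (φ.symm z)).comp (chartSymmDeriv a z))]
  · refine setLIntegral_congr_fun hS fun z hz ↦ ?_
    simp only [Function.comp_apply]
    rw [← ENNReal.ofReal_mul (abs_nonneg _), volDensity_eq, volDensity_eq,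
      ψ.left_inv (hb hz.2), ← mul_assoc]
    congr 2
    rw [← abs_mul]
    congr 1
    have h1 : (chartSymmDeriv a z).det =
        (((chartSymmDeriv b (ψ (φ.symm z))).comp (chartDeriv b (φ.symm z))).comp
          (chartSymmDeriv a z)).det := by
      rw [chartSymmDeriv_comp_chartDeriv b (hb hz.2), ContinuousLinearMap.id_comp]
    have hdet (A B : Coord n →L[ℝ] Coord n) : (A.comp B).det = A.det * B.det :=
      LinearMap.det_comp _ _
    rw [h1, hdet, hdet, hdet]
    ring
  · intro z hz
    have h1 := (mdifferentiableAt_chart b (hb hz.2)).hasMFDerivAt.comp z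
      (mdifferentiableAt_chart_symm a hz.1).hasMFDerivAt
    exact h1.hasFDerivAt.hasFDerivWithinAt
  · intro z hz z' hz' h
    simp only [Function.comp_apply] at h
    have := ψ.injOn (hb hz.2) (hb hz'.2) h
    exact φ.symm.injOn hz.1 hz'.1 this

variable [SecondCountableTopology M]

lemma exists_vol_eq [Nonempty M] : ∃ c : ℕ → M,
    (⋃ k, (chartAt (Coord n) (c k)).source = univ) ∧ ∀ g : SmoothMetric n M,
    vol g = Measure.sum fun k ↦ (chartVol g (c k)).restrict
      (disjointed (fun k ↦ (chartAt (Coord n) (c k)).source) k) := by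
  have h := exists_chart_cover (n := n) (M := M)
  refine ⟨h.choose, h.choose_spec, fun g ↦ ?_⟩
  rw [vol, dif_pos h]

lemma measurableSet_disjointed_chart (c : ℕ → M) (k : ℕ) :
    MeasurableSet (disjointed (fun k ↦ (chartAt (Coord n) (c k)).source) k) :=
  MeasurableSet.disjointed (fun k ↦ (chartAt (Coord n) (c k)).open_source.measurableSet) k

/-- On each piece of the cover defining `vol`, the measure of that chart agrees with the measure of
the chart at `a`, and the pieces add up. The arbitrary choice of cover thus disappears. -/
lemma vol_eq_chartVol (g : SmoothMetric n M) (a : M) {s : Set M} (hs : MeasurableSet s)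
    (ha : s ⊆ (chartAt (Coord n) a).source) : vol g s = chartVol g a s := by
  have : Nonempty M := ⟨a⟩
  obtain ⟨c, hc, hv⟩ := exists_vol_eq (n := n) (M := M)
  set D := disjointed (fun k ↦ (chartAt (Coord n) (c k)).source)
  have hD (k : ℕ) : MeasurableSet (D k) := measurableSet_disjointed_chart c k
  rw [hv g, Measure.sum_apply _ hs]
  have h1 (k : ℕ) : ((chartVol g (c k)).restrict (D k)) s = chartVol g a (s ∩ D k) := by
    rw [Measure.restrict_apply hs]
    exact chartVol_eq_chartVol g a (c k) (hs.inter (hD k)) (inter_subset_left.trans ha)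
      (inter_subset_right.trans (disjointed_subset _ k))
  simp only [h1]
  rw [← measure_iUnion]
  · rw [← inter_iUnion, iUnion_disjointed, hc, inter_univ]
  · intro i j hij
    exact ((disjoint_disjointed _) hij).mono inter_subset_right inter_subset_right
  · exact fun k ↦ hs.inter (hD k)

lemma vol_restrict_source (g : SmoothMetric n M) (a : M) :
    (vol g).restrict (chartAt (Coord n) a).source = chartVol g a := by
  ext s hs
  rw [Measure.restrict_apply hs, vol_eq_chartVol g a
    (hs.inter (chartAt (Coord n) a).open_source.measurableSet) inter_subset_right,
    chartVol_apply g a (hs.inter (chartAt (Coord n) a).open_source.measurableSet),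
    chartVol_apply g a hs]
  congr 2
  ext z
  simp only [mem_inter_iff, mem_preimage]
  exact ⟨fun h ↦ ⟨h.1, h.2.1⟩, fun h ↦ ⟨h.1, h.2, (chartAt (Coord n) a).map_target h.1⟩⟩

/-- All moving measures become weights over one fixed measure, so that integrals over `vol (g t)`
can be differentiated in `t` under the integral sign. -/
lemma vol_eq_withDensity (g₀ g : SmoothMetric n M) :
    vol g = (vol g₀).withDensity fun y ↦ ENNReal.ofReal (densRatio g₀ g y) := by
  rcases isEmpty_or_nonempty M with hM | hM
  · ext s hs
    have : s = ∅ := Subsingleton.elim _ _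
    simp [this]
  obtain ⟨c, hc, hv⟩ := exists_vol_eq (n := n) (M := M)
  have hm : Measurable fun y ↦ ENNReal.ofReal (densRatio g₀ g y) :=
    (continuous_densRatio g₀ g).measurable.ennreal_ofReal
  have key (a : M) {s : Set M} (hs : MeasurableSet s) :
      chartVol g a s = ∫⁻ y in s, ENNReal.ofReal (densRatio g₀ g y) ∂(chartVol g₀ a) := by
    rw [← lintegral_indicator hs, lintegral_chartVol g₀ a (hm.indicator hs), chartVol_apply g a hs,
      ← lintegral_indicator (measurableSet_chart_preimage a hs),
      ← lintegral_indicator (chartAt (Coord n) a).open_target.measurableSet]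
    congr 1
    ext z
    by_cases h1 : z ∈ (chartAt (Coord n) a).target <;>
    by_cases h2 : (chartAt (Coord n) a).symm z ∈ s <;> simp [indicator, h1, h2]
    rw [densRatio_chart g₀ g a h1, ← ENNReal.ofReal_mul (volDensity_pos g₀ a h1).le,
      mul_div_cancel₀ _ (volDensity_pos g₀ a h1).ne']
  ext s hs
  rw [withDensity_apply _ hs, hv g, hv g₀, Measure.sum_apply _ hs, Measure.restrict_sum _ hs,
    lintegral_sum_measure]
  congr 1
  ext k
  rw [Measure.restrict_apply hs, Measure.restrict_restrict hs]
  exact key _ (hs.inter (measurableSet_disjointed_chart c k))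

instance isLocallyFiniteMeasure_vol (g : SmoothMetric n M) :
    IsLocallyFiniteMeasure (vol g) := by
  refine ⟨fun a ↦ ?_⟩
  set φ := chartAt (Coord n) a
  obtain ⟨K, hK, hKt⟩ := Metric.nhds_basis_closedBall.mem_iff.1
    (φ.open_target.mem_nhds (mem_chart_target (Coord n) a))
  have hKc : IsCompact (Metric.closedBall (φ a) K) := isCompact_closedBall _ _
  obtain ⟨C, hC⟩ := (hKc.image_of_continuousOn
    ((continuousOn_volDensity g a).mono hKt)).bddAbove
  have hopen := φ.isOpen_inter_preimage (Metric.isOpen_ball (x := φ a) (ε := K))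
  refine ⟨_, hopen.mem_nhds ⟨mem_chart_source _ a, Metric.mem_ball_self hK⟩, ?_⟩
  rw [vol_eq_chartVol g a hopen.measurableSet inter_subset_left,
    chartVol_apply g a hopen.measurableSet]
  calc _ ≤ ∫⁻ z in Metric.closedBall (φ a) K, ENNReal.ofReal (volDensity g a z) := by
        refine lintegral_mono_set fun z hz ↦ ?_
        have := hz.2.2
        simp only [mem_preimage] at this
        rw [φ.right_inv hz.1] at this
        exact Metric.ball_subset_closedBall this
    _ ≤ ∫⁻ z in Metric.closedBall (φ a) K, ENNReal.ofReal C := by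
        refine setLIntegral_mono measurable_const fun z hz ↦ ENNReal.ofReal_le_ofReal ?_
        exact hC (mem_image_of_mem _ hz)
    _ < ⊤ := by
        rw [setLIntegral_const]
        exact ENNReal.mul_lt_top ENNReal.ofReal_lt_top hKc.measure_lt_top

lemma vol_pos_of_isOpen (g : SmoothMetric n M) {U : Set M} (hU : IsOpen U) (hne : U.Nonempty) :
    0 < vol g U := by
  obtain ⟨a, ha⟩ := hne
  set φ := chartAt (Coord n) a
  have hopen := φ.open_source.inter hU
  refine lt_of_lt_of_le ?_ (measure_mono (inter_subset_right (s := φ.source)))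
  rw [vol_eq_chartVol g a hopen.measurableSet inter_subset_left,
    chartVol_apply g a hopen.measurableSet]
  have hm : MeasurableSet (φ.target ∩ φ.symm ⁻¹' (φ.source ∩ U)) :=
    measurableSet_chart_preimage a hopen.measurableSet
  have h2 : IsOpen (φ.target ∩ φ.symm ⁻¹' U) := φ.isOpen_inter_preimage_symm hU
  have h3 : 0 < volume (φ.target ∩ φ.symm ⁻¹' U) := by
    refine h2.measure_pos volume ⟨φ a, mem_chart_target _ a, ?_⟩
    simpa [φ.left_inv (mem_chart_source _ a)] using ha
  rw [pos_iff_ne_zero]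
  intro h0
  rw [lintegral_eq_zero_iff' ((aemeasurable_volDensity g a).mono_measure
      (Measure.restrict_mono inter_subset_left le_rfl))] at h0
  have h4 : ∀ᵐ z ∂(volume.restrict (φ.target ∩ φ.symm ⁻¹' (φ.source ∩ U))), False := by
    filter_upwards [h0, ae_restrict_mem hm] with z hz hzS
    have := volDensity_pos g a hzS.1
    simp only [Pi.zero_apply, ENNReal.ofReal_eq_zero] at hz
    linarith
  rw [Filter.eventually_false_iff_eq_bot, ae_eq_bot, Measure.restrict_eq_zero] at h4
  refine h3.ne' (measure_mono_null (fun z hz ↦ ?_) h4)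
  exact ⟨hz.1, φ.map_target hz.1, hz.2⟩

/-- The integral of a function supported in the domain of a chart, in coordinates. -/
lemma integral_vol_eq_chart (g : SmoothMetric n M) (a : M) {F : M → ℝ} (hF : Continuous F)
    (hs : ∀ y, y ∉ (chartAt (Coord n) a).source → F y = 0) :
    ∫ y, F y ∂(vol g) = ∫ z in (chartAt (Coord n) a).target,
      volDensity g a z * F ((chartAt (Coord n) a).symm z) := by
  rw [← setIntegral_eq_integral_of_forall_compl_eq_zero hs, vol_restrict_source, chartVol,
    integral_map (aemeasurable_chart_symm g a) hF.aestronglyMeasurable]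
  have hm : AEMeasurable (fun z ↦ Real.toNNReal (volDensity g a z))
      (volume.restrict (chartAt (Coord n) a).target) :=
    ((continuousOn_volDensity g a).aemeasurable
      (chartAt (Coord n) a).open_target.measurableSet).real_toNNReal
  have := integral_withDensity_eq_integral_smul₀ hm
    (fun z ↦ F ((chartAt (Coord n) a).symm z))
  refine this.trans (setIntegral_congr_fun (chartAt (Coord n) a).open_target.measurableSet
    fun z hz ↦ ?_)
  simp only [NNReal.smul_def, smul_eq_mul, Real.coe_toNNReal _ (volDensity_pos g a hz).le]

end Volume

/-! ### The Laplace–Beltrami operator and Green's formula in one chart. -/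

section Laplacian

variable {n : ℕ} {M : Type*} [TopologicalSpace M] [ChartedSpace (EuclideanSpace ℝ (Fin n)) M]
  [IsManifold (𝓡 n) ∞ M]

/-- Cramer's rule: the entries of the inverse are quotients of determinants. -/
lemma contDiffOn_matrix_inv {F : Type*} [NormedAddCommGroup F] [NormedSpace ℝ F] {s : Set F}
    {G : F → Matrix (Fin n) (Fin n) ℝ} {k : ℕ∞ω}
    (hG : ∀ i j, ContDiffOn ℝ k (fun q ↦ G q i j) s) (hdet : ∀ q ∈ s, (G q).det ≠ 0)
    (i j : Fin n) : ContDiffOn ℝ k (fun q ↦ (G q)⁻¹ i j) s := by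
  simp only [Matrix.inv_def, Ring.inverse_eq_inv', Matrix.smul_apply, smul_eq_mul,
    Matrix.adjugate_apply]
  refine ((contDiffOn_det hG).inv hdet).mul (contDiffOn_det fun k l ↦ ?_)
  by_cases hk : k = j
  · subst hk
    simpa using contDiffOn_const
  · simpa [Matrix.updateRow_ne hk] using hG k l

lemma contDiffOn_gram_inv (g : SmoothMetric n M) (a : M) (i j : Fin n) :
    ContDiffOn ℝ ∞ (fun z ↦ (gram g a z)⁻¹ i j) (chartAt (Coord n) a).target :=
  contDiffOn_matrix_inv (contDiffOn_gram_const g a) (fun _ hz ↦ (posDef_gram g a hz).det_pos.ne')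
    i j

lemma contDiffOn_comp_chart_symm {k : ℕ∞ω} (hk : k ≤ (∞ : ℕ∞ω)) {O : Set M} {h : M → ℝ}
    (hh : ∀ y ∈ O, ContMDiffAt (𝓡 n) 𝓘(ℝ, ℝ) k h y) (a : M) :
    ContDiffOn ℝ k (h ∘ (chartAt (Coord n) a).symm)
      ((chartAt (Coord n) a).target ∩ (chartAt (Coord n) a).symm ⁻¹' O) := by
  intro z hz
  have h1 : ContMDiffAt (𝓡 n) (𝓡 n) k (chartAt (Coord n) a).symm z :=
    ((contMDiffOn_chart_symm (I := 𝓡 n) (n := ∞) (x := a)).contMDiffAt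
      ((chartAt (Coord n) a).open_target.mem_nhds hz.1)).of_le hk
  exact ((hh _ hz.2).comp z h1).contDiffAt.contDiffWithinAt

lemma contDiffOn_pd {k : ℕ∞ω} {F : Coord n → ℝ} {V : Set (Coord n)} (hV : IsOpen V)
    (hF : ContDiffOn ℝ (k + 1) F V) (i : Fin n) : ContDiffOn ℝ k (pd i F) V :=
  (hF.fderiv_of_isOpen hV le_rfl).clm_apply contDiffOn_const

lemma mdifferentiableAt_of_contMDiffAt {k : ℕ∞ω} (hk : 1 ≤ k) {h : M → ℝ} {y : M}
    (hh : ContMDiffAt (𝓡 n) 𝓘(ℝ, ℝ) k h y) : MDifferentiableAt (𝓡 n) 𝓘(ℝ, ℝ) h y :=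
  hh.mdifferentiableAt (by rintro rfl; simp at hk)

lemma continuousOn_gradPair (g : SmoothMetric n M) {O : Set M} (hO : IsOpen O) {h k : M → ℝ}
    (hh : ∀ y ∈ O, ContMDiffAt (𝓡 n) 𝓘(ℝ, ℝ) 1 h y)
    (hk : ∀ y ∈ O, ContMDiffAt (𝓡 n) 𝓘(ℝ, ℝ) 1 k y) :
    ContinuousOn (gradPair g h k) O := by
  intro a ha
  set φ := chartAt (Coord n) a
  have hV : IsOpen (φ.target ∩ φ.symm ⁻¹' O) := φ.isOpen_inter_preimage_symm hO
  have h1 : ContinuousOn (fun z ↦ ∑ i, ∑ j, (gram g a z)⁻¹ i j * pd i (h ∘ φ.symm) z *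
      pd j (k ∘ φ.symm) z) (φ.target ∩ φ.symm ⁻¹' O) := by
    refine continuousOn_finsetSum _ fun i _ ↦ continuousOn_finsetSum _ fun j _ ↦ ?_
    refine ((((contDiffOn_gram_inv g a i j).continuousOn.mono inter_subset_left)).mul
      (contDiffOn_pd (k := 0) hV ?_ i).continuousOn).mul
      (contDiffOn_pd (k := 0) hV ?_ j).continuousOn
    · simpa using contDiffOn_comp_chart_symm (by simp) hh a
    · simpa using contDiffOn_comp_chart_symm (by simp) hk a
  have h2 : ContinuousOn (gradPair g h k) (φ.source ∩ O) := by
    refine (h1.comp (φ.continuousOn.mono inter_subset_left) fun y hy ↦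
      ⟨φ.map_source hy.1, by simpa [φ.left_inv hy.1] using hy.2⟩).congr fun y hy ↦ ?_
    have := gradPair_chart g a (φ.map_source hy.1) (h := h) (k := k)
      (by rw [φ.left_inv hy.1]; exact mdifferentiableAt_of_contMDiffAt le_rfl (hh y hy.2))
      (by rw [φ.left_inv hy.1]; exact mdifferentiableAt_of_contMDiffAt le_rfl (hk y hy.2))
    rw [φ.left_inv hy.1] at this
    exact this
  exact ((h2 a ⟨mem_chart_source _ a, ha⟩).continuousAt
    ((φ.open_source.inter hO).mem_nhds ⟨mem_chart_source _ a, ha⟩)).continuousWithinAt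

lemma dM_eq_zero_of_notMem_tsupport {h : M → ℝ} {y : M} (hy : y ∉ tsupport h) :
    dM (n := n) h y = 0 := by
  have h1 : h =ᶠ[𝓝 y] fun _ ↦ 0 := notMem_tsupport_iff_eventuallyEq.1 hy
  rw [dM_congr h1, dM_const]

lemma gradPair_eq_zero_of_notMem_tsupport (g : SmoothMetric n M) {h : M → ℝ} (k : M → ℝ) {y : M}
    (hy : y ∉ tsupport h) : gradPair g h k y = 0 := by
  rw [gradPair_eq_dM, dM_eq_zero_of_notMem_tsupport hy]; rfl

/-- The flux `√(det g) g^{ij} ∂_j h` in the chart preferred at `a`. -/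
def flux (g : SmoothMetric n M) (a : M) (h : M → ℝ) (i : Fin n) (z : Coord n) : ℝ :=
  volDensity g a z * ∑ j, (gram g a z)⁻¹ i j * pd j (h ∘ (chartAt (Coord n) a).symm) z

/-- The Laplace-Beltrami operator in the chart preferred at `a`. -/
def lapChart (g : SmoothMetric n M) (a : M) (h : M → ℝ) (z : Coord n) : ℝ :=
  (volDensity g a z)⁻¹ * ∑ i, pd i (flux g a h i) z

lemma laplacian_eq_lapChart (g : SmoothMetric n M) (h : M → ℝ) (y : M) :
    laplacian g h y = lapChart g y h (chartAt (Coord n) y y) := rfl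

lemma contDiffOn_flux (g : SmoothMetric n M) (a : M) {O : Set M} (hO : IsOpen O) {h : M → ℝ}
    (hh : ∀ y ∈ O, ContMDiffAt (𝓡 n) 𝓘(ℝ, ℝ) 2 h y) (i : Fin n) :
    ContDiffOn ℝ 1 (flux g a h i)
      ((chartAt (Coord n) a).target ∩ (chartAt (Coord n) a).symm ⁻¹' O) := by
  have hV := (chartAt (Coord n) a).isOpen_inter_preimage_symm hO
  refine (((contDiffOn_volDensity_const g a).of_le (by simp)).mono inter_subset_left).mul
    (ContDiffOn.sum fun j _ ↦ ?_)
  refine (((contDiffOn_gram_inv g a i j).of_le (by simp)).mono inter_subset_left).mul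
    (contDiffOn_pd (k := 1) hV ?_ j)
  simpa [one_add_one_eq_two] using contDiffOn_comp_chart_symm (k := 2) (by
    exact WithTop.coe_le_coe.2 le_top) hh a

lemma continuousOn_lapChart (g : SmoothMetric n M) (a : M) {O : Set M} (hO : IsOpen O) {h : M → ℝ}
    (hh : ∀ y ∈ O, ContMDiffAt (𝓡 n) 𝓘(ℝ, ℝ) 2 h y) :
    ContinuousOn (lapChart g a h)
      ((chartAt (Coord n) a).target ∩ (chartAt (Coord n) a).symm ⁻¹' O) := by
  have hV := (chartAt (Coord n) a).isOpen_inter_preimage_symm hO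
  refine (((continuousOn_volDensity g a).mono inter_subset_left).inv₀
    fun z hz ↦ (volDensity_pos g a hz.1).ne').mul
    (continuousOn_finsetSum _ fun i _ ↦ ?_)
  exact (contDiffOn_pd (k := 0) hV (by simpa using contDiffOn_flux g a hO hh i) i).continuousOn

/-- A function supported in the domain of a chart, read in this chart and extended by zero. -/
def chartExt (a : M) (ψ : M → ℝ) : Coord n → ℝ :=
  (chartAt (Coord n) a).target.indicator (ψ ∘ (chartAt (Coord n) a).symm)

lemma chartExt_apply (a : M) (ψ : M → ℝ) {z : Coord n} (hz : z ∈ (chartAt (Coord n) a).target) :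
    chartExt a ψ z = ψ ((chartAt (Coord n) a).symm z) := indicator_of_mem hz _

variable [T2Space M]

section ChartExt

variable {a : M} {ψ : M → ℝ}

lemma support_chartExt_subset : Function.support (chartExt a ψ) ⊆
    (chartAt (Coord n) a) '' (tsupport ψ ∩ (chartAt (Coord n) a).source) := by
  intro z hz
  have hz1 : z ∈ (chartAt (Coord n) a).target := by
    by_contra h
    exact hz (indicator_of_notMem h _)
  refine ⟨(chartAt (Coord n) a).symm z, ⟨subset_tsupport _ ?_,
    (chartAt (Coord n) a).map_target hz1⟩, (chartAt (Coord n) a).right_inv hz1⟩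
  rwa [Function.mem_support, chartExt_apply a ψ hz1] at hz

lemma isCompact_chart_image (hψ : HasCompactSupport ψ)
    (hs : tsupport ψ ⊆ (chartAt (Coord n) a).source) :
    IsCompact (chartAt (Coord n) a '' tsupport ψ) :=
  hψ.isCompact.image_of_continuousOn ((chartAt (Coord n) a).continuousOn.mono hs)

lemma tsupport_chartExt_subset (hψ : HasCompactSupport ψ)
    (hs : tsupport ψ ⊆ (chartAt (Coord n) a).source) :
    tsupport (chartExt a ψ) ⊆ chartAt (Coord n) a '' tsupport ψ := by
  refine closure_minimal (support_chartExt_subset.trans ?_) (isCompact_chart_image hψ hs).isClosed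
  exact image_mono inter_subset_left

lemma hasCompactSupport_chartExt (hψ : HasCompactSupport ψ)
    (hs : tsupport ψ ⊆ (chartAt (Coord n) a).source) : HasCompactSupport (chartExt (n := n) a ψ) :=
  (isCompact_chart_image hψ hs).of_isClosed_subset (isClosed_tsupport _)
    (tsupport_chartExt_subset hψ hs)

lemma tsupport_chartExt_subset_target (hψ : HasCompactSupport ψ)
    (hs : tsupport ψ ⊆ (chartAt (Coord n) a).source) {O : Set M} (hO : tsupport ψ ⊆ O) :
    tsupport (chartExt (n := n) a ψ) ⊆
      (chartAt (Coord n) a).target ∩ (chartAt (Coord n) a).symm ⁻¹' O := by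
  refine (tsupport_chartExt_subset hψ hs).trans ?_
  rintro _ ⟨y, hy, rfl⟩
  exact ⟨(chartAt (Coord n) a).map_source (hs hy), by
    simpa [(chartAt (Coord n) a).left_inv (hs hy)] using hO hy⟩

lemma contDiff_chartExt {k : ℕ∞ω} (hk : k ≤ (∞ : ℕ∞ω)) (hψ : HasCompactSupport ψ)
    (hs : tsupport ψ ⊆ (chartAt (Coord n) a).source) (hc : ContMDiff (𝓡 n) 𝓘(ℝ, ℝ) k ψ) :
    ContDiff ℝ k (chartExt (n := n) a ψ) := by
  rw [contDiff_iff_contDiffAt]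
  intro z
  by_cases hz : z ∈ tsupport (chartExt (n := n) a ψ)
  · have hzt := (tsupport_chartExt_subset_target hψ hs (subset_univ _) hz).1
    have h1 := contDiffOn_comp_chart_symm hk (O := univ) (fun y _ ↦ hc y) a
    rw [preimage_univ, inter_univ] at h1
    have hn := (chartAt (Coord n) a).open_target.mem_nhds hzt
    refine (h1.contDiffAt hn).congr_of_eventuallyEq ?_
    filter_upwards [hn] with w hw using chartExt_apply a ψ hw
  · exact contDiffAt_const.congr_of_eventuallyEq (notMem_tsupport_iff_eventuallyEq.1 hz)

lemma pd_chartExt {z : Coord n} (hz : z ∈ (chartAt (Coord n) a).target) (i : Fin n) :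
    pd i (chartExt a ψ) z = pd i (ψ ∘ (chartAt (Coord n) a).symm) z := by
  rw [pd, pd]
  congr 1
  refine Filter.EventuallyEq.fderiv_eq ?_
  filter_upwards [(chartAt (Coord n) a).open_target.mem_nhds hz] with w hw
    using chartExt_apply a ψ hw

end ChartExt

variable [MeasurableSpace M] [BorelSpace M] [SecondCountableTopology M]

instance isOpenPosMeasure_vol (g : SmoothMetric n M) : (vol g).IsOpenPosMeasure :=
  ⟨fun _ hU hne ↦ (vol_pos_of_isOpen g hU hne).ne'⟩

/-- Green's formula in a chart. -/
lemma green_chart (g : SmoothMetric n M) (a : M) {O : Set M} (hO : IsOpen O) {h ψ : M → ℝ}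
    (hh : ∀ y ∈ O, ContMDiffAt (𝓡 n) 𝓘(ℝ, ℝ) 2 h y) (hψ : HasCompactSupport ψ)
    (hs : tsupport ψ ⊆ (chartAt (Coord n) a).source) (hψO : tsupport ψ ⊆ O)
    (hc : ContMDiff (𝓡 n) 𝓘(ℝ, ℝ) 1 ψ) :
    ∫ z in (chartAt (Coord n) a).target,
      volDensity g a z * (ψ ((chartAt (Coord n) a).symm z) * lapChart g a h z) =
    -∫ y, gradPair g ψ h y ∂(vol g) := by
  set φ := chartAt (Coord n) a
  set Ψ := chartExt (n := n) a ψ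
  have hV : IsOpen (φ.target ∩ φ.symm ⁻¹' O) := φ.isOpen_inter_preimage_symm hO
  have hΨV : tsupport Ψ ⊆ φ.target ∩ φ.symm ⁻¹' O := tsupport_chartExt_subset_target hψ hs hψO
  have hΨc : HasCompactSupport Ψ := hasCompactSupport_chartExt hψ hs
  have hΨd : ContDiff ℝ 1 Ψ := contDiff_chartExt (by simp) hψ hs hc
  have hfl (i : Fin n) : ContDiffOn ℝ 1 (flux g a h i) (φ.target ∩ φ.symm ⁻¹' O) :=
    contDiffOn_flux g a hO hh i
  have hzero {z : Coord n} (hz : z ∉ φ.target) : Ψ z = 0 := indicator_of_notMem hz _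
  have hpd0 {z : Coord n} (hz : z ∉ φ.target) (i : Fin n) : pd i Ψ z = 0 := by
    have : z ∉ tsupport Ψ := fun h ↦ hz (hΨV h).1
    rw [pd, (notMem_tsupport_iff_eventuallyEq.1 this).fderiv_eq]
    simp
  have hcpd (i : Fin n) : Continuous (pd i Ψ) :=
    (hΨd.continuous_fderiv one_ne_zero).clm_apply continuous_const
  have hpdsub (i : Fin n) : tsupport (pd i Ψ) ⊆ tsupport Ψ := by
    refine closure_minimal (fun z hz ↦ ?_) (isClosed_tsupport _)
    by_contra hzz
    apply hz
    rw [pd, (notMem_tsupport_iff_eventuallyEq.1 hzz).fderiv_eq]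
    simp
  have hprod {F G : Coord n → ℝ} (hF : Continuous F) (hFs : tsupport F ⊆ tsupport Ψ)
      (hG : ContinuousOn G (φ.target ∩ φ.symm ⁻¹' O)) : Integrable (fun z ↦ F z * G z) := by
    have hFc : HasCompactSupport F := hΨc.of_isClosed_subset (isClosed_tsupport _) hFs
    have hcs : HasCompactSupport (fun z ↦ F z * G z) := hFc.mul_right
    refine Continuous.integrable_of_hasCompactSupport ?_ hcs
    refine ContinuousOn.continuous_of_tsupport_subset (hF.continuousOn.mul hG) hV ?_
    exact (tsupport_mul_subset_left).trans (hFs.trans hΨV)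
  have hpdf (i : Fin n) : ContinuousOn (fun z ↦ pd i (flux g a h i) z)
      (φ.target ∩ φ.symm ⁻¹' O) :=
    (contDiffOn_pd (k := 0) hV (by simpa using hfl i) i).continuousOn
  -- Euclidean integration by parts. The flux is `C¹` only on an open set, but that set contains the
  -- compact support of `Ψ`.
  have key (i : Fin n) : ∫ z, Ψ z * pd i (flux g a h i) z = -∫ z, pd i Ψ z * flux g a h i z := by
    refine integral_mul_fderiv_eq_neg_fderiv_mul_of_integrable ?_ ?_ ?_ ?_ ?_
    · exact hprod (hcpd i) (hpdsub i) (hfl i).continuousOn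
    · exact hprod hΨd.continuous subset_rfl (hpdf i)
    · exact hprod hΨd.continuous subset_rfl (hfl i).continuousOn
    · exact fun z _ ↦ (hΨd.differentiable one_ne_zero) z
    · exact fun z hz ↦ ((hfl i).contDiffAt (hV.mem_nhds (hΨV hz))).differentiableAt one_ne_zero
  have hL : ∫ z in φ.target, volDensity g a z * (ψ (φ.symm z) * lapChart g a h z) =
      ∫ z, ∑ i, Ψ z * pd i (flux g a h i) z := by
    rw [← setIntegral_eq_integral_of_forall_compl_eq_zero (s := φ.target)
      (f := fun z ↦ ∑ i, Ψ z * pd i (flux g a h i) z) (fun z hz ↦ by simp [hzero hz])]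
    refine setIntegral_congr_fun φ.open_target.measurableSet fun z hz ↦ ?_
    have hv := (volDensity_pos g a hz).ne'
    simp only [lapChart, ← Finset.mul_sum]
    rw [show Ψ z = ψ (φ.symm z) from chartExt_apply a ψ hz]
    field_simp
  have hcg : Continuous (gradPair g ψ h) := by
    refine ContinuousOn.continuous_of_tsupport_subset (s := O) ?_ hO ?_
    · exact continuousOn_gradPair g hO (fun y _ ↦ hc y) fun y hy ↦ (hh y hy).of_le (by
        exact_mod_cast one_le_two)
    · refine (closure_minimal (fun y hy ↦ ?_) (isClosed_tsupport ψ)).trans hψO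
      by_contra hyy
      exact hy (gradPair_eq_zero_of_notMem_tsupport g h hyy)
  have hR : ∫ y, gradPair g ψ h y ∂(vol g) = ∫ z, ∑ i, pd i Ψ z * flux g a h i z := by
    rw [integral_vol_eq_chart g a hcg
      (fun y hy ↦ gradPair_eq_zero_of_notMem_tsupport g h fun hyy ↦ hy (hs hyy)),
      ← setIntegral_eq_integral_of_forall_compl_eq_zero (s := φ.target)
      (f := fun z ↦ ∑ i, pd i Ψ z * flux g a h i z) (fun z hz ↦ by simp [hpd0 hz])]
    refine setIntegral_congr_fun φ.open_target.measurableSet fun z hz ↦ ?_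
    by_cases hzs : φ.symm z ∈ tsupport ψ
    · have h1 := gradPair_chart g a hz (h := ψ) (k := h)
        (mdifferentiableAt_of_contMDiffAt le_rfl (hc _))
        (mdifferentiableAt_of_contMDiffAt (by exact_mod_cast one_le_two) (hh _ (hψO hzs)))
      rw [h1, Finset.mul_sum]
      refine Finset.sum_congr rfl fun i _ ↦ ?_
      simp only [Ψ]
      rw [pd_chartExt hz, flux, Finset.mul_sum, Finset.mul_sum, Finset.mul_sum]
      exact Finset.sum_congr rfl fun j _ ↦ by ring
    · have h0 : z ∉ tsupport Ψ := by
        intro hzz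
        obtain ⟨y, hy, rfl⟩ := tsupport_chartExt_subset hψ hs hzz
        rw [φ.left_inv (hs hy)] at hzs
        exact hzs hy
      have h2 (i : Fin n) : pd i Ψ z = 0 := by
        by_contra hne
        exact h0 (hpdsub i (subset_tsupport _ hne))
      simp only [h2, zero_mul, Finset.sum_const_zero]
      exact mul_eq_zero_of_right _ (gradPair_eq_zero_of_notMem_tsupport g h hzs)
  rw [hL, hR, integral_finsetSum _ fun i _ ↦ hprod hΨd.continuous subset_rfl (hpdf i),
    integral_finsetSum _ fun i _ ↦ hprod (hcpd i) (hpdsub i) (hfl i).continuousOn,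
    ← Finset.sum_neg_distrib]
  exact Finset.sum_congr rfl fun i _ ↦ key i

end Laplacian

/-! ### Partitions of unity, chart independence of the Laplacian, Green's formula. -/

section Green

variable {n : ℕ} {M : Type*} [TopologicalSpace M] [ChartedSpace (EuclideanSpace ℝ (Fin n)) M]
  [IsManifold (𝓡 n) ∞ M] [T2Space M] [SecondCountableTopology M]

/-- A finite smooth partition of unity subordinate to a finite open cover of a closed set. -/
lemma exists_finite_partition {ι : Type*} [Fintype ι] {K : Set M} (hK : IsClosed K) (U : ι → Set M)
    (hU : ∀ i, IsOpen (U i)) (hKU : K ⊆ ⋃ i, U i) :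
    ∃ χ : ι → M → ℝ, (∀ i, ContMDiff (𝓡 n) 𝓘(ℝ, ℝ) ∞ (χ i)) ∧ (∀ i y, 0 ≤ χ i y) ∧
      (∀ i, tsupport (χ i) ⊆ U i) ∧ ∀ y ∈ K, ∑ i, χ i y = 1 := by
  have : LocallyCompactSpace M := ChartedSpace.locallyCompactSpace (Coord n) M
  obtain ⟨f, hf⟩ := SmoothPartitionOfUnity.exists_isSubordinate (𝓡 n) hK U hU hKU
  refine ⟨fun i ↦ f i, fun i ↦ (f i).contMDiff, fun i y ↦ f.nonneg i y, hf, fun y hy ↦ ?_⟩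
  have := f.sum_eq_one hy
  rwa [finsum_eq_sum_of_fintype] at this

/-- A smooth bump function at a point, supported in a given neighborhood. -/
lemma exists_bump {y : M} {W : Set M} (hW : W ∈ 𝓝 y) :
    ∃ ψ : M → ℝ, ContMDiff (𝓡 n) 𝓘(ℝ, ℝ) ∞ ψ ∧ HasCompactSupport ψ ∧ tsupport ψ ⊆ W ∧
      (∀ z, 0 ≤ ψ z) ∧ ψ y = 1 := by
  obtain ⟨f, -, hf⟩ := (SmoothBumpFunction.nhds_basis_tsupport (I := 𝓡 n) y).mem_iff.1 hW
  exact ⟨f, f.contMDiff, f.hasCompactSupport, hf, fun z ↦ f.nonneg, f.eq_one⟩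

variable [MeasurableSpace M] [BorelSpace M]

lemma continuous_mul_of_tsupport {ψ G : M → ℝ} {O : Set M} (hO : IsOpen O) (hψ : Continuous ψ)
    (hs : tsupport ψ ⊆ O) (hG : ContinuousOn G O) : Continuous fun y ↦ ψ y * G y :=
  ContinuousOn.continuous_of_tsupport_subset (hψ.continuousOn.mul hG) hO
    (tsupport_mul_subset_left.trans hs)

lemma continuousOn_lapChart_comp (g : SmoothMetric n M) (a : M) {O : Set M} (hO : IsOpen O)
    {h : M → ℝ} (hh : ∀ y ∈ O, ContMDiffAt (𝓡 n) 𝓘(ℝ, ℝ) 2 h y) :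
    ContinuousOn (fun y ↦ lapChart g a h (chartAt (Coord n) a y))
      ((chartAt (Coord n) a).source ∩ O) :=
  (continuousOn_lapChart g a hO hh).comp
    ((chartAt (Coord n) a).continuousOn.mono inter_subset_left)
    fun y hy ↦ ⟨(chartAt (Coord n) a).map_source hy.1, by
      simpa [(chartAt (Coord n) a).left_inv hy.1] using hy.2⟩

lemma green_lapChart (g : SmoothMetric n M) (a : M) {O : Set M} (hO : IsOpen O) {h ψ : M → ℝ}
    (hh : ∀ y ∈ O, ContMDiffAt (𝓡 n) 𝓘(ℝ, ℝ) 2 h y) (hψ : HasCompactSupport ψ)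
    (hs : tsupport ψ ⊆ (chartAt (Coord n) a).source) (hψO : tsupport ψ ⊆ O)
    (hc : ContMDiff (𝓡 n) 𝓘(ℝ, ℝ) 1 ψ) :
    ∫ y, ψ y * lapChart g a h (chartAt (Coord n) a y) ∂(vol g) =
    -∫ y, gradPair g ψ h y ∂(vol g) := by
  rw [← green_chart g a hO hh hψ hs hψO hc, integral_vol_eq_chart g a]
  · refine setIntegral_congr_fun (chartAt (Coord n) a).open_target.measurableSet fun z hz ↦ ?_
    simp only [(chartAt (Coord n) a).right_inv hz]
  · exact continuous_mul_of_tsupport ((chartAt (Coord n) a).open_source.inter hO) hc.continuous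
      (subset_inter hs hψO) (continuousOn_lapChart_comp g a hO hh)
  · intro y hy
    rw [image_eq_zero_of_notMem_tsupport fun h ↦ hy (hs h), zero_mul]

/-- The Laplace-Beltrami operator does not depend on the chart in which it is computed. -/
lemma lapChart_eq_laplacian (g : SmoothMetric n M) (a : M) {O : Set M} (hO : IsOpen O) {h : M → ℝ}
    (hh : ∀ y ∈ O, ContMDiffAt (𝓡 n) 𝓘(ℝ, ℝ) 2 h y) {y : M} (hyO : y ∈ O)
    (hya : y ∈ (chartAt (Coord n) a).source) :
    lapChart g a h (chartAt (Coord n) a y) = laplacian g h y := by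
  rw [laplacian_eq_lapChart]
  -- No second derivatives are transformed. If the two expressions differed at `y`, their difference
  -- would have a sign nearby; tested against a bump function, both integrate to `-∫ ⟨∇ψ, ∇h⟩`,
  -- which involves no chart, so the difference integrates to zero, a contradiction.
  have aux : ∀ a b : M, y ∈ (chartAt (Coord n) a).source → y ∈ (chartAt (Coord n) b).source →
      lapChart g a h (chartAt (Coord n) a y) ≤ lapChart g b h (chartAt (Coord n) b y) := by
    intro a b hya hyb
    by_contra! hlt
    set D := fun y ↦ lapChart g a h (chartAt (Coord n) a y) -
      lapChart g b h (chartAt (Coord n) b y)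
    set W := ((chartAt (Coord n) a).source ∩ O) ∩ ((chartAt (Coord n) b).source ∩ O)
    have hW : IsOpen W := (((chartAt (Coord n) a).open_source.inter hO)).inter
      ((chartAt (Coord n) b).open_source.inter hO)
    have hDa := (continuousOn_lapChart_comp g a hO hh).mono (inter_subset_left (s :=
      ((chartAt (Coord n) a).source ∩ O)) (t := ((chartAt (Coord n) b).source ∩ O)))
    have hDb := (continuousOn_lapChart_comp g b hO hh).mono (inter_subset_right (s :=
      ((chartAt (Coord n) a).source ∩ O)) (t := ((chartAt (Coord n) b).source ∩ O)))
    have hD : ContinuousOn D W := hDa.sub hDb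
    have hDy : 0 < D y := sub_pos.2 hlt
    have hyW : y ∈ W := ⟨⟨hya, hyO⟩, hyb, hyO⟩
    have hn : W ∩ {y | 0 < D y} ∈ 𝓝 y := inter_mem (hW.mem_nhds hyW)
      ((hD.continuousAt (hW.mem_nhds hyW)).eventually (lt_mem_nhds hDy))
    obtain ⟨ψ, hψ, hψc, hψs, hψ0, hψ1⟩ := exists_bump (n := n) hn
    have hsW : tsupport ψ ⊆ W := hψs.trans inter_subset_left
    have ha1 := continuous_mul_of_tsupport hW hψ.continuous hsW hDa
    have hb1 := continuous_mul_of_tsupport hW hψ.continuous hsW hDb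
    have hg1 := green_lapChart g a hO hh hψc (hsW.trans fun y hy ↦ hy.1.1)
      (hsW.trans fun y hy ↦ hy.1.2) (hψ.of_le (by simp))
    have hg2 := green_lapChart g b hO hh hψc (hsW.trans fun y hy ↦ hy.2.1)
      (hsW.trans fun y hy ↦ hy.1.2) (hψ.of_le (by simp))
    have hint : ∫ y, ψ y * D y ∂(vol g) = 0 := by
      have : (fun y ↦ ψ y * D y) = fun y ↦ ψ y * lapChart g a h (chartAt (Coord n) a y) -
        ψ y * lapChart g b h (chartAt (Coord n) b y) := by ext y; ring
      rw [this, integral_sub (ha1.integrable_of_hasCompactSupport hψc.mul_right)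
        (hb1.integrable_of_hasCompactSupport hψc.mul_right), hg1, hg2, sub_self]
    have hpos := (continuous_mul_of_tsupport hW hψ.continuous hsW
      hD).integral_pos_of_hasCompactSupport_nonneg_nonzero (μ := vol g) hψc.mul_right
      (fun z ↦ ?_) (x := y) (by rw [hψ1, one_mul]; exact hDy.ne')
    · exact hpos.ne' hint
    · by_cases hz : z ∈ tsupport ψ
      · exact mul_nonneg (hψ0 z) (hψs hz).2.le
      · simp [image_eq_zero_of_notMem_tsupport hz]
  exact le_antisymm (aux a y hya (mem_chart_source _ y)) (aux y a (mem_chart_source _ y) hya)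

/-- `laplacian` uses a different chart at each point. Near a given point it coincides with
`lapChart` in one fixed chart, which is continuous. -/
lemma continuousOn_laplacian (g : SmoothMetric n M) {O : Set M} (hO : IsOpen O) {h : M → ℝ}
    (hh : ∀ y ∈ O, ContMDiffAt (𝓡 n) 𝓘(ℝ, ℝ) 2 h y) : ContinuousOn (laplacian g h) O := by
  intro a ha
  have h1 := (continuousOn_lapChart_comp g a hO hh).congr
    (g := laplacian g h) fun y hy ↦ (lapChart_eq_laplacian g a hO hh hy.2 hy.1).symm
  exact (h1.continuousAt (((chartAt (Coord n) a).open_source.inter hO).mem_nhds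
    ⟨mem_chart_source _ a, ha⟩)).continuousWithinAt

lemma continuous_gradPair_of_tsupport (g : SmoothMetric n M) {O : Set M} (hO : IsOpen O)
    {h ψ : M → ℝ} (hh : ∀ y ∈ O, ContMDiffAt (𝓡 n) 𝓘(ℝ, ℝ) 1 h y)
    (hψO : tsupport ψ ⊆ O) (hc : ContMDiff (𝓡 n) 𝓘(ℝ, ℝ) 1 ψ) :
    Continuous (gradPair g ψ h) := by
  refine ContinuousOn.continuous_of_tsupport_subset (s := O)
    (continuousOn_gradPair g hO (fun y _ ↦ hc y) hh) hO ?_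
  refine (closure_minimal (fun y hy ↦ ?_) (isClosed_tsupport ψ)).trans hψO
  by_contra hyy
  exact hy (gradPair_eq_zero_of_notMem_tsupport g h hyy)

lemma hasCompactSupport_gradPair (g : SmoothMetric n M) {h ψ : M → ℝ} (hψ : HasCompactSupport ψ) :
    HasCompactSupport (gradPair g ψ h) :=
  HasCompactSupport.intro hψ fun _ hy ↦ gradPair_eq_zero_of_notMem_tsupport g h hy

/-- Green's formula. -/
lemma green (g : SmoothMetric n M) {O : Set M} (hO : IsOpen O) {h ψ : M → ℝ}
    (hh : ∀ y ∈ O, ContMDiffAt (𝓡 n) 𝓘(ℝ, ℝ) 2 h y) (hψ : HasCompactSupport ψ)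
    (hψO : tsupport ψ ⊆ O) (hc : ContMDiff (𝓡 n) 𝓘(ℝ, ℝ) 1 ψ) :
    ∫ y, ψ y * laplacian g h y ∂(vol g) = -∫ y, gradPair g ψ h y ∂(vol g) := by
  obtain ⟨t, ht⟩ := hψ.isCompact.elim_finite_subcover
    (fun a : M ↦ (chartAt (Coord n) a).source) (fun a ↦ (chartAt (Coord n) a).open_source)
    fun y _ ↦ mem_iUnion.2 ⟨y, mem_chart_source _ y⟩
  -- Both sides are linear in `ψ`, so it suffices to treat the pieces `χ i * ψ`, each supported in
  -- one chart domain.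
  obtain ⟨χ, hχ, -, hχs, hχ1⟩ := exists_finite_partition (n := n) (isClosed_tsupport ψ)
    (fun a : t ↦ (chartAt (Coord n) (a : M)).source) (fun a ↦ (chartAt (Coord n) _).open_source)
    (fun y hy ↦ by
      obtain ⟨i, hi, hyi⟩ := mem_iUnion₂.1 (ht hy)
      exact mem_iUnion.2 ⟨⟨i, hi⟩, hyi⟩)
  have hh1 : ∀ y ∈ O, ContMDiffAt (𝓡 n) 𝓘(ℝ, ℝ) 1 h y := fun y hy ↦
    (hh y hy).of_le (by exact_mod_cast one_le_two)
  have hsum (y : M) : ∑ i, χ i y * ψ y = ψ y := by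
    rw [← Finset.sum_mul]
    by_cases hy : y ∈ tsupport ψ
    · rw [hχ1 y hy, one_mul]
    · rw [image_eq_zero_of_notMem_tsupport hy, mul_zero]
  have hci (i : t) : ContMDiff (𝓡 n) 𝓘(ℝ, ℝ) 1 fun y ↦ χ i y * ψ y :=
    ((hχ i).of_le (by simp)).mul hc
  have hsi (i : t) : HasCompactSupport fun y ↦ χ i y * ψ y := hψ.mul_left
  have hsO (i : t) : tsupport (fun y ↦ χ i y * ψ y) ⊆ O := tsupport_mul_subset_right.trans hψO
  have hgi (i : t) : ∫ y, χ i y * ψ y * laplacian g h y ∂(vol g) =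
      -∫ y, gradPair g (fun y ↦ χ i y * ψ y) h y ∂(vol g) := by
    have hs : tsupport (fun y ↦ χ i y * ψ y) ⊆ (chartAt (Coord n) (i : M)).source :=
      tsupport_mul_subset_left.trans (hχs i)
    rw [← green_lapChart g (i : M) hO hh (hsi i) hs (hsO i) (hci i)]
    congr 1
    ext y
    by_cases hy : y ∈ tsupport (fun y ↦ χ i y * ψ y)
    · rw [lapChart_eq_laplacian g _ hO hh (hsO i hy) (hs hy)]
    · have : χ i y * ψ y = 0 := image_eq_zero_of_notMem_tsupport (f := fun y ↦ χ i y * ψ y) hy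
      rw [this, zero_mul, zero_mul]
  have hgrad (y : M) : gradPair g ψ h y = ∑ i, gradPair g (fun y ↦ χ i y * ψ y) h y := by
    simp only [gradPair_eq_dM]
    have : dM (n := n) ψ y = ∑ i, dM (n := n) (fun y ↦ χ i y * ψ y) y := by
      rw [← dM_sum Finset.univ fun i _ ↦ mdifferentiableAt_of_contMDiffAt le_rfl (hci i y)]
      simp only [hsum]
    rw [this, sum_apply]
  simp only [hgrad]
  rw [integral_finsetSum _ fun i _ ↦ (continuous_gradPair_of_tsupport g hO hh1 (hsO i)
    (hci i)).integrable_of_hasCompactSupport (hasCompactSupport_gradPair g (hsi i)),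
    ← Finset.sum_neg_distrib, ← Finset.sum_congr rfl fun i _ ↦ hgi i,
    ← integral_finsetSum _ fun i _ ↦ (continuous_mul_of_tsupport hO (hci i).continuous (hsO i)
      (continuousOn_laplacian g hO hh)).integrable_of_hasCompactSupport (hsi i).mul_right]
  congr 1
  ext y
  rw [← Finset.sum_mul, hsum]

end Green

/-! ### Smooth approximation with control of the differential: mollification and gluing. -/

section Approximation

section Mollify

variable {n : ℕ}

/-- Mollification of a compactly supported continuous function. Every uniform first order
approximation of the increments of `Ψ` near a point is inherited by the differential of the
mollified function. -/
lemma exists_mollified {Ψ : Coord n → ℝ} (hΨ : Continuous Ψ) (hc : HasCompactSupport Ψ) {ρ ε : ℝ}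
    (hρ : 0 < ρ) (hε : 0 < ε) :
    ∃ k : Coord n → ℝ, ContDiff ℝ ∞ k ∧ (∀ z, |k z - Ψ z| ≤ ε) ∧
      ∀ (z v : Coord n) (c b : ℝ), 0 ≤ b →
        (∃ s₀ > 0, ∀ z' ∈ Metric.ball z ρ, ∀ s : ℝ, |s| < s₀ →
          |Ψ (z' + s • v) - Ψ z' - s * c| ≤ |s| * b) →
        |fderiv ℝ k z v - c| ≤ b := by
  have hu : UniformContinuous Ψ := hc.uniformContinuous_of_continuous hΨ
  obtain ⟨δ, hδ, hδΨ⟩ := Metric.uniformContinuous_iff.1 hu ε hε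
  set R := min ρ δ
  have hR : 0 < R := lt_min hρ hδ
  set φ : ContDiffBump (0 : Coord n) := ⟨R / 2, R, half_pos hR, half_lt_self hR⟩
  have hsupp : Function.support (φ.normed volume) ⊆ Metric.ball 0 R := by
    rw [φ.support_normed_eq]
  set K : (Coord n → ℝ) → Coord n → ℝ := fun F ↦
    MeasureTheory.convolution (φ.normed volume) F (ContinuousLinearMap.lsmul ℝ ℝ) volume
  have hKint {F : Coord n → ℝ} (hF : Continuous F) (z : Coord n) :
      Integrable fun t ↦ φ.normed volume t * F (z - t) :=
    (φ.continuous_normed.mul (by fun_prop)).integrable_of_hasCompactSupport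
      φ.hasCompactSupport_normed.mul_right
  have hKdef (F : Coord n → ℝ) (z : Coord n) :
      K F z = ∫ t, φ.normed volume t * F (z - t) := by
    simp [K, MeasureTheory.convolution_def]
  have hsm : ContDiff ℝ ∞ (K Ψ) :=
    φ.hasCompactSupport_normed.contDiff_convolution_left _ φ.contDiff_normed
      hΨ.locallyIntegrable
  refine ⟨K Ψ, hsm, fun z ↦ ?_, fun z v c b hb hbd ↦ ?_⟩
  · have := φ.dist_normed_convolution_le (μ := volume) (x₀ := z) (ε := ε)
      hΨ.aestronglyMeasurable (g := Ψ) fun x hx ↦ ?_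
    · simpa [Real.dist_eq] using this
    · exact (hδΨ (lt_of_lt_of_le (Metric.mem_ball.1 hx) (min_le_right _ _))).le
  · obtain ⟨s₀, hs₀, hs⟩ := hbd
    have hshift (s : ℝ) : K (fun z' ↦ Ψ (z' + s • v) - Ψ z') z = K Ψ (z + s • v) - K Ψ z := by
      rw [hKdef, hKdef, hKdef, ← integral_sub (hKint hΨ _) (hKint hΨ _)]
      congr 1
      ext t
      rw [mul_sub, show z - t + s • v = z + s • v - t by abel]
    -- The increment `K Ψ (z + s v) - K Ψ z` is an average of increments of `Ψ` starting within
    -- distance `ρ` of `z`, so it deviates from `s c` by at most `|s| b`. This bounds the derivative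
    -- at `s = 0` of the function below.
    have hder : HasDerivAt (fun s : ℝ ↦ K Ψ (z + s • v) - s * c) (fderiv ℝ (K Ψ) z v - c) 0 := by
      have h1 : HasDerivAt (fun s : ℝ ↦ z + s • v) v 0 := by
        simpa using ((hasDerivAt_id (0 : ℝ)).smul_const v).const_add z
      have h2 : HasFDerivAt (K Ψ) (fderiv ℝ (K Ψ) z) (z + (0 : ℝ) • v) := by
        simpa using (hsm.differentiable (by simp) z).hasFDerivAt
      have h3 := h2.comp_hasDerivAt (0 : ℝ) h1
      have h4 : HasDerivAt (fun s : ℝ ↦ s * c) c 0 := by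
        simpa using (hasDerivAt_id (0 : ℝ)).mul_const c
      exact h3.sub h4
    have := hder.le_of_lip' hb ?_
    · simpa using this
    · have hball : Metric.ball (0 : ℝ) s₀ ∈ 𝓝 (0 : ℝ) := Metric.ball_mem_nhds _ hs₀
      filter_upwards [hball] with s hsb
      have hs' : |s| < s₀ := by simpa using hsb
      have h5 := dist_convolution_le (μ := volume) (f := φ.normed volume) (x₀ := z) (R := R)
        (ε := |s| * b) (z₀ := s * c) (g := fun z' ↦ Ψ (z' + s • v) - Ψ z') (by positivity) hsupp
        φ.nonneg_normed φ.integral_normed (by fun_prop) fun z' hz' ↦ ?_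
      · change dist (K (fun z' ↦ Ψ (z' + s • v) - Ψ z') z) (s * c) ≤ |s| * b at h5
        rw [hshift, Real.dist_eq] at h5
        simp only [Real.norm_eq_abs, zero_smul, add_zero, zero_mul, sub_zero]
        calc _ = |K Ψ (z + s • v) - K Ψ z - s * c| := by congr 1; ring
          _ ≤ |s| * b := h5
          _ = b * |s| := mul_comm _ _
      · rw [Real.dist_eq]
        exact hs z' (Metric.ball_subset_ball (min_le_left _ _) hz') s hs'

end Mollify

variable {n : ℕ} {M : Type*} [TopologicalSpace M] [ChartedSpace (EuclideanSpace ℝ (Fin n)) M]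
  [IsManifold (𝓡 n) ∞ M] [T2Space M] [SecondCountableTopology M]

lemma contMDiff_mul_of_tsupport {k : ℕ∞ω} {χ h : M → ℝ} {U : Set M}
    (hχ : ContMDiff (𝓡 n) 𝓘(ℝ, ℝ) k χ) (hs : tsupport χ ⊆ U)
    (hh : ∀ z ∈ U, ContMDiffAt (𝓡 n) 𝓘(ℝ, ℝ) k h z) :
    ContMDiff (𝓡 n) 𝓘(ℝ, ℝ) k fun z ↦ χ z * h z := by
  intro z
  by_cases hz : z ∈ tsupport χ
  · exact (hχ z).mul (hh z (hs hz))
  · refine (contMDiffAt_const (c := (0 : ℝ))).congr_of_eventuallyEq ?_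
    filter_upwards [notMem_tsupport_iff_eventuallyEq.1 hz] with w hw
    simp [hw]

lemma exists_dM_bound (g : SmoothMetric n M) {χ : M → ℝ} (hχ : ContMDiff (𝓡 n) 𝓘(ℝ, ℝ) 1 χ)
    (hc : HasCompactSupport χ) :
    ∃ C, 0 ≤ C ∧ ∀ z v, |dM χ z v| ≤ C * √(innerM g z v v) := by
  have hcont : Continuous (gradPair g χ χ) := by
    rw [← continuousOn_univ]
    exact continuousOn_gradPair g isOpen_univ (fun y _ ↦ hχ y) (fun y _ ↦ hχ y)
  have hcs : HasCompactSupport (gradPair g χ χ) :=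
    HasCompactSupport.intro hc fun _ hy ↦ gradPair_eq_zero_of_notMem_tsupport g χ hy
  obtain ⟨C, hC⟩ := hcont.bounded_above_of_compact_support hcs
  refine ⟨√C, Real.sqrt_nonneg _, fun z v ↦ ?_⟩
  have h1 := dM_sq_le g χ z v
  have h2 : gradPair g χ χ z ≤ C := (le_abs_self _).trans (hC z)
  rw [← Real.sqrt_mul' _ (innerM_self_nonneg g z v)]
  refine Real.abs_le_sqrt (h1.trans ?_)
  exact mul_le_mul_of_nonneg_right h2 (innerM_self_nonneg g z v)

/-- Local first order approximations of a compactly supported function by smooth functions can be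
glued. -/
lemma exists_smooth_approx (g : SmoothMetric n M) {θ : M → ℝ} {ξ : M → Coord n →L[ℝ] ℝ}
    (hθ : HasCompactSupport θ) {O : Set M} (hO : IsOpen O) (hθO : tsupport θ ⊆ O)
    (hξ : ∀ y ∉ tsupport θ, ξ y = 0) {L : ℝ} (hL : 0 ≤ L)
    (hloc : ∀ y ∈ tsupport θ, ∃ U, IsOpen U ∧ y ∈ U ∧ ∀ ε > 0, ∃ h : M → ℝ,
      (∀ z ∈ U, ContMDiffAt (𝓡 n) 𝓘(ℝ, ℝ) ∞ h z) ∧ ∀ z ∈ U, |h z - θ z| ≤ ε ∧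
        ∀ v, |dM h z v - ξ z v| ≤ L * √(innerM g z v v))
    {ε : ℝ} (hε : 0 < ε) :
    ∃ κ : M → ℝ, ContMDiff (𝓡 n) 𝓘(ℝ, ℝ) ∞ κ ∧ HasCompactSupport κ ∧ tsupport κ ⊆ O ∧
      ∀ z, |κ z - θ z| ≤ ε ∧ ∀ v, |dM κ z v - ξ z v| ≤ (L + ε) * √(innerM g z v v) := by
  classical
  have : LocallyCompactSpace M := ChartedSpace.locallyCompactSpace (Coord n) M
  obtain ⟨O', hO', hKO', hO'O, hO'c⟩ :=
    exists_open_between_and_isCompact_closure hθ.isCompact hO hθO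
  choose! U hU hyU hUh using hloc
  obtain ⟨t, htK, ht⟩ := hθ.isCompact.elim_nhds_subcover U
    fun y hy ↦ (hU y hy).mem_nhds (hyU y hy)
  -- The index `none` covers the complement of the support, where the zero function is an exact
  -- approximation. Intersecting with `O'` keeps the other pieces in a compact subset of `O`.
  set V : Option t → Set M := fun j ↦ j.elim (tsupport θ)ᶜ fun i ↦ U i ∩ O'
  have hV : ∀ j, IsOpen (V j) := by
    rintro (_ | i)
    · exact (isClosed_tsupport θ).isOpen_compl
    · exact (hU i (htK i i.2)).inter hO'
  obtain ⟨χ, hχ, hχ0, hχV, hχ1⟩ := exists_finite_partition (n := n) isClosed_univ V hV (by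
    intro y _
    by_cases hy : y ∈ tsupport θ
    · obtain ⟨i, hi, hyi⟩ := mem_iUnion₂.1 (ht hy)
      exact mem_iUnion.2 ⟨some ⟨i, hi⟩, hyi, hKO' hy⟩
    · exact mem_iUnion.2 ⟨none, hy⟩)
  have hχc (i : t) : HasCompactSupport (χ (some i)) :=
    hO'c.of_isClosed_subset (isClosed_tsupport _)
      ((hχV (some i)).trans (inter_subset_right.trans subset_closure))
  choose C hC0 hC using fun i : t ↦ exists_dM_bound g ((hχ (some i)).of_le (by simp)) (hχc i)
  -- Local approximations this close in value make the error terms `(h i - θ) dχ i` add up to at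
  -- most `ε` times the length of the vector; the `1` also ensures `ε' ≤ ε`.
  set ε' := ε / (1 + ∑ i, C i)
  have hCs : 0 ≤ ∑ i, C i := Finset.sum_nonneg fun i _ ↦ hC0 i
  have hε' : 0 < ε' := by positivity
  have hε'1 : ε' ≤ ε := div_le_self hε.le (by linarith)
  have hε'2 : ε' * ∑ i, C i ≤ ε := by
    rw [div_mul_eq_mul_div, div_le_iff₀ (by linarith)]
    nlinarith
  choose h hhs hh using fun i : t ↦ hUh i (htK i i.2) ε' hε'
  set H : Option t → M → ℝ := fun j ↦ j.elim (fun _ ↦ 0) fun i ↦ h i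
  set C' : Option t → ℝ := fun j ↦ j.elim 0 C
  have hHs : ∀ j, ∀ z ∈ V j, ContMDiffAt (𝓡 n) 𝓘(ℝ, ℝ) ∞ (H j) z := by
    rintro (_ | i) z hz
    · exact contMDiffAt_const
    · exact hhs i z hz.1
  have hHv : ∀ j, ∀ z ∈ V j, |H j z - θ z| ≤ ε' := by
    rintro (_ | i) z hz
    · simp only [H, Option.elim, image_eq_zero_of_notMem_tsupport hz]
      simpa using hε'.le
    · exact (hh i z hz.1).1
  have hHd : ∀ j, ∀ z ∈ V j, ∀ v, |dM (n := n) (H j) z v - ξ z v| ≤ L * √(innerM g z v v) := by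
    rintro (_ | i) z hz v
    · have h1 : dM (n := n) (H none) z = 0 := dM_const 0 z
      simp only [h1, hξ z hz]
      simp
      positivity
    · exact (hh i z hz.1).2 v
  have hHC : ∀ j, ∀ z ∈ V j, ∀ v, |(H j z - θ z) * dM (n := n) (χ j) z v| ≤
      ε' * C' j * √(innerM g z v v) := by
    rintro (_ | i) z hz v
    · simp only [H, C', Option.elim, image_eq_zero_of_notMem_tsupport hz]
      simp
    · rw [abs_mul, mul_assoc]
      exact mul_le_mul (hHv (some i) z hz) (hC i z v) (abs_nonneg _) hε'.le
  have hC'0 : ∀ j, 0 ≤ C' j := by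
    rintro (_ | i)
    · exact le_rfl
    · exact hC0 i
  have hC's : ∑ j, C' j = ∑ i, C i := by
    rw [Fintype.sum_option]
    simp [C']
  have hsm (j : Option t) : ContMDiff (𝓡 n) 𝓘(ℝ, ℝ) ∞ fun z ↦ χ j z * H j z :=
    contMDiff_mul_of_tsupport (hχ j) (hχV j) (hHs j)
  have hsum1 (z : M) : ∑ j, χ j z = 1 := hχ1 z (mem_univ z)
  have hκs : ContMDiff (𝓡 n) 𝓘(ℝ, ℝ) ∞ fun z ↦ ∑ j, χ j z * H j z :=
    contMDiff_finsetSum fun j _ ↦ hsm j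
  have hsub : Function.support (fun z ↦ ∑ j, χ j z * H j z) ⊆ closure O' := by
    intro z hz
    by_contra hzO
    refine hz (Finset.sum_eq_zero fun j _ ↦ ?_)
    rcases j with _ | i
    · simp [H]
    · rw [image_eq_zero_of_notMem_tsupport (f := χ (some i)) fun hzs ↦
        hzO (subset_closure (hχV _ hzs).2), zero_mul]
  have htsub : tsupport (fun z ↦ ∑ j, χ j z * H j z) ⊆ closure O' :=
    closure_minimal hsub isClosed_closure
  refine ⟨fun z ↦ ∑ j, χ j z * H j z, hκs, hO'c.of_isClosed_subset (isClosed_tsupport _) htsub,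
    htsub.trans hO'O, fun z ↦ ⟨?_, fun v ↦ ?_⟩⟩
  · have h1 : ∑ j, χ j z * H j z - θ z = ∑ j, χ j z * (H j z - θ z) := by
      simp only [mul_sub, Finset.sum_sub_distrib, ← Finset.sum_mul, hsum1, one_mul]
    rw [h1]
    calc _ ≤ ∑ j, |χ j z * (H j z - θ z)| := Finset.abs_sum_le_sum_abs _ _
      _ ≤ ∑ j, χ j z * ε' := by
        refine Finset.sum_le_sum fun j _ ↦ ?_
        rw [abs_mul, abs_of_nonneg (hχ0 j z)]
        by_cases hz : z ∈ tsupport (χ j)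
        · exact mul_le_mul_of_nonneg_left (hHv j z (hχV j hz)) (hχ0 j z)
        · simp [image_eq_zero_of_notMem_tsupport hz]
      _ ≤ ε := by rw [← Finset.sum_mul, hsum1, one_mul]; exact hε'1
  · set s := √(innerM g z v v)
    have hs0 : 0 ≤ s := Real.sqrt_nonneg _
    have hd1 : dM (n := n) (fun z ↦ ∑ j, χ j z * H j z) z v =
        ∑ j, dM (n := n) (fun z ↦ χ j z * H j z) z v := by
      rw [dM_sum Finset.univ fun j _ ↦ mdifferentiableAt_of_contMDiffAt (by simp) (hsm j z),
        sum_apply]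
    have hd2 : ∑ j, dM (n := n) (χ j) z v = 0 := by
      rw [← sum_apply, ← dM_sum Finset.univ fun j _ ↦ mdifferentiableAt_of_contMDiffAt (by simp)
        (hχ j z)]
      simp only [hsum1]
      rw [dM_const]; rfl
    -- Since `∑ χ j = 1`, also `∑ dχ j = 0`, so `θ ∑ dχ j` may be subtracted. The derivatives of the
    -- partition then multiply only the small differences `H j - θ`.
    have hd3 : dM (n := n) (fun z ↦ ∑ j, χ j z * H j z) z v - ξ z v =
        ∑ j, (dM (n := n) (fun z ↦ χ j z * H j z) z v - χ j z * ξ z v -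
          θ z * dM (n := n) (χ j) z v) := by
      rw [hd1, Finset.sum_sub_distrib, Finset.sum_sub_distrib, ← Finset.sum_mul, ← Finset.mul_sum,
        hsum1, hd2]
      ring
    rw [hd3]
    calc _ ≤ ∑ j, |dM (n := n) (fun z ↦ χ j z * H j z) z v - χ j z * ξ z v -
          θ z * dM (n := n) (χ j) z v| := Finset.abs_sum_le_sum_abs _ _
      _ ≤ ∑ j, (χ j z * (L * s) + ε' * C' j * s) := by
        refine Finset.sum_le_sum fun j _ ↦ ?_
        by_cases hz : z ∈ tsupport (χ j)
        · have hzV := hχV j hz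
          rw [dM_mul (mdifferentiableAt_of_contMDiffAt (by simp) (hχ j z))
            (mdifferentiableAt_of_contMDiffAt (by simp) (hHs j z hzV))]
          have h2 : (χ j z • dM (n := n) (H j) z + H j z • dM (n := n) (χ j) z) v -
              χ j z * ξ z v - θ z * dM (n := n) (χ j) z v =
              χ j z * (dM (n := n) (H j) z v - ξ z v) +
              (H j z - θ z) * dM (n := n) (χ j) z v := by
            simp only [add_apply, smul_apply, smul_eq_mul]
            ring
          rw [h2]
          refine (abs_add_le _ _).trans (add_le_add ?_ (hHC j z hzV v))
          rw [abs_mul, abs_of_nonneg (hχ0 j z)]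
          exact mul_le_mul_of_nonneg_left (hHd j z hzV v) (hχ0 j z)
        · have h3 : z ∉ tsupport fun z ↦ χ j z * H j z := fun h ↦ hz (tsupport_mul_subset_left h)
          rw [dM_eq_zero_of_notMem_tsupport h3, dM_eq_zero_of_notMem_tsupport hz,
            image_eq_zero_of_notMem_tsupport hz]
          have := hC'0 j
          simp
          positivity
      _ = L * s + (ε' * ∑ i, C i) * s := by
        rw [Finset.sum_add_distrib, ← Finset.sum_mul, hsum1, one_mul, ← Finset.sum_mul,
          ← Finset.mul_sum, hC's]
      _ ≤ (L + ε) * s := by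
        rw [add_mul]
        gcongr

/-- First order approximations in coordinates give local smooth approximations. -/
lemma exists_local_approx (g : SmoothMetric n M) {θ : M → ℝ} (hθ : Continuous θ)
    (ξ : M → Coord n →L[ℝ] ℝ) (y : M) {L R : ℝ} (hL : 0 ≤ L) (hR : 0 < R)
    (H : ∀ ζ ∈ Metric.ball (chartAt (Coord n) y y) R ∩ (chartAt (Coord n) y).target,
      ∀ w, ∀ z' ∈ Metric.ball (chartAt (Coord n) y y) R, ∀ s : ℝ,
      z' + s • w ∈ Metric.ball (chartAt (Coord n) y y) R →
      |θ ((chartAt (Coord n) y).symm (z' + s • w)) - θ ((chartAt (Coord n) y).symm z') -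
        s * ξ ((chartAt (Coord n) y).symm ζ) (chartSymmDeriv y ζ w)| ≤
      |s| * (L * √(innerM g ((chartAt (Coord n) y).symm ζ) (chartSymmDeriv y ζ w)
        (chartSymmDeriv y ζ w)))) :
    ∃ U, IsOpen U ∧ y ∈ U ∧ ∀ ε > 0, ∃ h : M → ℝ,
      (∀ z ∈ U, ContMDiffAt (𝓡 n) 𝓘(ℝ, ℝ) ∞ h z) ∧ ∀ z ∈ U, |h z - θ z| ≤ ε ∧
        ∀ v, |dM h z v - ξ z v| ≤ L * √(innerM g z v v) := by
  set φ := chartAt (Coord n) y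
  obtain ⟨f, -, hf⟩ := (SmoothBumpFunction.nhds_basis_tsupport (I := 𝓡 n) y).mem_iff.1
    (φ.open_source.mem_nhds (mem_chart_source (Coord n) y))
  have hfθc : HasCompactSupport (fun z ↦ f z * θ z) := f.hasCompactSupport.mul_right
  have hfθs : tsupport (fun z ↦ f z * θ z) ⊆ φ.source := tsupport_mul_subset_left.trans hf
  set Ψ := chartExt (n := n) y fun z ↦ f z * θ z
  have hΨc : Continuous Ψ := by
    have h1 : ContinuousOn Ψ φ.target := by
      refine ContinuousOn.congr (f := (fun z ↦ f z * θ z) ∘ φ.symm) ?_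
        fun z hz ↦ chartExt_apply y _ hz
      exact (f.contMDiff.continuous.mul hθ).comp_continuousOn φ.continuousOn_symm
    exact h1.continuous_of_tsupport_subset φ.open_target
      ((tsupport_chartExt_subset_target hfθc hfθs (subset_univ _)).trans inter_subset_left)
  have hΨs : HasCompactSupport Ψ := hasCompactSupport_chartExt hfθc hfθs
  have hev : ∀ᶠ z in 𝓝 (φ y), z ∈ φ.target ∧ Ψ z = θ (φ.symm z) := by
    have h1 : ∀ᶠ z in 𝓝 (φ y), f (φ.symm z) = 1 := by
      have h2 : Tendsto φ.symm (𝓝 (φ y)) (𝓝 y) := by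
        have := φ.symm.continuousAt (mem_chart_target (Coord n) y)
        rwa [ContinuousAt, φ.left_inv (mem_chart_source _ y)] at this
      exact h2.eventually f.eventuallyEq_one
    filter_upwards [h1, φ.open_target.mem_nhds (mem_chart_target (Coord n) y)] with z hz hzt
    refine ⟨hzt, ?_⟩
    simp only [Ψ]
    rw [chartExt_apply y _ hzt]
    simp only [φ] at hz
    rw [hz, one_mul]
  obtain ⟨R₁, hR₁, hball⟩ := Metric.eventually_nhds_iff_ball.1 hev
  -- One third each for the distance of the point from the centre, the mollification radius and the
  -- length of the increment.
  set r := min R R₁ / 3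
  have hr : 0 < r := by positivity
  have hr3 : 3 * r = min R R₁ := by simp only [r]; ring
  refine ⟨φ.source ∩ φ ⁻¹' Metric.ball (φ y) r, φ.isOpen_inter_preimage Metric.isOpen_ball,
    ⟨mem_chart_source _ y, Metric.mem_ball_self hr⟩, fun ε hε ↦ ?_⟩
  obtain ⟨k, hk, hkΨ, hkd⟩ := exists_mollified hΨc hΨs hr hε
  have hin {z : Coord n} (hz : dist z (φ y) < 3 * r) :
      z ∈ Metric.ball (φ y) R ∧ z ∈ φ.target ∧ Ψ z = θ (φ.symm z) := by
    rw [hr3] at hz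
    exact ⟨hz.trans_le (min_le_left _ _), hball z (hz.trans_le (min_le_right _ _))⟩
  have hks {z : M} (hz : z ∈ φ.source) :
      ContMDiffAt (𝓡 n) 𝓘(ℝ, ℝ) ∞ (fun z ↦ k (φ z)) z := by
    have h1 : ContMDiffAt (𝓡 n) (𝓡 n) ∞ φ z :=
      (contMDiffOn_chart (I := 𝓡 n) (n := ∞) (x := y)).contMDiffAt (φ.open_source.mem_nhds hz)
    exact hk.contMDiff.contMDiffAt.comp z h1
  refine ⟨fun z ↦ k (φ z), fun z hz ↦ hks hz.1, fun z hz ↦ ?_⟩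
  have hζ : dist (φ z) (φ y) < r := hz.2
  obtain ⟨hζR, hζt, hζΨ⟩ := hin (show dist (φ z) (φ y) < 3 * r by linarith)
  have hzz : φ.symm (φ z) = z := φ.left_inv hz.1
  refine ⟨?_, fun v ↦ ?_⟩
  · have := hkΨ (φ z)
    rwa [hζΨ, hzz] at this
  · set w := chartDeriv (n := n) y z v
    have hv : v = chartSymmDeriv (n := n) y (φ z) w := by
      have := congrArg (fun A ↦ A v) (chartSymmDeriv_comp_chartDeriv (n := n) y hz.1)
      exact this.symm
    have hdk : dM (n := n) (fun z ↦ k (φ z)) z v = fderiv ℝ k (φ z) w := by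
      have h1 := fderiv_comp_chart_symm (n := n) y hζt (h := fun z ↦ k (φ z)) (by
        rw [show (chartAt (Coord n) y).symm (φ z) = z from hzz]
        exact mdifferentiableAt_of_contMDiffAt (by simp) (hks hz.1))
      have h2 : (fun z ↦ k (φ z)) ∘ φ.symm =ᶠ[𝓝 (φ z)] k := by
        filter_upwards [φ.open_target.mem_nhds hζt] with x hx
        simp [φ.right_inv hx]
      rw [show (chartAt (Coord n) y).symm (φ z) = z from hzz] at h1
      conv_lhs => rw [hv]
      change ((dM (n := n) (fun z ↦ k (φ z)) z).comp (chartSymmDeriv y (φ z))) w = _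
      rw [← h1]
      exact congrArg (fun A : Coord n →L[ℝ] ℝ ↦ A w) h2.fderiv_eq
    rw [hdk]
    -- This range of `s` keeps `|s| ‖w‖` below `r`; the `1` covers `w = 0`.
    refine hkd (φ z) w (ξ z v) _ (by positivity) ⟨r / (1 + ‖w‖), by positivity,
      fun z' hz' s hs ↦ ?_⟩
    have h3 : dist z' (φ y) < 2 * r := by
      have := dist_triangle z' (φ z) (φ y)
      have h4 : dist z' (φ z) < r := hz'
      linarith
    have h5 : dist (z' + s • w) (φ y) < 3 * r := by
      have h6 := dist_triangle (z' + s • w) z' (φ y)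
      have h7 : dist (z' + s • w) z' = |s| * ‖w‖ := by
        rw [dist_eq_norm, add_sub_cancel_left, norm_smul, Real.norm_eq_abs]
      have h8 : |s| * ‖w‖ ≤ r := by
        rw [lt_div_iff₀ (by positivity)] at hs
        nlinarith [abs_nonneg s]
      linarith
    obtain ⟨h9, -, h10⟩ := hin (show dist z' (φ y) < 3 * r by linarith)
    obtain ⟨h11, -, h12⟩ := hin h5
    rw [h10, h12]
    have := H (φ z) ⟨hζR, hζt⟩ w z' h9 s h11
    rw [← hv, hzz] at this
    exact this

end Approximation

/-! ### The Riemannian distance. -/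

section Distance

variable {n : ℕ} {M : Type*} [TopologicalSpace M] [ChartedSpace (EuclideanSpace ℝ (Fin n)) M]
  [IsManifold (𝓡 n) ∞ M]

/-- The length of a path with respect to `g`. -/
def pathLen (g : SmoothMetric n M) (γ : ℝ → M) (a b : ℝ) : ℝ≥0∞ :=
  letI : RiemannianBundle (fun y : M ↦ TangentSpace (𝓡 n) y) := ⟨g.toRiemannianMetric⟩
  pathELength (𝓡 n) γ a b

/-- The velocity of a path. -/
def velocity (γ : ℝ → M) (t : ℝ) : Coord n :=
  mfderiv 𝓘(ℝ, ℝ) (𝓡 n) γ t (1 : ℝ)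

lemma pathLen_eq_lintegral (g : SmoothMetric n M) (γ : ℝ → M) (a b : ℝ) :
    pathLen g γ a b = ∫⁻ t in Icc a b, ENNReal.ofReal
      √(innerM g (γ t) (velocity γ t) (velocity γ t)) := by
  let : RiemannianBundle (fun y : M ↦ TangentSpace (𝓡 n) y) := ⟨g.toRiemannianMetric⟩
  change pathELength (𝓡 n) γ a b = _
  rw [pathELength_eq_lintegral_mfderiv_Icc]
  refine lintegral_congr fun t ↦ ?_
  rw [← ofReal_norm, norm_eq_sqrt_real_inner]
  rfl

lemma rdist_le_pathLen (g : SmoothMetric n M) {γ : ℝ → M} {a b : ℝ}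
    (hγ : ContMDiffOn 𝓘(ℝ, ℝ) (𝓡 n) 1 γ (Icc a b)) (hab : a ≤ b) :
    rdist g (γ a) (γ b) ≤ pathLen g γ a b := by
  let : RiemannianBundle (fun y : M ↦ TangentSpace (𝓡 n) y) := ⟨g.toRiemannianMetric⟩
  exact riemannianEDist_le_pathELength hγ rfl rfl hab

lemma exists_path_of_rdist_lt (g : SmoothMetric n M) {x y : M} {r : ℝ≥0∞} (h : rdist g x y < r) :
    ∃ γ : ℝ → M, γ 0 = x ∧ γ 1 = y ∧ ContMDiffOn 𝓘(ℝ, ℝ) (𝓡 n) 1 γ (Icc 0 1) ∧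
      pathLen g γ 0 1 < r := by
  let : RiemannianBundle (fun y : M ↦ TangentSpace (𝓡 n) y) := ⟨g.toRiemannianMetric⟩
  exact exists_lt_of_riemannianEDist_lt h

lemma rdist_self (g : SmoothMetric n M) (x : M) : rdist g x x = 0 := by
  let : RiemannianBundle (fun y : M ↦ TangentSpace (𝓡 n) y) := ⟨g.toRiemannianMetric⟩
  exact riemannianEDist_self

lemma rdist_comm (g : SmoothMetric n M) (x y : M) : rdist g x y = rdist g y x := by
  let : RiemannianBundle (fun y : M ↦ TangentSpace (𝓡 n) y) := ⟨g.toRiemannianMetric⟩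
  exact riemannianEDist_comm

lemma rdist_triangle (g : SmoothMetric n M) (x y z : M) :
    rdist g x z ≤ rdist g x y + rdist g y z := by
  let : RiemannianBundle (fun y : M ↦ TangentSpace (𝓡 n) y) := ⟨g.toRiemannianMetric⟩
  exact riemannianEDist_triangle

/-- The Riemannian distance as an extended pseudometric inducing the manifold topology. -/
@[reducible] def pseudoEMetricSpace [RegularSpace M] (g : SmoothMetric n M) :
    PseudoEMetricSpace M :=
  letI : RiemannianBundle (fun y : M ↦ TangentSpace (𝓡 n) y) := ⟨g.toRiemannianMetric⟩
  haveI : IsContinuousRiemannianBundle (EuclideanSpace ℝ (Fin n))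
      (fun y : M ↦ TangentSpace (𝓡 n) y) :=
    ⟨⟨g.inner, g.contMDiff.continuous, fun _ _ _ ↦ rfl⟩⟩
  .ofRiemannianMetric (𝓡 n) M

lemma edist_eq_rdist [RegularSpace M] (g : SmoothMetric n M) (x y : M) :
    letI := pseudoEMetricSpace g
    edist x y = rdist g x y := rfl

lemma continuous_rdist [RegularSpace M] (g : SmoothMetric n M) (x : M) :
    Continuous (rdist g x) := by
  let := pseudoEMetricSpace g
  exact (continuous_const.edist continuous_id : Continuous fun y ↦ edist x y)

lemma isOpen_ball [RegularSpace M] (g : SmoothMetric n M) (x : M) (r : ℝ) :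
    IsOpen (ball g x r) :=
  isOpen_lt (continuous_rdist g x) continuous_const

/-- The two lengths of one and the same path compare pointwise under the integral. -/
lemma rdist_le_of_inner_le {g g' : SmoothMetric n M} {L : ℝ} (hL : 0 < L)
    (h : ∀ y v, innerM g y v v ≤ L ^ 2 * innerM g' y v v) (x y : M) :
    rdist g x y ≤ ENNReal.ofReal L * rdist g' x y := by
  have hL0 : ENNReal.ofReal L ≠ 0 := by simpa using hL
  by_contra! hlt
  rw [mul_comm, ← ENNReal.lt_div_iff_mul_lt (Or.inl hL0) (Or.inl ENNReal.ofReal_ne_top)] at hlt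
  obtain ⟨γ, rfl, rfl, hγ, hlen⟩ := exists_path_of_rdist_lt g' hlt
  rw [ENNReal.lt_div_iff_mul_lt (Or.inl hL0) (Or.inl ENNReal.ofReal_ne_top), mul_comm] at hlen
  refine absurd (rdist_le_pathLen g hγ zero_le_one) (not_le.2 (lt_of_le_of_lt ?_ hlen))
  rw [pathLen_eq_lintegral, pathLen_eq_lintegral, ← lintegral_const_mul' _ _ ENNReal.ofReal_ne_top]
  refine lintegral_mono fun t ↦ ?_
  rw [← ENNReal.ofReal_mul hL.le]
  refine ENNReal.ofReal_le_ofReal ?_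
  calc _ ≤ √(L ^ 2 * innerM g' (γ t) (velocity γ t) (velocity γ t)) :=
        Real.sqrt_le_sqrt (h _ _)
    _ = _ := by rw [Real.sqrt_mul (sq_nonneg L), Real.sqrt_sq hL.le]

/-- Points of a length space are approximately joined by geodesics. -/
lemma exists_rdist_le_rdist_lt [RegularSpace M] (g : SmoothMetric n M) {x y : M} {a b : ℝ≥0∞}
    (hb : 0 < b) (h : rdist g x y < a + b) :
    ∃ z, rdist g x z ≤ a ∧ rdist g z y < b := by
  rcases le_total (rdist g x y) a with hle | hle
  · exact ⟨y, hle, by rwa [rdist_self]⟩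
  obtain ⟨γ, rfl, rfl, hγ, hlen⟩ := exists_path_of_rdist_lt g h
  have hc : ContinuousOn (fun t ↦ rdist g (γ 0) (γ t)) (Icc 0 1) :=
    (continuous_rdist g (γ 0)).comp_continuousOn hγ.continuousOn
  -- On an almost minimal path take a point at distance exactly `a` from the start. The first piece
  -- has length at least `a`, which leaves less than `b` for the second.
  obtain ⟨t, ht, hta⟩ := intermediate_value_Icc zero_le_one hc
    (show a ∈ Icc _ _ from ⟨by simp [rdist_self], hle⟩)
  refine ⟨γ t, hta.le, ?_⟩
  have h1 : a ≤ pathLen g γ 0 t := hta ▸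
    rdist_le_pathLen g (hγ.mono (Icc_subset_Icc_right ht.2)) ht.1
  have h2 := rdist_le_pathLen g (hγ.mono (Icc_subset_Icc_left ht.1)) ht.2
  have h3 : pathLen g γ 0 t + pathLen g γ t 1 = pathLen g γ 0 1 :=  by
    let : RiemannianBundle (fun y : M ↦ TangentSpace (𝓡 n) y) := ⟨g.toRiemannianMetric⟩
    exact pathELength_add ht.1 ht.2
  refine h2.trans_lt ?_
  by_contra! h4
  exact absurd (add_le_add h1 h4) (by rw [h3]; exact not_le.2 hlen)

/-! ### Compactness of closed balls in complete length spaces. -/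

section HopfRinow

variable {X : Type*} [PseudoEMetricSpace X] [LocallyCompactSpace X] [CompleteSpace X]

/-- In a complete locally compact length space closed balls of finite radius are compact. -/
theorem isCompact_closedEBall_of_length
    (hlen : ∀ (x y : X) (a b : ℝ≥0∞), 0 < b → edist x y < a + b →
      ∃ z, edist x z ≤ a ∧ edist z y < b) (x : X) {R : ℝ} (hR : 0 ≤ R) :
    IsCompact (Metric.closedEBall x (ENNReal.ofReal R)) := by
  set B : ℝ → Set X := fun ρ ↦ Metric.closedEBall x (ENNReal.ofReal ρ)
  have hmono {ρ ρ' : ℝ} (h : ρ ≤ ρ') : B ρ ⊆ B ρ' :=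
    Metric.closedEBall_subset_closedEBall (ENNReal.ofReal_le_ofReal h)
  have hclosed (ρ : ℝ) : IsClosed (B ρ) := Metric.isClosed_closedEBall
  -- A continuity argument in the radius: `S` contains `0` by local compactness, the ball at the
  -- supremum is compact, and compactness extends beyond any compact ball of radius below `R`.
  set S := {ρ : ℝ | ρ ∈ Icc 0 R ∧ IsCompact (B ρ)}
  have h0 : (0 : ℝ) ∈ S := by
    obtain ⟨δ, hδ, hc⟩ := (isCompact_singleton (x := x)).exists_isCompact_cthickening
    refine ⟨⟨le_rfl, hR⟩, hc.of_isClosed_subset (hclosed 0) fun y hy ↦ ?_⟩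
    rw [Metric.mem_cthickening_iff, Metric.infEDist_singleton]
    exact (Metric.mem_closedEBall.1 hy).trans (ENNReal.ofReal_le_ofReal hδ.le)
  have hbdd : BddAbove S := ⟨R, fun ρ h ↦ h.1.2⟩
  set ρ := sSup S
  have hρ0 : 0 ≤ ρ := le_csSup hbdd h0
  have hρR : ρ ≤ R := csSup_le ⟨0, h0⟩ fun ρ h ↦ h.1.2
  have hlt {ρ' : ℝ} (h : ρ' < ρ) : IsCompact (B ρ') := by
    obtain ⟨σ, hσ, hσ'⟩ := exists_lt_of_lt_csSup ⟨0, h0⟩ h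
    exact hσ.2.of_isClosed_subset (hclosed _) (hmono hσ'.le)
  have hρ : IsCompact (B ρ) := by
    rcases hρ0.eq_or_lt with h | hpos
    · rw [← h]
      exact h0.2
    rw [isCompact_iff_totallyBounded_isComplete]
    -- By the length property every point of `B ρ` is within `ε / 2` of the compact ball of radius
    -- `ρ - η`, so a finite `ε / 2`-net of the latter is an `ε`-net of `B ρ`.
    refine ⟨EMetric.totallyBounded_iff.2 fun ε hε ↦ ?_, (hclosed ρ).isComplete⟩
    have hε2 : 0 < ε / 2 := ENNReal.half_pos hε.ne'
    obtain ⟨η, hη0, hη⟩ := ENNReal.lt_iff_exists_nnreal_btwn.1 hε2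
    have hη0' : (0 : ℝ) < η := by exact_mod_cast hη0
    obtain ⟨t, -, htf, hts⟩ := EMetric.totallyBounded_iff'.1
      (hlt (sub_lt_self ρ hη0')).totallyBounded (ε / 2) hε2
    refine ⟨t, htf, fun z hz ↦ ?_⟩
    obtain ⟨w, hw, hwz⟩ := hlen x z (ENNReal.ofReal (ρ - η)) (ε / 2) hε2 (by
      refine (Metric.mem_closedEBall'.1 hz).trans_lt ?_
      rcases le_total (η : ℝ) ρ with h | h
      · calc ENNReal.ofReal ρ = ENNReal.ofReal (ρ - η) + η := by
              rw [← ENNReal.ofReal_coe_nnreal, ← ENNReal.ofReal_add (by linarith) η.coe_nonneg,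
                sub_add_cancel]
          _ < _ := ENNReal.add_lt_add_left ENNReal.ofReal_ne_top hη
      · calc ENNReal.ofReal ρ ≤ ENNReal.ofReal η := ENNReal.ofReal_le_ofReal h
          _ = η := ENNReal.ofReal_coe_nnreal
          _ < ε / 2 := hη
          _ ≤ _ := le_add_self)
    obtain ⟨y, hy, hwy⟩ := mem_iUnion₂.1 (hts (Metric.mem_closedEBall'.2 hw))
    refine mem_iUnion₂.2 ⟨y, hy, ?_⟩
    rw [Metric.mem_eball] at hwy ⊢
    calc edist z y ≤ edist z w + edist w y := edist_triangle _ _ _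
      _ < ε / 2 + ε / 2 := ENNReal.add_lt_add (by rwa [edist_comm]) hwy
      _ = ε := ENNReal.add_halves ε
  rcases hρR.eq_or_lt with h | h
  · rw [← h]
    exact hρ
  obtain ⟨δ, hδ, hc⟩ := hρ.exists_isCompact_cthickening
  -- The length property again: a slightly larger ball lies in a thickening of `B ρ`, which is
  -- compact for small `δ`.
  have hsub : B (ρ + δ / 2) ⊆ Metric.cthickening δ (B ρ) := fun z hz ↦ by
    obtain ⟨w, hw, hwz⟩ := hlen x z (ENNReal.ofReal ρ) (ENNReal.ofReal δ) (by simpa using hδ) (by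
      refine (Metric.mem_closedEBall'.1 hz).trans_lt ?_
      rw [← ENNReal.ofReal_add hρ0 hδ.le]
      exact (ENNReal.ofReal_lt_ofReal_iff (by linarith)).2 (by linarith))
    rw [Metric.mem_cthickening_iff]
    refine (Metric.infEDist_le_edist_of_mem (Metric.mem_closedEBall'.2 hw)).trans ?_
    rw [edist_comm]
    exact hwz.le
  have hmem : min (ρ + δ / 2) R ∈ S :=
    ⟨⟨le_min (by linarith) hR, min_le_right _ _⟩,
      hc.of_isClosed_subset (hclosed _) ((hmono (min_le_left _ _)).trans hsub)⟩
  have := le_csSup hbdd hmem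
  exact absurd this (not_le.2 (lt_min (by linarith) h))

end HopfRinow

/-- `rdist g` is a length metric inducing the manifold topology, so the Hopf–Rinow argument applies.
-/
theorem isCompact_rdist_le [T2Space M] (g : SmoothMetric n M) (hg : IsCompleteMetric g) (x : M)
    {R : ℝ} (hR : 0 ≤ R) : IsCompact {y | rdist g x y ≤ ENNReal.ofReal R} := by
  have : LocallyCompactSpace M := ChartedSpace.locallyCompactSpace (Coord n) M
  let := pseudoEMetricSpace g
  have hcs : CompleteSpace M := by
    refine EMetric.complete_of_cauchySeq_tendsto fun s hs ↦ hg s fun ε hε ↦ ?_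
    exact EMetric.cauchySeq_iff.1 hs ε hε
  have := isCompact_closedEBall_of_length (fun x y a b hb h ↦ exists_rdist_le_rdist_lt g hb h)
    x hR
  have h : {y | rdist g x y ≤ ENNReal.ofReal R} = Metric.closedEBall x (ENNReal.ofReal R) := by
    ext y
    rw [Metric.mem_closedEBall', mem_ofPred_eq, edist_eq_rdist]
  rwa [h]

end Distance

/-! ### Comparison of the metric with its coefficients near the centre of a chart. -/

section ChartComparison

variable {n : ℕ} {M : Type*} [TopologicalSpace M] [ChartedSpace (EuclideanSpace ℝ (Fin n)) M]
  [IsManifold (𝓡 n) ∞ M]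

/-- The quadratic form of `g` in the chart preferred at `a`. -/
def chartForm (g : SmoothMetric n M) (a : M) (z w : Coord n) : ℝ :=
  innerM g ((chartAt (Coord n) a).symm z) (chartSymmDeriv a z w) (chartSymmDeriv a z w)

lemma chartForm_eq_sum (g : SmoothMetric n M) (a : M) (z w : Coord n) :
    chartForm g a z w = ∑ i, ∑ j, gram g a z i j * (w i * w j) := by
  have h : chartSymmDeriv (M := M) a z w = ∑ i, w i • chartSymmDeriv (M := M) a z (basisVec i) := by
    conv_lhs => rw [coord_eq_sum w]
    simp
  rw [chartForm, h]
  simp only [map_sum, map_smul, sum_apply, smul_apply, smul_eq_mul, ← gram_apply, Finset.mul_sum]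
  rw [Finset.sum_comm]
  exact Finset.sum_congr rfl fun i _ ↦ Finset.sum_congr rfl fun j _ ↦ by ring

/-- Near a point, the coefficients of a metric vary by a factor two at most. -/
lemma exists_chartForm_comparison (g : SmoothMetric n M) (a : M) :
    ∃ R > 0, Metric.ball (chartAt (Coord n) a a) R ⊆ (chartAt (Coord n) a).target ∧ ∃ l > 0,
      ∀ z ∈ Metric.ball (chartAt (Coord n) a a) R, ∀ w, l * ‖w‖ ^ 2 ≤ chartForm g a z w ∧
        ∀ z' ∈ Metric.ball (chartAt (Coord n) a a) R,
          chartForm g a z' w ≤ 2 * chartForm g a z w := by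
  set z₀ := chartAt (Coord n) a a
  have ht : z₀ ∈ (chartAt (Coord n) a).target := mem_chart_target _ a
  obtain ⟨c, hc, hcs⟩ : ∃ c, 0 < c ∧ ∀ w ∈ Metric.sphere (0 : Coord n) 1, c ≤ chartForm g a z₀ w := by
    refine (isCompact_sphere _ _).exists_forall_le' (Continuous.continuousOn ?_) fun w hw ↦ ?_
    · rw [show chartForm g a z₀ = fun w ↦ _ from funext fun w ↦ chartForm_eq_sum g a z₀ w]
      fun_prop
    · have hw0 : w ≠ 0 := by
        rintro rfl
        simp at hw
      refine innerM_pos g _ fun h ↦ hw0 ?_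
      have := congrArg (fun A ↦ A w) (chartDeriv_comp_chartSymmDeriv (n := n) a ht)
      simpa [h] using this.symm
  have hcw (w : Coord n) : c * ‖w‖ ^ 2 ≤ chartForm g a z₀ w := by
    rcases eq_or_ne w 0 with rfl | hw
    · simp [chartForm_eq_sum]
    · have hw' : 0 < ‖w‖ := norm_pos_iff.2 hw
      have h1 := hcs (‖w‖⁻¹ • w) (by simp [norm_smul, hw'.ne'])
      have h2 : chartForm g a z₀ (‖w‖⁻¹ • w) = (‖w‖ ^ 2)⁻¹ * chartForm g a z₀ w := by
        simp only [chartForm, map_smul, smul_apply, smul_eq_mul]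
        ring
      rw [h2, inv_mul_eq_div, le_div_iff₀ (by positivity)] at h1
      exact h1
  set N : ℝ := (n : ℝ)
  -- Coefficients this close to those at the centre change the form by at most `(c / 3) ‖w‖²`, where
  -- the central form is at least `c ‖w‖²`. The lower bound `2c/3` follows, and the factor two from
  -- `Q + c/3 ≤ 2 (Q - c/3)`, that is `c ≤ Q`, for unit vectors.
  set ε := c / 3 / (N ^ 2 + 1)
  have hε : 0 < ε := by positivity
  have hev : ∀ᶠ z in 𝓝 z₀, ∀ i j, |gram g a z i j - gram g a z₀ i j| < ε := by
    simp only [eventually_all]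
    intro i j
    have h1 : ContinuousAt (fun z ↦ gram g a z i j) z₀ :=
      ((contDiffOn_gram_const g a i j).continuousOn).continuousAt
        ((chartAt (Coord n) a).open_target.mem_nhds ht)
    exact Metric.tendsto_nhds.1 h1 ε hε
  obtain ⟨R, hR, hball⟩ := Metric.eventually_nhds_iff_ball.1 (hev.and
    ((chartAt (Coord n) a).open_target.mem_nhds ht))
  have hdiff : ∀ z ∈ Metric.ball z₀ R, ∀ w,
      |chartForm g a z w - chartForm g a z₀ w| ≤ c / 3 * ‖w‖ ^ 2 := by
    intro z hz w
    have h1 : chartForm g a z w - chartForm g a z₀ w =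
        ∑ i, ∑ j, (gram g a z i j - gram g a z₀ i j) * (w i * w j) := by
      simp only [chartForm_eq_sum, sub_mul, Finset.sum_sub_distrib]
    have hwi (i : Fin n) : |w i| ≤ ‖w‖ := by simpa using PiLp.norm_apply_le w i
    rw [h1]
    calc _ ≤ ∑ i, ∑ j, |(gram g a z i j - gram g a z₀ i j) * (w i * w j)| :=
          (Finset.abs_sum_le_sum_abs _ _).trans
            (Finset.sum_le_sum fun i _ ↦ Finset.abs_sum_le_sum_abs _ _)
      _ ≤ ∑ i : Fin n, ∑ j : Fin n, ε * ‖w‖ ^ 2 := by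
        refine Finset.sum_le_sum fun i _ ↦ Finset.sum_le_sum fun j _ ↦ ?_
        rw [abs_mul, abs_mul, sq]
        exact mul_le_mul ((hball z hz).1 i j).le
          (mul_le_mul (hwi i) (hwi j) (abs_nonneg _) (norm_nonneg _)) (by positivity) hε.le
      _ = (N ^ 2 * ε) * ‖w‖ ^ 2 := by
        simp only [Finset.sum_const, Finset.card_univ, Fintype.card_fin, nsmul_eq_mul, N]
        ring
      _ ≤ c / 3 * ‖w‖ ^ 2 := by
        refine mul_le_mul_of_nonneg_right ?_ (sq_nonneg _)
        simp only [ε]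
        rw [mul_div_assoc', div_le_iff₀ (by positivity)]
        nlinarith
  refine ⟨R, hR, fun z hz ↦ (hball z hz).2, c * (2 / 3), by positivity, fun z hz w ↦
    ⟨?_, fun z' hz' ↦ ?_⟩⟩
  · have := (abs_le.1 (hdiff z hz w)).1
    nlinarith [hcw w]
  · have h1 := (abs_le.1 (hdiff z hz w)).1
    have h2 := (abs_le.1 (hdiff z' hz' w)).2
    nlinarith [hcw w]

section

variable [T2Space M]

lemma velocity_segment (a : M) {z w : Coord n} {t : ℝ}
    (h : z + t • w ∈ (chartAt (Coord n) a).target) :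
    velocity (M := M) (fun t : ℝ ↦ (chartAt (Coord n) a).symm (z + t • w)) t =
      chartSymmDeriv a (z + t • w) w := by
  have h1 : MDifferentiableAt 𝓘(ℝ, ℝ) (𝓡 n) (fun t : ℝ ↦ z + t • w) t :=
    (by fun_prop : DifferentiableAt ℝ (fun t : ℝ ↦ z + t • w) t).mdifferentiableAt
  have h2 := mfderiv_comp t (mdifferentiableAt_chart_symm a h) h1
  have h3 : HasDerivAt (fun t : ℝ ↦ z + t • w) w t := by
    simpa using ((hasDerivAt_id t).smul_const w).const_add z
  have h4 : mfderiv 𝓘(ℝ, ℝ) (𝓡 n) (fun t : ℝ ↦ z + t • w) t (1 : ℝ) = w := by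
    rw [mfderiv_eq_fderiv]
    exact h3.deriv
  change mfderiv 𝓘(ℝ, ℝ) (𝓡 n) ((chartAt (Coord n) a).symm ∘ fun t : ℝ ↦ z + t • w) t (1 : ℝ) = _
  rw [h2]
  exact congrArg (chartSymmDeriv (M := M) a (z + t • w)) h4

/-- The distance between two points is at most the length of the coordinate segment. -/
lemma rdist_chart_symm_le (g : SmoothMetric n M) (a : M) {R : ℝ}
    (hR : Metric.ball (chartAt (Coord n) a a) R ⊆ (chartAt (Coord n) a).target)
    {L : ℝ} {z w : Coord n} {s : ℝ}
    (hL : ∀ z' ∈ Metric.ball (chartAt (Coord n) a a) R, chartForm g a z' w ≤ L)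
    (hz : z ∈ Metric.ball (chartAt (Coord n) a a) R)
    (hzs : z + s • w ∈ Metric.ball (chartAt (Coord n) a a) R) :
    rdist g ((chartAt (Coord n) a).symm z) ((chartAt (Coord n) a).symm (z + s • w)) ≤
      ENNReal.ofReal (|s| * √L) := by
  have key {z : Coord n} {s : ℝ} (hs : 0 ≤ s) (hz : z ∈ Metric.ball (chartAt (Coord n) a a) R)
      (hzs : z + s • w ∈ Metric.ball (chartAt (Coord n) a a) R) :
      rdist g ((chartAt (Coord n) a).symm z) ((chartAt (Coord n) a).symm (z + s • w)) ≤
        ENNReal.ofReal (s * √L) := by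
    have hseg : ∀ t ∈ Icc 0 s, z + t • w ∈ Metric.ball (chartAt (Coord n) a a) R := by
      intro t ht
      rcases hs.eq_or_lt with rfl | hs'
      · rw [show t = 0 from le_antisymm ht.2 ht.1]
        exact hzs
      have := (convex_ball (chartAt (Coord n) a a) R).add_smul_sub_mem hz hzs (t := t / s)
        ⟨div_nonneg ht.1 hs, div_le_one_of_le₀ ht.2 hs⟩
      rwa [add_sub_cancel_left, smul_smul, div_mul_cancel₀ _ hs'.ne'] at this
    have h1 := rdist_le_pathLen g
      (γ := fun t : ℝ ↦ (chartAt (Coord n) a).symm (z + t • w)) (a := 0) (b := s) (by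
        intro t ht
        refine ContMDiffAt.contMDiffWithinAt ?_
        have h2 : ContMDiffAt (𝓡 n) (𝓡 n) 1 (chartAt (Coord n) a).symm (z + t • w) :=
          ((contMDiffOn_chart_symm (I := 𝓡 n) (n := ∞) (x := a)).contMDiffAt
            ((chartAt (Coord n) a).open_target.mem_nhds (hR (hseg t ht)))).of_le (by simp)
        have h3 : ContMDiffAt 𝓘(ℝ, ℝ) (𝓡 n) 1 (fun t : ℝ ↦ z + t • w) t :=
          (by fun_prop : ContDiff ℝ 1 fun t : ℝ ↦ z + t • w).contMDiff.contMDiffAt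
        exact h2.comp t h3) hs
    simp only [zero_smul, add_zero] at h1
    refine h1.trans ?_
    rw [pathLen_eq_lintegral]
    calc _ ≤ ∫⁻ t in Icc 0 s, ENNReal.ofReal √L := by
          refine setLIntegral_mono measurable_const fun t ht ↦ ENNReal.ofReal_le_ofReal ?_
          rw [velocity_segment a (hR (hseg t ht))]
          exact Real.sqrt_le_sqrt (hL _ (hseg t ht))
      _ = _ := by
        rw [setLIntegral_const, Real.volume_Icc, sub_zero, mul_comm, ENNReal.ofReal_mul hs]
  rcases le_total 0 s with hs | hs
  · rw [abs_of_nonneg hs]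
    exact key hs hz hzs
  · rw [rdist_comm, abs_of_nonpos hs]
    have := key (z := z + s • w) (neg_nonneg.2 hs) hzs (by simpa using hz)
    simpa using this

end

end ChartComparison

/-! ### Cutoff functions on geodesic balls; the Sobolev inequality for `C¹` functions. -/

section Cutoff

variable {n : ℕ} {M : Type*} [TopologicalSpace M] [ChartedSpace (EuclideanSpace ℝ (Fin n)) M]
  [IsManifold (𝓡 n) ∞ M] [T2Space M]

/-- The truncated distance function `max (1 - 2 d(x, ·) / r) 0`. -/
def distCutoff (g : SmoothMetric n M) (x : M) (r : ℝ) (y : M) : ℝ :=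
  (1 - rdist g x y / ENNReal.ofReal (r / 2)).toReal

lemma continuous_distCutoff (g : SmoothMetric n M) (x : M) {r : ℝ} (hr : 0 < r) :
    Continuous (distCutoff g x r) := by
  have : LocallyCompactSpace M := ChartedSpace.locallyCompactSpace (Coord n) M
  have h1 : Continuous fun y ↦ 1 - rdist g x y / ENNReal.ofReal (r / 2) :=
    (ENNReal.continuous_sub_left ENNReal.one_ne_top).comp
      ((ENNReal.continuous_div_const _ (by simpa using hr)).comp (continuous_rdist g x))
  exact ENNReal.continuousOn_toReal.comp_continuous h1 fun y ↦
    (tsub_le_self.trans_lt ENNReal.one_lt_top).ne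

lemma distCutoff_self (g : SmoothMetric n M) (x : M) (r : ℝ) : distCutoff g x r x = 1 := by
  simp [distCutoff, rdist_self]

lemma tsupport_distCutoff_subset (g : SmoothMetric n M) (x : M) {r : ℝ} (hr : 0 < r) :
    tsupport (distCutoff g x r) ⊆ {y | rdist g x y ≤ ENNReal.ofReal (r / 2)} := by
  have : LocallyCompactSpace M := ChartedSpace.locallyCompactSpace (Coord n) M
  refine closure_minimal (fun y hy ↦ ?_) (isClosed_le (continuous_rdist g x) continuous_const)
  by_contra h
  rw [mem_ofPred_eq, not_le] at h
  refine hy ?_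
  have h1 : 1 ≤ rdist g x y / ENNReal.ofReal (r / 2) := by
    rw [ENNReal.le_div_iff_mul_le (by simp [hr]) (by simp), one_mul]
    exact h.le
  simp [distCutoff, tsub_eq_zero_of_le h1]

/-- The triangle inequality, carried out with truncated subtraction in `ℝ≥0∞` because the distance
from `x` may be infinite. -/
lemma abs_distCutoff_sub_le (g : SmoothMetric n M) (x : M) {r : ℝ} (hr : 0 < r) {y z : M} {d : ℝ}
    (hd : 0 ≤ d) (h : rdist g y z ≤ ENNReal.ofReal d) :
    |distCutoff g x r y - distCutoff g x r z| ≤ 2 * d / r := by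
  have key {y z : M} (h : rdist g y z ≤ ENNReal.ofReal d) :
      distCutoff g x r y ≤ distCutoff g x r z + 2 * d / r := by
    set D := ENNReal.ofReal (r / 2)
    have h1 : rdist g x z / D ≤ rdist g x y / D + ENNReal.ofReal (2 * d / r) := by
      have h2 : ENNReal.ofReal (2 * d / r) = ENNReal.ofReal d / D := by
        rw [← ENNReal.ofReal_div_of_pos (by positivity)]
        congr 1
        field_simp
      rw [h2, ← ENNReal.add_div]
      gcongr
      exact (rdist_triangle g x y z).trans (by gcongr)
    have h3 : 1 - rdist g x y / D ≤ (1 - rdist g x z / D) + ENNReal.ofReal (2 * d / r) := by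
      rw [tsub_le_iff_right, add_assoc, add_comm (ENNReal.ofReal _)]
      exact le_tsub_add.trans (by gcongr)
    have h4 : 1 - rdist g x z / D ≠ ⊤ := (tsub_le_self.trans_lt ENNReal.one_lt_top).ne
    have h5 := ENNReal.toReal_mono (by finiteness) h3
    rwa [ENNReal.toReal_add h4 ENNReal.ofReal_ne_top, ENNReal.toReal_ofReal (by positivity)] at h5
  have h1 := key h
  have h2 := key (y := z) (z := y) (by rwa [rdist_comm])
  exact abs_le.2 ⟨by linarith, by linarith⟩

variable [SecondCountableTopology M]

lemma gradPair_const_mul_self_le (g : SmoothMetric n M) {h : M → ℝ} {y : M}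
    (hh : MDifferentiableAt (𝓡 n) 𝓘(ℝ, ℝ) h y) (b : ℝ) {L : ℝ}
    (H : ∀ v, |dM h y v| ≤ L * √(innerM g y v v)) :
    gradPair g (fun y ↦ h y * b) (fun y ↦ h y * b) y ≤ (b * L) ^ 2 := by
  refine gradPair_self_le g (sq_nonneg _) fun v ↦ ?_
  have h1 : dM (n := n) (fun y ↦ h y * b) y = b • dM h y :=
    dM_comp (χ := fun s ↦ s * b) hh (by simpa using (hasDerivAt_id (h y)).mul_const b)
  rw [h1, smul_apply, smul_eq_mul, mul_pow, mul_pow, mul_assoc]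
  refine mul_le_mul_of_nonneg_left ?_ (sq_nonneg b)
  have h2 := pow_le_pow_left₀ (abs_nonneg _) (H v) 2
  rwa [sq_abs, mul_pow, Real.sq_sqrt (innerM_self_nonneg g y v)] at h2

/-- Smooth cutoff functions on geodesic balls. -/
theorem exists_cutoff (g : SmoothMetric n M) (x : M) {r : ℝ} (hr : 0 < r)
    (hc : IsCompact {y | rdist g x y ≤ ENNReal.ofReal (r / 2)}) :
    ∃ κ : M → ℝ, ContMDiff (𝓡 n) 𝓘(ℝ, ℝ) ∞ κ ∧ HasCompactSupport κ ∧ tsupport κ ⊆ ball g x r ∧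
      κ x = 1 ∧ ∀ y, gradPair g κ κ y ≤ 36 / r ^ 2 := by
  have : LocallyCompactSpace M := ChartedSpace.locallyCompactSpace (Coord n) M
  have hts := tsupport_distCutoff_subset g x hr
  have hcs : HasCompactSupport (distCutoff g x r) := hc.of_isClosed_subset (isClosed_tsupport _) hts
  have hsub : tsupport (distCutoff g x r) ⊆ ball g x r := fun y hy ↦
    (hts hy : rdist g x y ≤ _).trans_lt
      ((ENNReal.ofReal_lt_ofReal_iff hr).2 (half_lt_self hr))
  -- With `ξ = 0` a Lipschitz bound becomes a gradient bound. The Lipschitz constant is `2 / r`; the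
  -- value `3 / r` leaves room for `√2 ≤ 3/2`, since the form varies by at most a factor two in a
  -- small coordinate ball.
  obtain ⟨κ, hκ, hκc, hκs, hκa⟩ := exists_smooth_approx g (ξ := fun _ ↦ 0) hcs (isOpen_ball g x r)
    hsub (fun _ _ ↦ rfl) (L := 3 / r) (by positivity) (fun y _ ↦ by
      obtain ⟨R, hR, hball, l, hl, hcomp⟩ := exists_chartForm_comparison g y
      refine exists_local_approx g (continuous_distCutoff g x hr) _ y (by positivity) hR
        fun ζ hζ w z' hz' s hs ↦ ?_
      have h1 := rdist_chart_symm_le g y hball (fun z hz ↦ (hcomp ζ hζ.1 w).2 z hz)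
        hz' hs
      rw [rdist_comm] at h1
      have h2 := abs_distCutoff_sub_le g x hr (by positivity) h1
      simp only [zero_apply, mul_zero, sub_zero]
      refine h2.trans ?_
      change 2 * (|s| * √(2 * chartForm g y ζ w)) / r ≤ |s| * (3 / r * √(chartForm g y ζ w))
      have h3 : √(2 * chartForm g y ζ w) ≤ 3 / 2 * √(chartForm g y ζ w) := by
        rw [Real.sqrt_mul zero_le_two]
        refine mul_le_mul_of_nonneg_right ?_ (Real.sqrt_nonneg _)
        rw [Real.sqrt_le_left (by norm_num)]
        norm_num
      calc 2 * (|s| * √(2 * chartForm g y ζ w)) / r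
          ≤ 2 * (|s| * (3 / 2 * √(chartForm g y ζ w))) / r := by gcongr
        _ = _ := by ring) (ε := min (1 / 4) (1 / r)) (by positivity)
  have hx : 3 / 4 ≤ κ x := by
    have h1 := (abs_le.1 (hκa x).1).1
    rw [distCutoff_self] at h1
    linarith [min_le_left (1 / 4) (1 / r)]
  have hx0 : κ x ≠ 0 := by linarith
  have hcm : ContMDiff (𝓡 n) 𝓘(ℝ, ℝ) ∞ fun y ↦ κ y * (κ x)⁻¹ := hκ.mul contMDiff_const
  refine ⟨fun y ↦ κ y * (κ x)⁻¹, hcm, hκc.mul_right, tsupport_mul_subset_left.trans hκs,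
    mul_inv_cancel₀ hx0, fun y ↦ ?_⟩
  have h1 := gradPair_const_mul_self_le g (mdifferentiableAt_of_contMDiffAt (by simp) (hκ y))
    (κ x)⁻¹ (L := 3 / r + min (1 / 4) (1 / r)) fun v ↦ by
      simpa using (hκa y).2 v
  refine h1.trans ?_
  -- Normalizing the value at `x`, which is at least `3/4`, costs a factor `4/3`. The gradient is
  -- then at most `(4/3)(3/r + 1/r) = 16/(3r) ≤ 6/r`, the source of `36 / r ^ 2`.
  have h2 : (κ x)⁻¹ ≤ 4 / 3 := by
    rw [inv_le_comm₀ (by linarith) (by norm_num)]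
    linarith
  have h3 : (κ x)⁻¹ * (3 / r + min (1 / 4) (1 / r)) ≤ 6 / r := by
    calc _ ≤ 4 / 3 * (3 / r + 1 / r) := by
          gcongr
          exact min_le_right _ _
      _ = 16 / 3 / r := by ring
      _ ≤ 6 / r := by gcongr; norm_num
  calc _ ≤ (6 / r) ^ 2 := by
        refine pow_le_pow_left₀ ?_ h3 2
        have : 0 < κ x := by linarith
        positivity
    _ = _ := by ring

/-- Compactly supported `C¹` functions can be approximated in `C¹` by smooth ones. -/
lemma exists_contMDiff_approx (g : SmoothMetric n M) {φ : M → ℝ}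
    (hφ : ContMDiff (𝓡 n) 𝓘(ℝ, ℝ) 1 φ) (hc : HasCompactSupport φ) {O : Set M} (hO : IsOpen O)
    (hs : tsupport φ ⊆ O) {ε : ℝ} (hε : 0 < ε) :
    ∃ κ : M → ℝ, ContMDiff (𝓡 n) 𝓘(ℝ, ℝ) ∞ κ ∧ HasCompactSupport κ ∧ tsupport κ ⊆ O ∧
      ∀ z, |κ z - φ z| ≤ ε ∧ ∀ v, |dM κ z v - dM φ z v| ≤ ε * √(innerM g z v v) := by
  have hε2 : 0 < ε / 2 := half_pos hε
  obtain ⟨κ, h1, h2, h3, h4⟩ := exists_smooth_approx g (ξ := dM φ) hc hO hs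
    (fun y hy ↦ dM_eq_zero_of_notMem_tsupport hy) hε2.le (fun y _ ↦ by
      obtain ⟨R, hR, hball, l, hl, hcomp⟩ := exists_chartForm_comparison g y
      set F := φ ∘ (chartAt (Coord n) y).symm
      have hF : ContDiffOn ℝ 1 F (chartAt (Coord n) y).target := by
        simpa using contDiffOn_comp_chart_symm (O := univ) (by simp) (fun z _ ↦ hφ z) y
      have hopen := (chartAt (Coord n) y).open_target
      have hFc : ContinuousAt (fderiv ℝ F) (chartAt (Coord n) y y) :=
        (hF.continuousOn_fderiv_of_isOpen hopen le_rfl).continuousAt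
          (hopen.mem_nhds (mem_chart_target _ y))
      -- Two points of the small ball then have differentials within `ε / 2 * √l`, and `√l ‖w‖` is
      -- at most the Riemannian length of `w`. The other `ε / 2` is spent in gluing.
      have hε4 : 0 < ε / 2 * √l / 2 := by positivity
      obtain ⟨R', hR', hR'F⟩ := Metric.continuousAt_iff.1 hFc _ hε4
      have hRR : Metric.ball (chartAt (Coord n) y y) (min R R') ⊆
          Metric.ball (chartAt (Coord n) y y) R := Metric.ball_subset_ball (min_le_left _ _)
      have hFd : ∀ z ∈ Metric.ball (chartAt (Coord n) y y) (min R R'),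
          ‖fderiv ℝ F z - fderiv ℝ F (chartAt (Coord n) y y)‖ ≤ ε / 2 * √l / 2 := fun z hz ↦ by
        rw [← dist_eq_norm]
        exact (hR'F (lt_of_lt_of_le hz (min_le_right _ _))).le
      refine exists_local_approx g hφ.continuous _ y hε2.le (lt_min hR hR')
        fun ζ hζ w z' hz' s hs ↦ ?_
      have h1 : dM φ ((chartAt (Coord n) y).symm ζ) (chartSymmDeriv y ζ w) = fderiv ℝ F ζ w := by
        rw [fderiv_comp_chart_symm y hζ.2 (mdifferentiableAt_of_contMDiffAt le_rfl (hφ _))]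
        rfl
      have h2 := (convex_ball _ _).norm_image_sub_le_of_norm_hasFDerivWithin_le' (𝕜 := ℝ) (f := F)
        (f' := fderiv ℝ F) (φ := fderiv ℝ F ζ) (C := ε / 2 * √l)
        (fun z hz ↦ ((hF.differentiableOn one_ne_zero z (hball (hRR hz))).differentiableAt
          (hopen.mem_nhds (hball (hRR hz)))).hasFDerivAt.hasFDerivWithinAt)
        (fun z hz ↦ by
          have h3 := norm_sub_le (fderiv ℝ F z - fderiv ℝ F (chartAt (Coord n) y y))
            (fderiv ℝ F ζ - fderiv ℝ F (chartAt (Coord n) y y))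
          rw [sub_sub_sub_cancel_right] at h3
          linarith [hFd z hz, hFd ζ hζ.1]) hz' hs
      rw [add_sub_cancel_left, map_smul, smul_eq_mul, norm_smul, Real.norm_eq_abs,
        Real.norm_eq_abs] at h2
      rw [h1]
      refine h2.trans ?_
      have h4 : √l * ‖w‖ ≤ √(chartForm g y ζ w) := by
        refine Real.le_sqrt_of_sq_le ?_
        rw [mul_pow, Real.sq_sqrt hl.le]
        exact (hcomp ζ (hRR hζ.1) w).1
      calc ε / 2 * √l * (|s| * ‖w‖) = |s| * (ε / 2 * (√l * ‖w‖)) := by ring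
        _ ≤ |s| * (ε / 2 * √(chartForm g y ζ w)) := by gcongr) hε2
  refine ⟨κ, h1, h2, h3, fun z ↦ ⟨(h4 z).1.trans (by linarith), fun v ↦ ?_⟩⟩
  simpa using (h4 z).2 v

/-- The triangle inequality for the dual norm. -/
lemma gradPair_self_le_of_dM_sub_le (g : SmoothMetric n M) {h k : M → ℝ} {y : M} {ε : ℝ}
    (H : ∀ v, |dM h y v - dM k y v| ≤ ε * √(innerM g y v v)) :
    gradPair g h h y ≤ (√(gradPair g k k y) + ε) ^ 2 := by
  refine gradPair_self_le g (sq_nonneg _) fun v ↦ ?_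
  have h1 : |dM k y v| ≤ √(gradPair g k k y) * √(innerM g y v v) := by
    rw [← Real.sqrt_mul (gradPair_self_nonneg g k y)]
    exact Real.abs_le_sqrt (dM_sq_le g k y v)
  have h2 : |dM h y v| ≤ (√(gradPair g k k y) + ε) * √(innerM g y v v) := by
    have h3 := abs_add_le (dM h y v - dM k y v) (dM k y v)
    rw [sub_add_cancel] at h3
    linarith [H v]
  have h4 := pow_le_pow_left₀ (abs_nonneg _) h2 2
  rwa [sq_abs, mul_pow, Real.sq_sqrt (innerM_self_nonneg g y v)] at h4

/-- The Sobolev inequality extends to compactly supported `C¹` functions. -/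
theorem SobolevOn.le_of_contMDiff_one [MeasurableSpace M] [BorelSpace M] {g : SmoothMetric n M}
    {B : Set M} {A : ℝ} (hS : SobolevOn g B A) (hn : 3 ≤ n) (hA : 0 ≤ A) (hB : IsOpen B) {φ : M → ℝ}
    (hφ : ContMDiff (𝓡 n) 𝓘(ℝ, ℝ) 1 φ) (hc : HasCompactSupport φ) (hs : tsupport φ ⊆ B) :
    (∫ y, |φ y| ^ (2 * (n : ℝ) / ((n : ℝ) - 2)) ∂vol g) ^ (((n : ℝ) - 2) / (n : ℝ)) ≤
      A * ∫ y, gradPair g φ φ y ∂vol g := by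
  have : LocallyCompactSpace M := ChartedSpace.locallyCompactSpace (Coord n) M
  obtain ⟨O, hO, hKO, hOB, hOc⟩ := exists_open_between_and_isCompact_closure hc.isCompact hB hs
  have hn3 : (3 : ℝ) ≤ n := by exact_mod_cast hn
  set e : ℝ := 2 * (n : ℝ) / ((n : ℝ) - 2)
  have he : 0 < e := div_pos (by linarith) (by linarith)
  -- All approximants are supported in this compact set of finite measure, so constants dominate
  -- both integrands and uniform convergence passes to the limit.
  set K := closure O
  have hKm : MeasurableSet K := hOc.measurableSet
  have hKfin : IsFiniteMeasure ((vol g).restrict K) := ⟨by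
    rw [Measure.restrict_apply_univ]
    exact hOc.measure_lt_top⟩
  have hε (k : ℕ) : (0 : ℝ) < 1 / ((k : ℝ) + 1) := by positivity
  choose κ hκ hκc hκO hκa using fun k : ℕ ↦ exists_contMDiff_approx g hφ hc hO hKO (hε k)
  have hlim : Tendsto (fun k : ℕ ↦ (1 : ℝ) / ((k : ℝ) + 1)) atTop (𝓝 0) :=
    tendsto_one_div_add_atTop_nhds_zero_nat
  have hrestr {F : M → ℝ} {S : Set M} (hF : ∀ y ∉ tsupport φ, F y = 0) (hS : tsupport φ ⊆ S) :
      ∫ y in S, F y ∂vol g = ∫ y, F y ∂vol g :=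
    setIntegral_eq_integral_of_forall_compl_eq_zero fun y hy ↦ hF y fun h ↦ hy (hS h)
  have hgc : Continuous (gradPair g φ φ) := by
    rw [← continuousOn_univ]
    exact continuousOn_gradPair g isOpen_univ (fun y _ ↦ hφ y) (fun y _ ↦ hφ y)
  obtain ⟨b₁, hb₁⟩ := hφ.continuous.bounded_above_of_compact_support hc
  obtain ⟨b₂, hb₂⟩ := hgc.bounded_above_of_compact_support
    (HasCompactSupport.intro hc fun _ hy ↦ gradPair_eq_zero_of_notMem_tsupport g φ hy)
  have hleft : Tendsto (fun k ↦ ∫ y in K, |κ k y| ^ e ∂vol g) atTop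
      (𝓝 (∫ y in K, |φ y| ^ e ∂vol g)) := by
    refine tendsto_integral_of_dominated_convergence (fun _ ↦ (b₁ + 1) ^ e) (fun k ↦ ?_)
      (integrable_const _) (fun k ↦ Eventually.of_forall fun y ↦ ?_)
      (Eventually.of_forall fun y ↦ ?_)
    · exact ((hκ k).continuous.abs.rpow_const fun _ ↦ Or.inr he.le).aestronglyMeasurable
    · rw [Real.norm_of_nonneg (by positivity)]
      refine Real.rpow_le_rpow (abs_nonneg _) ?_ he.le
      have h1 := (hκa k y).1
      have h2 := hb₁ y
      have h3 : 1 / ((k : ℝ) + 1) ≤ 1 := div_le_one_of_le₀ (by linarith [k.cast_nonneg (α := ℝ)])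
        (by positivity)
      rw [Real.norm_eq_abs] at h2
      have h4 := abs_add_le (κ k y - φ y) (φ y)
      rw [sub_add_cancel] at h4
      linarith
    · refine Tendsto.rpow_const (Tendsto.abs ?_) (Or.inr he.le)
      rw [tendsto_iff_dist_tendsto_zero]
      exact squeeze_zero (fun _ ↦ dist_nonneg) (fun k ↦ (hκa k y).1) hlim
  have hright : Tendsto (fun k : ℕ ↦ ∫ y in K, (√(gradPair g φ φ y) + 1 / ((k : ℝ) + 1)) ^ 2 ∂vol g)
      atTop (𝓝 (∫ y in K, gradPair g φ φ y ∂vol g)) := by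
    refine tendsto_integral_of_dominated_convergence (fun _ ↦ (√b₂ + 1) ^ 2) (fun k ↦ ?_)
      (integrable_const _) (fun k ↦ Eventually.of_forall fun y ↦ ?_)
      (Eventually.of_forall fun y ↦ ?_)
    · exact (by fun_prop : Continuous fun y ↦
        (√(gradPair g φ φ y) + 1 / ((k : ℝ) + 1)) ^ 2).aestronglyMeasurable
    · rw [Real.norm_of_nonneg (by positivity)]
      have h3 : 1 / ((k : ℝ) + 1) ≤ 1 := div_le_one_of_le₀ (by linarith [k.cast_nonneg (α := ℝ)])
        (by positivity)
      have h2 : √(gradPair g φ φ y) ≤ √b₂ := Real.sqrt_le_sqrt ((le_abs_self _).trans (hb₂ y))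
      gcongr
    · have h1 : Tendsto (fun k : ℕ ↦ (√(gradPair g φ φ y) + 1 / ((k : ℝ) + 1)) ^ 2) atTop
          (𝓝 ((√(gradPair g φ φ y) + 0) ^ 2)) := (hlim.const_add _).pow 2
      rwa [add_zero, Real.sq_sqrt (gradPair_self_nonneg g φ y)] at h1
  have hKB : K ⊆ B := hOB
  have hineq (k : ℕ) : (∫ y in K, |κ k y| ^ e ∂vol g) ^ (((n : ℝ) - 2) / (n : ℝ)) ≤
      A * ∫ y in K, (√(gradPair g φ φ y) + 1 / ((k : ℝ) + 1)) ^ 2 ∂vol g := by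
    have hout {y : M} (hy : y ∉ K) : y ∉ tsupport (κ k) := fun h ↦ hy (subset_closure (hκO k h))
    have h1 := hS (κ k) (hκ k) (hκc k) ((hκO k).trans (subset_closure.trans hKB))
    have h2 : ∫ y in B, |κ k y| ^ e ∂vol g = ∫ y in K, |κ k y| ^ e ∂vol g := by
      refine setIntegral_eq_of_subset_of_forall_sdiff_eq_zero hB.measurableSet hKB
        fun y hy ↦ ?_
      rw [image_eq_zero_of_notMem_tsupport (hout hy.2), abs_zero, Real.zero_rpow he.ne']
    have h3 : ∫ y in B, gradSq g (κ k) y ∂vol g = ∫ y in K, gradPair g (κ k) (κ k) y ∂vol g := by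
      rw [← setIntegral_eq_of_subset_of_forall_sdiff_eq_zero hB.measurableSet hKB
        fun y hy ↦ gradPair_eq_zero_of_notMem_tsupport g _ (hout hy.2)]
      exact integral_congr_ae (Eventually.of_forall fun y ↦
        gradSq_eq_gradPair g (mdifferentiableAt_of_contMDiffAt (by simp) (hκ k y)))
    rw [h2, h3] at h1
    refine h1.trans (mul_le_mul_of_nonneg_left ?_ hA)
    refine integral_mono_of_nonneg (Eventually.of_forall fun y ↦ gradPair_self_nonneg g _ y) ?_
      (Eventually.of_forall fun y ↦ gradPair_self_le_of_dM_sub_le g (hκa k y).2)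
    exact (by fun_prop : Continuous fun y ↦
      (√(gradPair g φ φ y) + 1 / ((k : ℝ) + 1)) ^ 2).continuousOn.integrableOn_compact hOc
  have hfinal := le_of_tendsto_of_tendsto'
    (hleft.rpow_const (Or.inr (div_nonneg (by linarith) (by linarith)))) (hright.const_mul A) hineq
  rwa [hrestr (fun y hy ↦ by rw [image_eq_zero_of_notMem_tsupport hy, abs_zero,
      Real.zero_rpow he.ne']) (hKO.trans subset_closure),
    hrestr (fun y hy ↦ gradPair_eq_zero_of_notMem_tsupport g φ hy) (hKO.trans subset_closure)]
    at hfinal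

end Cutoff

/-! ### Real analysis of the iteration: interpolation, integration in time, recursion. -/

section IterationLemmas

section MoserIteration

lemma continuous_integral_of_compact {X Y : Type*} [TopologicalSpace X] [FirstCountableTopology X]
    [LocallyCompactSpace X] [TopologicalSpace Y] [CompactSpace Y] [MeasurableSpace Y] [BorelSpace Y]
    (ν : Measure Y) [IsFiniteMeasure ν] {F : X → Y → ℝ}
    (hF : Continuous fun z : X × Y ↦ F z.1 z.2) : Continuous fun t ↦ ∫ y, F t y ∂ν := by
  simpa using continuous_parametric_integral_of_continuous (μ := ν) hF isCompact_univ

/-- Interpolation between `L¹` and `L^{d/(d-2)}`. -/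
lemma integral_rpow_le_interpolation {Y : Type*} [TopologicalSpace Y] [CompactSpace Y]
    [MeasurableSpace Y] [BorelSpace Y] (ν : Measure Y) [IsFiniteMeasure ν] {F w : Y → ℝ}
    (hF : Continuous F) (hw : Continuous w) (hF0 : ∀ y, 0 ≤ F y) (hw0 : ∀ y, 0 ≤ w y) {d : ℝ}
    (hd : 2 < d) :
    ∫ y, F y ^ (1 + 2 / d) * w y ∂ν ≤ (∫ y, F y * w y ∂ν) ^ (2 / d) *
      (∫ y, F y ^ (d / (d - 2)) * w y ∂ν) ^ ((d - 2) / d) := by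
  have hd0 : 0 < d := by linarith
  have hd2 : 0 < d - 2 := by linarith
  have hpq : (d / 2).HolderConjugate (d / (d - 2)) := by
    rw [Real.holderConjugate_iff]
    refine ⟨by rw [lt_div_iff₀ two_pos]; linarith, ?_⟩
    field_simp
    ring
  have hmem {G : Y → ℝ} (hG : Continuous G) (e : ℝ) : MemLp G (ENNReal.ofReal e) ν := by
    obtain ⟨b, hb⟩ := isCompact_univ.exists_bound_of_continuousOn hG.continuousOn
    exact MemLp.of_bound hG.aestronglyMeasurable b (Eventually.of_forall fun y ↦ hb y (mem_univ y))
  have hc1 : Continuous fun y ↦ (F y * w y) ^ (2 / d) :=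
    (hF.mul hw).rpow_const fun _ ↦ Or.inr (by positivity)
  have hc2 : Continuous fun y ↦ (F y ^ (d / (d - 2)) * w y) ^ ((d - 2) / d) :=
    ((hF.rpow_const fun _ ↦ Or.inr (by positivity)).mul hw).rpow_const
      fun _ ↦ Or.inr (by positivity)
  -- Hölder with exponents `d/2` and `d/(d-2)` for the product `F^{2/d} · F`, the weight being split
  -- as `w^{2/d} · w^{(d-2)/d}`.
  have h := integral_mul_le_Lp_mul_Lq_of_nonneg (μ := ν) hpq
    (Eventually.of_forall fun y ↦ Real.rpow_nonneg (mul_nonneg (hF0 y) (hw0 y)) (2 / d))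
    (Eventually.of_forall fun y ↦ Real.rpow_nonneg (mul_nonneg (Real.rpow_nonneg (hF0 y)
      (d / (d - 2))) (hw0 y)) ((d - 2) / d)) (hmem hc1 _) (hmem hc2 _)
  have h1 (y : Y) : ((F y * w y) ^ (2 / d)) ^ (d / 2) = F y * w y := by
    rw [← Real.rpow_mul (mul_nonneg (hF0 y) (hw0 y)), div_mul_div_cancel₀ hd0.ne',
      div_self two_ne_zero, Real.rpow_one]
  have h2 (y : Y) : ((F y ^ (d / (d - 2)) * w y) ^ ((d - 2) / d)) ^ (d / (d - 2)) =
      F y ^ (d / (d - 2)) * w y := by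
    rw [← Real.rpow_mul (mul_nonneg (Real.rpow_nonneg (hF0 y) _) (hw0 y)),
      div_mul_div_cancel₀ hd0.ne', div_self hd2.ne', Real.rpow_one]
  have h3 (y : Y) : (F y * w y) ^ (2 / d) * (F y ^ (d / (d - 2)) * w y) ^ ((d - 2) / d) =
      F y ^ (1 + 2 / d) * w y := by
    rw [Real.mul_rpow (hF0 y) (hw0 y), Real.mul_rpow (Real.rpow_nonneg (hF0 y) _) (hw0 y),
      ← Real.rpow_mul (hF0 y), div_mul_div_cancel₀ hd2.ne', div_self hd0.ne', Real.rpow_one]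
    have h4 : w y ^ (2 / d) * w y ^ ((d - 2) / d) = w y := by
      rw [← Real.rpow_add_of_nonneg (hw0 y) (by positivity) (by positivity)]
      have : 2 / d + (d - 2) / d = 1 := by field_simp; ring
      rw [this, Real.rpow_one]
    rw [Real.rpow_add_of_nonneg (hF0 y) zero_le_one (by positivity), Real.rpow_one]
    calc _ = F y ^ (2 / d) * F y * (w y ^ (2 / d) * w y ^ ((d - 2) / d)) := by ring
      _ = _ := by rw [h4]; ring
  simp only [h1, h2, h3, one_div_div] at h
  exact h

/-- A differential inequality `I' ≤ -D S + b J` on a time interval controls `sup I` and `∫ S` on a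
shorter interval by `∫ J`. -/
lemma bound_of_deriv_le {I S J : ℝ → ℝ} (hI : Continuous I) (hS : Continuous S) (hJ : Continuous J)
    (hI0 : ∀ t, 0 ≤ I t) (hS0 : ∀ t, 0 ≤ S t) (hJ0 : ∀ t, 0 ≤ J t) {D b s₀ s₁ t₀ : ℝ} (hD : 0 < D)
    (hb : 0 ≤ b) (h01 : s₀ < s₁) (h1t : s₁ ≤ t₀) (hIJ : ∀ t ∈ Icc s₀ t₀, I t ≤ J t)
    (hder : ∀ t ∈ Ioo s₀ t₀, ∃ I', HasDerivAt I I' t ∧ I' ≤ -D * S t + b * J t) :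
    (∀ t ∈ Icc s₁ t₀, I t ≤ (1 / (s₁ - s₀) + b) * ∫ τ in s₀..t₀, J τ) ∧
      D * ∫ τ in s₁..t₀, S τ ≤ (1 / (s₁ - s₀) + b) * ∫ τ in s₀..t₀, J τ := by
  have hJi (c d : ℝ) : IntervalIntegrable J volume c d := hJ.intervalIntegrable c d
  have hSi (c d : ℝ) : IntervalIntegrable S volume c d := hS.intervalIntegrable c d
  have hJmono {c d : ℝ} (hc : s₀ ≤ c) (hcd : c ≤ d) (hd : d ≤ t₀) :
      ∫ τ in c..d, J τ ≤ ∫ τ in s₀..t₀, J τ :=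
    intervalIntegral.integral_mono_interval hc hcd hd (Eventually.of_forall hJ0) (hJi _ _)
  -- A good starting time replaces a cutoff in time: at the minimum over `[s₀, s₁]`, the value of
  -- `I` is at most its mean, which is the source of the coefficient `1 / (s₁ - s₀)`.
  obtain ⟨s, hs, hmin⟩ := isCompact_Icc.exists_isMinOn (nonempty_Icc.2 h01.le) hI.continuousOn
  have hIs : I s ≤ 1 / (s₁ - s₀) * ∫ τ in s₀..t₀, J τ := by
    rw [div_mul_eq_mul_div, one_mul, le_div_iff₀ (sub_pos.2 h01)]
    calc I s * (s₁ - s₀) = ∫ τ in s₀..s₁, I s := by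
          rw [intervalIntegral.integral_const, smul_eq_mul, mul_comm]
      _ ≤ ∫ τ in s₀..s₁, J τ := intervalIntegral.integral_mono_on h01.le
          intervalIntegrable_const (hJi _ _) fun τ hτ ↦
            (hmin hτ).trans (hIJ τ ⟨hτ.1, hτ.2.trans h1t⟩)
      _ ≤ _ := hJmono le_rfl h01.le h1t
  -- The differential inequality says that this function is decreasing.
  set F : ℝ → ℝ := fun t ↦ I t + D * (∫ τ in s..t, S τ) - b * ∫ τ in s..t, J τ
  have hF : ContinuousOn F (Icc s t₀) := by
    refine Continuous.continuousOn ?_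
    have h1 := intervalIntegral.continuous_primitive (fun c d ↦ hSi c d) s
    have h2 := intervalIntegral.continuous_primitive (fun c d ↦ hJi c d) s
    exact (hI.add (h1.const_mul D)).sub (h2.const_mul b)
  have hFd : ∀ t ∈ Ioo s t₀, ∃ F', HasDerivAt F F' t ∧ F' ≤ 0 := fun t ht ↦ by
    obtain ⟨I', hI', hle⟩ := hder t ⟨hs.1.trans_lt ht.1, ht.2⟩
    have h1 : HasDerivAt (fun t ↦ ∫ τ in s..t, S τ) (S t) t :=
      intervalIntegral.integral_hasDerivAt_right (hSi _ _)
        (hS.stronglyMeasurableAtFilter _ _) hS.continuousAt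
    have h2 : HasDerivAt (fun t ↦ ∫ τ in s..t, J τ) (J t) t :=
      intervalIntegral.integral_hasDerivAt_right (hJi _ _)
        (hJ.stronglyMeasurableAtFilter _ _) hJ.continuousAt
    exact ⟨_, (hI'.add (h1.const_mul D)).sub (h2.const_mul b), by linarith⟩
  have hanti : AntitoneOn F (Icc s t₀) := by
    refine antitoneOn_of_deriv_nonpos (convex_Icc _ _) hF ?_ ?_ <;> rw [interior_Icc]
    · intro t ht
      obtain ⟨F', h, -⟩ := hFd t ht
      exact h.differentiableAt.differentiableWithinAt
    · intro t ht
      obtain ⟨F', h, h'⟩ := hFd t ht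
      rwa [h.deriv]
  have key : ∀ t ∈ Icc s₁ t₀, I t + D * ∫ τ in s..t, S τ ≤
      (1 / (s₁ - s₀) + b) * ∫ τ in s₀..t₀, J τ := fun t ht ↦ by
    have hst : s ≤ t := hs.2.trans ht.1
    have h1 := hanti (left_mem_Icc.2 (hst.trans ht.2)) ⟨hst, ht.2⟩ hst
    simp only [F, intervalIntegral.integral_same, mul_zero, add_zero, sub_zero] at h1
    have h2 := mul_le_mul_of_nonneg_left (hJmono hs.1 hst ht.2) hb
    rw [add_mul]
    linarith
  refine ⟨fun t ht ↦ ?_, ?_⟩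
  · have h1 : 0 ≤ ∫ τ in s..t, S τ :=
      intervalIntegral.integral_nonneg (hs.2.trans ht.1) fun τ _ ↦ hS0 τ
    have := key t ht
    nlinarith
  · have h1 := key t₀ ⟨h1t, le_rfl⟩
    have h2 : ∫ τ in s₁..t₀, S τ ≤ ∫ τ in s..t₀, S τ :=
      intervalIntegral.integral_mono_interval hs.2 h1t le_rfl (Eventually.of_forall hS0) (hSi _ _)
    have := mul_le_mul_of_nonneg_left h2 hD.le
    linarith [hI0 t₀]

/-- Reverse Hölder step: the space-time norm of the higher power is controlled. -/
lemma integral_rpow_mul_le {I S : ℝ → ℝ} (hI : Continuous I) (hS : Continuous S)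
    (hI0 : ∀ t, 0 ≤ I t) (hS0 : ∀ t, 0 ≤ S t) {D Q e s t : ℝ} (hD : 0 < D) (hQ : 0 ≤ Q)
    (he : 0 ≤ e) (hst : s ≤ t) (hIQ : ∀ τ ∈ Icc s t, I τ ≤ Q) (hSQ : D * ∫ τ in s..t, S τ ≤ Q) :
    ∫ τ in s..t, I τ ^ e * S τ ≤ D⁻¹ * Q ^ (1 + e) := by
  calc ∫ τ in s..t, I τ ^ e * S τ ≤ ∫ τ in s..t, Q ^ e * S τ := by
        refine intervalIntegral.integral_mono_on hst ?_ ?_ fun τ hτ ↦ ?_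
        · exact ((hI.rpow_const fun _ ↦ Or.inr he).mul hS).intervalIntegrable _ _
        · exact (hS.const_mul _).intervalIntegrable _ _
        · exact mul_le_mul_of_nonneg_right (Real.rpow_le_rpow (hI0 τ) (hIQ τ hτ) he) (hS0 τ)
    _ = Q ^ e * ∫ τ in s..t, S τ := intervalIntegral.integral_const_mul _ _
    _ ≤ Q ^ e * (D⁻¹ * Q) := by
      refine mul_le_mul_of_nonneg_left ?_ (Real.rpow_nonneg hQ e)
      rwa [inv_mul_eq_div, le_div_iff₀' hD]
    _ = _ := by
      rw [Real.rpow_add_of_nonneg hQ zero_le_one he, Real.rpow_one]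
      ring

/-- A superlinear recursive inequality. -/
lemma recursion_bound {X : ℕ → ℝ} (hX : ∀ k, 0 ≤ X k) {D W b β : ℝ} (hD : 0 < D) (hW : 0 < W)
    (hb : 1 ≤ b) (hβ : 1 < β) (h : ∀ k : ℕ, X (k + 1) ≤ D⁻¹ * (W * b ^ (k : ℝ) * X k) ^ β) (k : ℕ) :
    D ^ (-(1 / (β - 1))) * W ^ (β / (β - 1)) * X k ≤
      (D ^ (-(1 / (β - 1))) * W ^ (β / (β - 1)) * b ^ (β / (β - 1) ^ 2) * X 0) ^ (β ^ (k : ℝ)) := by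
  have hb0 : 0 < b := by linarith
  have hβ1 : 0 < β - 1 := by linarith
  set G := D ^ (-(1 / (β - 1))) * W ^ (β / (β - 1))
  have hG : 0 < G := by positivity
  have hGβ : G * (D⁻¹ * W ^ β) = G ^ β := by
    simp only [G]
    rw [Real.mul_rpow (by positivity) (by positivity), ← Real.rpow_mul hD.le, ← Real.rpow_mul hW.le,
      ← Real.rpow_neg_one D]
    calc _ = (D ^ (-(1 / (β - 1))) * D ^ (-1 : ℝ)) * (W ^ (β / (β - 1)) * W ^ β) := by ring
      _ = _ := by
        rw [← Real.rpow_add hD, ← Real.rpow_add hW]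
        congr 2 <;> · field_simp; ring
  -- Weights for which `σ k * X k` obeys the pure recursion `Y (k+1) ≤ (Y k) ^ β`. This asks for `G
  -- D⁻¹ W^β = G^β` and, for the exponents `e k` of `b`, for `e (k+1) + β k = β e k`.
  set σ : ℕ → ℝ := fun k ↦ G * b ^ (β / (β - 1) * k + β / (β - 1) ^ 2)
  have hσ (k : ℕ) : 0 < σ k := by positivity
  have hstep (k : ℕ) : σ (k + 1) * X (k + 1) ≤ (σ k * X k) ^ β := by
    calc σ (k + 1) * X (k + 1) ≤ σ (k + 1) * (D⁻¹ * (W * b ^ (k : ℝ) * X k) ^ β) :=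
          mul_le_mul_of_nonneg_left (h k) (hσ _).le
      _ = (G * (D⁻¹ * W ^ β)) * (b ^ (β / (β - 1) * ((k + 1 : ℕ) : ℝ) + β / (β - 1) ^ 2) *
            b ^ ((k : ℝ) * β)) * X k ^ β := by
        rw [Real.mul_rpow (by positivity) (hX k), Real.mul_rpow hW.le (by positivity),
          ← Real.rpow_mul hb0.le]
        simp only [σ]
        ring
      _ = (σ k * X k) ^ β := by
        rw [hGβ, ← Real.rpow_add hb0, Real.mul_rpow (hσ k).le (hX k),
          Real.mul_rpow hG.le (by positivity), ← Real.rpow_mul hb0.le]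
        congr 3
        push_cast
        field_simp
        ring
  have hind (k : ℕ) : σ k * X k ≤ (σ 0 * X 0) ^ (β ^ (k : ℝ)) := by
    induction k with
    | zero => simp
    | succ k ih =>
      refine (hstep k).trans ((Real.rpow_le_rpow (mul_nonneg (hσ k).le (hX k)) ih
        (by linarith)).trans_eq ?_)
      rw [← Real.rpow_mul (mul_nonneg (hσ 0).le (hX 0))]
      push_cast
      rw [Real.rpow_add_one (by linarith)]
  have h0 : σ 0 = G * b ^ (β / (β - 1) ^ 2) := by simp [σ]
  have h1 : G ≤ σ k := le_mul_of_one_le_right hG.le (Real.one_le_rpow hb (by positivity))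
  have := hind k
  rw [h0] at this
  exact (mul_le_mul_of_nonneg_right h1 (hX k)).trans this

/-- If `c x ^ (β ^ k) ≤ y ^ (β ^ k)` for all `k`, then `x ≤ y`. -/
lemma le_of_forall_rpow_le {c x y β : ℝ} (hc : 0 < c) (hx : 0 ≤ x) (hy : 0 ≤ y) (hβ : 1 < β)
    (h : ∀ k : ℕ, c * x ^ (β ^ (k : ℝ)) ≤ y ^ (β ^ (k : ℝ))) : x ≤ y := by
  by_contra! hlt
  have hx0 : 0 < x := hy.trans_lt hlt
  rcases hy.eq_or_lt with rfl | hy0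
  · have := h 0
    simp at this
    nlinarith
  have h1 : 1 < x / y := (one_lt_div hy0).2 hlt
  have h2 : Tendsto (fun k : ℕ ↦ β ^ (k : ℝ)) atTop atTop := by
    simp only [Real.rpow_natCast]
    exact tendsto_pow_atTop_atTop_of_one_lt hβ
  have h3 : Tendsto (fun k : ℕ ↦ (x / y) ^ (β ^ (k : ℝ))) atTop atTop :=
    (tendsto_rpow_atTop_of_base_gt_one _ h1).comp h2
  obtain ⟨k, hk⟩ := (h3.eventually_gt_atTop c⁻¹).exists
  have h4 := h k
  rw [Real.div_rpow hx hy, lt_div_iff₀ (by positivity), inv_mul_lt_iff₀ hc] at hk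
  linarith

end MoserIteration

end IterationLemmas

/-! ### Moser's iteration on a compact space with a time-dependent weight. -/

section Iteration

section MoserIteration

/-- The levels of the nested cutoff functions. -/
def cutoffLevel (k : ℕ) : ℝ := 1 / 2 - (1 / 2) ^ (k + 2)

/-- The levels rise from `1/4` towards `1/2` with halving gaps, so slopes of cutoffs and inverse
gaps grow like `2^k`, a rate the recursion tolerates. -/
lemma cutoffLevel_succ_sub (k : ℕ) : cutoffLevel (k + 1) - cutoffLevel k = (1 / 2) ^ (k + 3) := by
  simp only [cutoffLevel]
  ring

lemma cutoffLevel_lt_succ (k : ℕ) : cutoffLevel k < cutoffLevel (k + 1) := by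
  have := cutoffLevel_succ_sub k
  have : (0 : ℝ) < (1 / 2) ^ (k + 3) := by positivity
  linarith

lemma cutoffLevel_lt_half (k : ℕ) : cutoffLevel k < 1 / 2 :=
  sub_lt_self _ (by positivity)

lemma quarter_le_cutoffLevel (k : ℕ) : 1 / 4 ≤ cutoffLevel k := by
  have h : ((1 : ℝ) / 2) ^ k ≤ 1 := pow_le_one₀ (by norm_num) (by norm_num)
  simp only [cutoffLevel, pow_add]
  linarith

/-- A smooth function vanishing below the `k`-th level and equal to one above the next level. -/
def levelCutoff (k : ℕ) (s : ℝ) : ℝ := Real.smoothTransition ((s - cutoffLevel k) * 2 ^ (k + 3))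

lemma contDiff_levelCutoff (k : ℕ) : ContDiff ℝ ∞ (levelCutoff k) :=
  Real.smoothTransition.contDiff.comp (by fun_prop)

lemma levelCutoff_eq_zero {k : ℕ} {s : ℝ} (h : s ≤ cutoffLevel k) : levelCutoff k s = 0 :=
  Real.smoothTransition.zero_of_nonpos
    (mul_nonpos_of_nonpos_of_nonneg (sub_nonpos.2 h) (by positivity))

lemma levelCutoff_eq_one {k : ℕ} {s : ℝ} (h : cutoffLevel (k + 1) ≤ s) : levelCutoff k s = 1 := by
  refine Real.smoothTransition.one_of_one_le ?_
  have h1 := cutoffLevel_succ_sub k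
  calc (1 : ℝ) = (1 / 2) ^ (k + 3) * 2 ^ (k + 3) := by rw [← mul_pow]; norm_num
    _ ≤ _ := mul_le_mul_of_nonneg_right (by linarith) (by positivity)

lemma levelCutoff_sq_le_one (k : ℕ) (s : ℝ) : levelCutoff k s ^ 2 ≤ 1 :=
  pow_le_one₀ (Real.smoothTransition.nonneg _) (Real.smoothTransition.le_one _)

lemma deriv_levelCutoff (k : ℕ) (s : ℝ) : deriv (levelCutoff k) s =
    deriv Real.smoothTransition ((s - cutoffLevel k) * 2 ^ (k + 3)) * 2 ^ (k + 3) := by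
  have h1 : HasDerivAt (fun s : ℝ ↦ (s - cutoffLevel k) * 2 ^ (k + 3)) (2 ^ (k + 3)) s := by
    simpa using ((hasDerivAt_id s).sub_const (cutoffLevel k)).mul_const ((2 : ℝ) ^ (k + 3))
  have h2 : DifferentiableAt ℝ Real.smoothTransition ((s - cutoffLevel k) * 2 ^ (k + 3)) :=
    (Real.smoothTransition.contDiff (n := 1)).differentiable (by simp) _
  exact (h2.hasDerivAt.comp s h1).deriv

lemma deriv_levelCutoff_eq_zero {k : ℕ} {s : ℝ} (h : s < cutoffLevel k) :
    deriv (levelCutoff k) s = 0 := by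
  have : levelCutoff k =ᶠ[𝓝 s] fun _ ↦ 0 := by
    filter_upwards [Iio_mem_nhds h] with z hz
    exact levelCutoff_eq_zero (le_of_lt hz)
  rw [this.deriv_eq, deriv_const]

/-- The function is constant outside `[0, 1]`. The bound is an absolute number, so it may enter the
final constant. -/
lemma exists_abs_deriv_smoothTransition_le : ∃ L, ∀ s, |deriv Real.smoothTransition s| ≤ L := by
  have hc : Continuous (deriv Real.smoothTransition) :=
    (Real.smoothTransition.contDiff (n := 1)).continuous_deriv le_rfl
  obtain ⟨L, hL⟩ := isCompact_Icc.exists_bound_of_continuousOn (s := Icc (0 : ℝ) 1) hc.continuousOn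
  have hL0 : 0 ≤ L := (norm_nonneg _).trans (hL 0 ⟨le_rfl, zero_le_one⟩)
  refine ⟨L, fun s ↦ ?_⟩
  rcases lt_or_ge s 0 with h | h
  · have : Real.smoothTransition =ᶠ[𝓝 s] fun _ ↦ 0 := by
      filter_upwards [Iio_mem_nhds h] with z hz
      exact Real.smoothTransition.zero_of_nonpos (le_of_lt hz)
    rwa [this.deriv_eq, deriv_const, abs_zero]
  rcases lt_or_ge 1 s with h' | h'
  · have : Real.smoothTransition =ᶠ[𝓝 s] fun _ ↦ 1 := by
      filter_upwards [Ioi_mem_nhds h'] with z hz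
      exact Real.smoothTransition.one_of_one_le (le_of_lt hz)
    rwa [this.deriv_eq, deriv_const, abs_zero]
  exact hL s ⟨h, h'⟩

/-- The constant of the iteration in dimension `d`, starting from the exponent `p`, when the
exponent `a` enters the energy inequality through `a ^ γ`; `L` bounds the slope of the cutoffs. -/
def moserConst (d p γ L : ℝ) : ℝ :=
  (8 + 64 * L ^ 2 + 4 * p ^ γ) ^ ((d + 2) / 2) *
    (4 * (1 + 2 / d) ^ γ) ^ ((1 + 2 / d) / (2 / d) ^ 2)

variable {Y : Type*} [TopologicalSpace Y] [T2Space Y] [CompactSpace Y] [MeasurableSpace Y] [BorelSpace Y]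

lemma integral_le_setIntegral {ν : Measure Y} [IsFiniteMeasure ν] {F G : Y → ℝ} (hF : Continuous F)
    (hG : Continuous G) {V : Set Y} (hV : MeasurableSet V) (hFG : ∀ y ∈ V, F y ≤ G y)
    (h0 : ∀ y ∉ V, F y ≤ 0) : ∫ y, F y ∂ν ≤ ∫ y in V, G y ∂ν := by
  have hi {H : Y → ℝ} (hH : Continuous H) : Integrable H ν :=
    integrableOn_univ.1 (hH.continuousOn.integrableOn_compact isCompact_univ)
  rw [← integral_indicator hV]
  refine integral_mono (hi hF) ((hi hG).indicator hV) fun y ↦ ?_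
  by_cases hy : y ∈ V
  · simpa [hy] using hFG y hy
  · simpa [hy] using h0 y hy

lemma setIntegral_le_integral_of_le {ν : Measure Y} [IsFiniteMeasure ν] {F G : Y → ℝ}
    (hF : Continuous F) (hG : Continuous G) {V : Set Y} (hV : MeasurableSet V)
    (hFG : ∀ y ∈ V, F y ≤ G y) (h0 : ∀ y, 0 ≤ G y) : ∫ y in V, F y ∂ν ≤ ∫ y, G y ∂ν := by
  have hi {H : Y → ℝ} (hH : Continuous H) : Integrable H ν :=
    integrableOn_univ.1 (hH.continuousOn.integrableOn_compact isCompact_univ)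
  rw [← integral_indicator hV]
  refine integral_mono ((hi hF).indicator hV) (hi hG) fun y ↦ ?_
  by_cases hy : y ∈ V
  · simpa [hy] using hFG y hy
  · simpa [hy] using h0 y

/-- The coefficients in the iteration grow geometrically. -/
lemma iteration_coeff_le {L E₁ E₂ p γ β t₀ : ℝ} (hE₁ : 0 ≤ E₁) (hE₂ : 0 ≤ E₂) (hp : 0 ≤ p)
    (hγ : 0 ≤ γ) (hβ : 1 ≤ β) (ht₀ : 0 < t₀) (k : ℕ) :
    2 ^ (k + 3) / t₀ + (E₁ * (L * 2 ^ (k + 3)) ^ 2 + E₂ * (p * β ^ (k : ℝ)) ^ γ * (4 / t₀)) ≤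
      (8 + 64 * L ^ 2 + 4 * p ^ γ) * (E₁ + (1 + E₂) / t₀) * (4 * β ^ γ) ^ (k : ℝ) := by
  have hβ0 : 0 < β := by linarith
  have hβγ : 1 ≤ β ^ γ := Real.one_le_rpow hβ hγ
  set B := (4 * β ^ γ) ^ (k : ℝ)
  have hB4 : (4 : ℝ) ^ k ≤ B := by
    simp only [B, Real.rpow_natCast]
    exact pow_le_pow_left₀ (by norm_num) (by linarith) k
  have hB2 : (2 : ℝ) ^ k ≤ B :=
    (pow_le_pow_left₀ (by norm_num) (by norm_num) k).trans hB4
  have hBβ : (β ^ (k : ℝ)) ^ γ ≤ B := by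
    rw [← Real.rpow_mul hβ0.le, mul_comm, Real.rpow_mul hβ0.le]
    exact Real.rpow_le_rpow (by positivity) (by linarith) (by positivity)
  have hB0 : 0 ≤ B := by positivity
  have hpγ : 0 ≤ p ^ γ := by positivity
  have h1 : 2 ^ (k + 3) / t₀ ≤ 8 * (1 / t₀ * B) := by
    calc 2 ^ (k + 3) / t₀ = 8 * (1 / t₀ * 2 ^ k) := by ring
      _ ≤ _ := by gcongr
  have h2 : E₁ * (L * 2 ^ (k + 3)) ^ 2 ≤ 64 * L ^ 2 * (E₁ * B) := by
    calc E₁ * (L * 2 ^ (k + 3)) ^ 2 = 64 * L ^ 2 * (E₁ * 4 ^ k) := by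
          rw [show (4 : ℝ) = 2 ^ 2 by norm_num, ← pow_mul]
          ring
      _ ≤ _ := by gcongr
  have h3 : E₂ * (p * β ^ (k : ℝ)) ^ γ * (4 / t₀) ≤ 4 * p ^ γ * (E₂ / t₀ * B) := by
    rw [Real.mul_rpow hp (by positivity)]
    calc _ = 4 * p ^ γ * (E₂ / t₀ * (β ^ (k : ℝ)) ^ γ) := by ring
      _ ≤ _ := by gcongr
  set W := E₁ + (1 + E₂) / t₀
  have hW1 : 1 / t₀ * B ≤ W * B := by
    refine mul_le_mul_of_nonneg_right ?_ hB0
    simp only [W, add_div]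
    have : 0 ≤ E₂ / t₀ := by positivity
    linarith
  have hW2 : E₁ * B ≤ W * B := by
    refine mul_le_mul_of_nonneg_right ?_ hB0
    simp only [W]
    have : 0 ≤ (1 + E₂) / t₀ := by positivity
    linarith
  have hW3 : E₂ / t₀ * B ≤ W * B := by
    refine mul_le_mul_of_nonneg_right ?_ hB0
    simp only [W, add_div]
    have : 0 ≤ 1 / t₀ := by positivity
    linarith
  calc _ ≤ 8 * (1 / t₀ * B) + (64 * L ^ 2 * (E₁ * B) + 4 * p ^ γ * (E₂ / t₀ * B)) := by gcongr
    _ ≤ 8 * (W * B) + (64 * L ^ 2 * (W * B) + 4 * p ^ γ * (W * B)) := by gcongr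
    _ = _ := by ring

/-- Moser's iteration: energy inequalities for all powers give a pointwise bound. -/
theorem moser_iteration {ν : Measure Y} [IsFiniteMeasure ν] {y₀ : Y}
    (hν : ∀ U ∈ 𝓝 y₀, 0 < ν U) {κ : Y → ℝ} (hκ : Continuous κ) (hκ0 : κ y₀ = 1) {d p γ L : ℝ}
    (hd : 2 < d) (hp : 1 ≤ p) (hγ : 0 ≤ γ) (hL : ∀ s, |deriv Real.smoothTransition s| ≤ L)
    {D E₁ E₂ t₀ : ℝ} (hD : 0 < D) (hE₁ : 0 ≤ E₁) (hE₂ : 0 ≤ E₂) (ht₀ : 0 < t₀)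
    {h w : ℝ → Y → ℝ} (hh : Continuous fun z : ℝ × Y ↦ h z.1 z.2)
    (hw : Continuous fun z : ℝ × Y ↦ w z.1 z.2) (hh0 : ∀ t y, 0 < h t y) (hw0 : ∀ t y, 0 < w t y)
    (henergy : ∀ a, p ≤ a → ∀ χ : ℝ → ℝ, ContDiff ℝ ∞ χ → (∀ s ≤ 1 / 4, χ s = 0) →
      ∀ t ∈ Ioo 0 t₀, ∃ I', HasDerivAt (fun t ↦ ∫ y, χ (κ y) ^ 2 * h t y ^ a * w t y ∂ν) I' t ∧
        I' ≤ -D * (∫ y, (χ (κ y) ^ 2 * h t y ^ a) ^ (d / (d - 2)) * w t y ∂ν) ^ ((d - 2) / d) +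
          E₁ * ∫ y, deriv χ (κ y) ^ 2 * h t y ^ a * w t y ∂ν +
          E₂ * a ^ γ / t * ∫ y, χ (κ y) ^ 2 * h t y ^ a * w t y ∂ν) :
    h t₀ y₀ ^ p ≤ moserConst d p γ L * D ^ (-(d / 2)) * (E₁ + (1 + E₂) / t₀) ^ ((d + 2) / 2) *
      ∫ s in (0 : ℝ)..t₀, ∫ y, h s y ^ p * w s y ∂ν := by
  have hd0 : 0 < d := by linarith
  have hd2 : 0 < d - 2 := by linarith
  have hp0 : 0 < p := by linarith
  -- The gain of integrability per step: combining `L^∞` in time of the `L¹` norm with `L¹` in time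
  -- of the `L^{d/(d-2)}` norm controls the space-time power `1 + 2/d`.
  set β : ℝ := 1 + 2 / d
  have hβ : 1 < β := lt_add_of_pos_right _ (by positivity)
  set a : ℕ → ℝ := fun k ↦ p * β ^ (k : ℝ)
  have ha0 (k : ℕ) : 0 < a k := by positivity
  have hap (k : ℕ) : p ≤ a k :=
    le_mul_of_one_le_right hp0.le (Real.one_le_rpow hβ.le (by positivity))
  have hha (b : ℝ) : Continuous fun z : ℝ × Y ↦ h z.1 z.2 ^ b :=
    hh.rpow_const fun z ↦ Or.inl (hh0 _ _).ne'
  have hslice (t : ℝ) : Continuous fun y : Y ↦ (t, y) := by fun_prop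
  have hhs (t b : ℝ) : Continuous fun y ↦ h t y ^ b := (hha b).comp (hslice t)
  have hws (t : ℝ) : Continuous (w t) := hw.comp (hslice t)
  set V : ℕ → Set Y := fun k ↦ {y | cutoffLevel k ≤ κ y}
  have hV (k : ℕ) : MeasurableSet (V k) := (isClosed_le continuous_const hκ).measurableSet
  set J : ℕ → ℝ → ℝ := fun k t ↦ ∫ y in V k, h t y ^ a k * w t y ∂ν
  have hJ (k : ℕ) : Continuous (J k) := continuous_integral_of_compact _ ((hha _).mul hw)
  have hJ0 (k : ℕ) (t : ℝ) : 0 ≤ J k t := integral_nonneg fun y ↦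
    mul_nonneg (Real.rpow_nonneg (hh0 t y).le _) (hw0 t y).le
  -- One sequence of levels cuts both `κ` and time. The cylinders shrink but always contain `{1/2 ≤
  -- κ} × [t₀/2, t₀]`.
  set X : ℕ → ℝ := fun k ↦ ∫ t in t₀ * cutoffLevel k..t₀, J k t
  have hle (k : ℕ) : t₀ * cutoffLevel k ≤ t₀ / 2 := by
    have := cutoffLevel_lt_half k
    nlinarith
  have hX (k : ℕ) : 0 ≤ X k :=
    intervalIntegral.integral_nonneg ((hle k).trans (by linarith)) fun t _ ↦ hJ0 k t
  set W := (8 + 64 * L ^ 2 + 4 * p ^ γ) * (E₁ + (1 + E₂) / t₀)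
  have hW : 0 < W := by positivity
  have hb : 1 ≤ 4 * β ^ γ := by
    have := Real.one_le_rpow hβ.le hγ
    linarith
  have hstep (k : ℕ) : X (k + 1) ≤ D⁻¹ * (W * (4 * β ^ γ) ^ (k : ℝ) * X k) ^ β := by
    set χ := levelCutoff k
    have hχ : Continuous χ := (contDiff_levelCutoff k).continuous
    have hχ' : Continuous (deriv χ) := (contDiff_levelCutoff k).continuous_deriv (by simp)
    have hIc : Continuous fun z : ℝ × Y ↦ χ (κ z.2) ^ 2 * h z.1 z.2 ^ a k :=
      ((hχ.comp (hκ.comp continuous_snd)).pow 2).mul (hha _)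
    have hIs (t : ℝ) : Continuous fun y ↦ χ (κ y) ^ 2 * h t y ^ a k := hIc.comp (hslice t)
    set I : ℝ → ℝ := fun t ↦ ∫ y, χ (κ y) ^ 2 * h t y ^ a k * w t y ∂ν
    set S : ℝ → ℝ := fun t ↦
      (∫ y, (χ (κ y) ^ 2 * h t y ^ a k) ^ (d / (d - 2)) * w t y ∂ν) ^ ((d - 2) / d)
    have hI : Continuous I := continuous_integral_of_compact _ (hIc.mul hw)
    have hS : Continuous S := (continuous_integral_of_compact _
      ((hIc.rpow_const fun _ ↦ Or.inr (by positivity)).mul hw)).rpow_const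
        fun _ ↦ Or.inr (by positivity)
    have hF0 (t : ℝ) (y : Y) : 0 ≤ χ (κ y) ^ 2 * h t y ^ a k :=
      mul_nonneg (sq_nonneg _) (Real.rpow_nonneg (hh0 t y).le _)
    have hI0 (t : ℝ) : 0 ≤ I t := integral_nonneg fun y ↦ mul_nonneg (hF0 t y) (hw0 t y).le
    have hS0 (t : ℝ) : 0 ≤ S t := Real.rpow_nonneg (integral_nonneg fun y ↦
      mul_nonneg (Real.rpow_nonneg (hF0 t y) _) (hw0 t y).le) _
    have hIJ (t : ℝ) : I t ≤ J k t := by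
      refine integral_le_setIntegral ((hIs t).mul (hws t))
        ((hhs t _).mul (hws t)) (hV k) (fun y _ ↦ ?_) fun y hy ↦ ?_
      · exact mul_le_mul_of_nonneg_right (mul_le_of_le_one_left (Real.rpow_nonneg (hh0 t y).le _)
          (levelCutoff_sq_le_one k _)) (hw0 t y).le
      · change χ (κ y) ^ 2 * h t y ^ a k * w t y ≤ 0
        rw [show χ (κ y) = 0 from levelCutoff_eq_zero (not_le.1 hy).le]
        simp
    have hIJ' (t : ℝ) : ∫ y, deriv χ (κ y) ^ 2 * h t y ^ a k * w t y ∂ν ≤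
        (L * 2 ^ (k + 3)) ^ 2 * J k t := by
      simp only [J]
      rw [← integral_const_mul]
      refine integral_le_setIntegral
        ((((hχ'.comp hκ).pow 2).mul (hhs t _)).mul (hws t))
        (((hhs t _).mul (hws t)).const_mul _) (hV k) (fun y _ ↦ ?_) fun y hy ↦ ?_
      · change deriv χ (κ y) ^ 2 * h t y ^ a k * w t y ≤
          (L * 2 ^ (k + 3)) ^ 2 * (h t y ^ a k * w t y)
        rw [mul_assoc]
        refine mul_le_mul_of_nonneg_right ?_
          (mul_nonneg (Real.rpow_nonneg (hh0 t y).le _) (hw0 t y).le)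
        simp only [χ, deriv_levelCutoff]
        refine sq_le_sq' ?_ ?_
        · rw [← neg_mul]
          exact mul_le_mul_of_nonneg_right (abs_le.1 (hL _)).1 (by positivity)
        · exact mul_le_mul_of_nonneg_right (abs_le.1 (hL _)).2 (by positivity)
      · change deriv χ (κ y) ^ 2 * h t y ^ a k * w t y ≤ 0
        rw [show deriv χ (κ y) = 0 from deriv_levelCutoff_eq_zero (not_le.1 hy)]
        simp
    set b := E₁ * (L * 2 ^ (k + 3)) ^ 2 + E₂ * a k ^ γ * (4 / t₀)
    have hb0 : 0 ≤ b := by positivity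
    have h01 : t₀ * cutoffLevel k < t₀ * cutoffLevel (k + 1) :=
      mul_lt_mul_of_pos_left (cutoffLevel_lt_succ k) ht₀
    -- All times used stay above `t₀ / 4`, so the singular factor `1 / t` of the energy inequality
    -- is at most `4 / t₀`.
    have hq : t₀ / 4 ≤ t₀ * cutoffLevel k := by
      have := quarter_le_cutoffLevel k
      nlinarith
    have h1t : t₀ * cutoffLevel (k + 1) ≤ t₀ := (hle _).trans (by linarith)
    obtain ⟨hsup, hint⟩ := bound_of_deriv_le hI hS (hJ k) hI0 hS0 (hJ0 k) hD hb0 h01 h1t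
      (fun t _ ↦ hIJ t) fun t ht ↦ by
        have ht4 : t₀ / 4 < t := hq.trans_lt ht.1
        have ht0 : 0 < t := lt_trans (by positivity) ht4
        obtain ⟨I', hI', hle⟩ := henergy (a k) (hap k) χ (contDiff_levelCutoff k)
          (fun s hs ↦ levelCutoff_eq_zero (hs.trans (quarter_le_cutoffLevel k))) t ⟨ht0, ht.2⟩
        refine ⟨I', hI', hle.trans ?_⟩
        have h1 : E₁ * ∫ y, deriv χ (κ y) ^ 2 * h t y ^ a k * w t y ∂ν ≤
            E₁ * ((L * 2 ^ (k + 3)) ^ 2 * J k t) := mul_le_mul_of_nonneg_left (hIJ' t) hE₁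
        have h2 : E₂ * a k ^ γ / t * I t ≤ E₂ * a k ^ γ * (4 / t₀) * J k t := by
          refine mul_le_mul ?_ (hIJ t) (hI0 t) (by positivity)
          rw [div_eq_mul_inv]
          refine mul_le_mul_of_nonneg_left ?_ (by positivity)
          rw [inv_le_comm₀ ht0 (by positivity), inv_div]
          exact ht4.le
        simp only [b, add_mul]
        linarith
    have hcoef : 1 / (t₀ * cutoffLevel (k + 1) - t₀ * cutoffLevel k) + b ≤
        W * (4 * β ^ γ) ^ (k : ℝ) := by
      refine le_trans (le_of_eq ?_) (iteration_coeff_le (L := L) hE₁ hE₂ hp0.le hγ hβ.le ht₀ k)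
      rw [← mul_sub, cutoffLevel_succ_sub]
      congr 1
      rw [one_div_pow]
      field_simp
    have hQ := mul_le_mul_of_nonneg_right hcoef (hX k)
    have hW' : 0 ≤ W * (4 * β ^ γ) ^ (k : ℝ) * X k :=
      mul_nonneg (by positivity) (hX k)
    -- On the next cylinder `χ = 1`, so `h ^ a (k+1)` is there the power `β` of `χ² h ^ a k`, and
    -- interpolation bounds its space integral by `I ^ (2/d) * S`.
    refine le_trans ?_ (integral_rpow_mul_le hI hS hI0 hS0 hD hW' (by positivity : 0 ≤ 2 / d) h1t
      (fun t ht ↦ (hsup t ht).trans hQ) (hint.trans hQ))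
    refine intervalIntegral.integral_mono_on h1t ((hJ _).intervalIntegrable _ _)
      (((hI.rpow_const fun _ ↦ Or.inr (by positivity)).mul hS).intervalIntegrable _ _) fun t _ ↦ ?_
    refine le_trans ?_ (integral_rpow_le_interpolation ν (hIs t) (hws t) (hF0 t)
      (fun y ↦ (hw0 t y).le) hd)
    refine setIntegral_le_integral_of_le ((hhs t _).mul (hws t))
      (((hIs t).rpow_const fun _ ↦ Or.inr (by positivity)).mul (hws t)) (hV _)
      (fun y hy ↦ le_of_eq ?_) fun y ↦ mul_nonneg (Real.rpow_nonneg (hF0 t y) _) (hw0 t y).le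
    have h1 : χ (κ y) = 1 := levelCutoff_eq_one hy
    change h t y ^ a (k + 1) * w t y = (χ (κ y) ^ 2 * h t y ^ a k) ^ (1 + 2 / d) * w t y
    rw [h1, one_pow, one_mul, ← Real.rpow_mul (hh0 t y).le]
    congr 2
    simp only [a]
    push_cast
    rw [Real.rpow_add_one (by linarith)]
    ring
  set G := D ^ (-(1 / (β - 1))) * W ^ (β / (β - 1))
  have hG : 0 < G := by positivity
  set Q := G * (4 * β ^ γ) ^ (β / (β - 1) ^ 2) * X 0
  have hQ : 0 ≤ Q := mul_nonneg (by positivity) (hX 0)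
  have hrec (k : ℕ) : G * X k ≤ Q ^ (β ^ (k : ℝ)) := recursion_bound hX hD hW hb hβ hstep k
  -- The pointwise value is recovered from below: near `(t₀, y₀)` one has `h > η` and `κ > 1/2`, and
  -- a product neighbourhood of past times lies in every cylinder. Hence `X k` is at least a fixed
  -- positive multiple of `η ^ a k`, and taking roots of order `β ^ k` removes the multiple.
  have hlower : ∀ η, 0 < η → η < h t₀ y₀ → η ^ p ≤ Q := by
    intro η hη hηh
    obtain ⟨c, hc, hcw⟩ : ∃ c, 0 < c ∧ ∀ z ∈ Icc 0 t₀ ×ˢ (univ : Set Y), c ≤ w z.1 z.2 :=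
      (isCompact_Icc.prod isCompact_univ).exists_forall_le' hw.continuousOn fun z _ ↦ hw0 _ _
    have hnhds : {z : ℝ × Y | η < h z.1 z.2 ∧ 1 / 2 < κ z.2} ∈ 𝓝 (t₀, y₀) :=
      ((isOpen_lt continuous_const hh).inter (isOpen_lt continuous_const
        (hκ.comp continuous_snd))).mem_nhds ⟨hηh, by simp only [mem_ofPred_eq, Function.comp, hκ0]; norm_num⟩
    obtain ⟨U₁, hU₁, U₂, hU₂, hsub⟩ := mem_nhds_prod_iff.1 hnhds
    obtain ⟨ρ, hρ, hρU⟩ := Metric.mem_nhds_iff.1 hU₁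
    obtain ⟨U, hUU, hUo, hyU⟩ := mem_nhds_iff.1 hU₂
    set σ := min (ρ / 2) (t₀ / 2)
    have hσ : 0 < σ := by positivity
    have hσt : σ ≤ t₀ / 2 := min_le_right _ _
    have hνU : 0 < ν.real U :=
      ENNReal.toReal_pos (hν U (hUo.mem_nhds hyU)).ne' (measure_ne_top ν U)
    have hin : ∀ t ∈ Icc (t₀ - σ) t₀, ∀ y ∈ U, η < h t y ∧ 1 / 2 < κ y := fun t ht y hy ↦
      hsub (mk_mem_prod (hρU (by
        rw [Metric.mem_ball, Real.dist_eq, abs_lt]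
        have := min_le_left (ρ / 2) (t₀ / 2)
        constructor <;> linarith [ht.1, ht.2])) (hUU hy))
    have hXk (k : ℕ) : σ * (η ^ a k * c * ν.real U) ≤ X k := by
      calc σ * (η ^ a k * c * ν.real U) = ∫ t in (t₀ - σ)..t₀, η ^ a k * c * ν.real U := by
            rw [intervalIntegral.integral_const, smul_eq_mul, sub_sub_cancel]
        _ ≤ ∫ t in (t₀ - σ)..t₀, J k t := by
            refine intervalIntegral.integral_mono_on (by linarith) intervalIntegrable_const
              ((hJ k).intervalIntegrable _ _) fun t ht ↦ ?_
            have hUV : U ⊆ V k := fun y hy ↦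
              (cutoffLevel_lt_half k).le.trans (hin t ht y hy).2.le
            have hGi : Integrable (fun y ↦ h t y ^ a k * w t y) ν := integrableOn_univ.1
              (((hhs t _).mul (hws t)).continuousOn.integrableOn_compact
                isCompact_univ)
            calc η ^ a k * c * ν.real U = ∫ y in U, η ^ a k * c ∂ν := by
                  rw [setIntegral_const, smul_eq_mul, mul_comm]
              _ ≤ ∫ y in U, h t y ^ a k * w t y ∂ν := by
                  refine setIntegral_mono_on (integrable_const _).integrableOn hGi.integrableOn
                    hUo.measurableSet fun y hy ↦ ?_
                  exact mul_le_mul (Real.rpow_le_rpow hη.le (hin t ht y hy).1.le (ha0 k).le)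
                    (hcw (t, y) ⟨⟨by linarith [ht.1], ht.2⟩, mem_univ _⟩) hc.le
                    (Real.rpow_nonneg (hh0 t y).le _)
              _ ≤ J k t := setIntegral_mono_set hGi.integrableOn
                  (Eventually.of_forall fun y ↦
                    mul_nonneg (Real.rpow_nonneg (hh0 t y).le _) (hw0 t y).le)
                  (Eventually.of_forall hUV)
        _ ≤ X k := intervalIntegral.integral_mono_interval ((hle k).trans (by linarith))
            (by linarith) le_rfl (Eventually.of_forall (hJ0 k)) ((hJ k).intervalIntegrable _ _)
    refine le_of_forall_rpow_le (c := G * (σ * (c * ν.real U))) (by positivity) (by positivity) hQ hβ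
      fun k ↦ ?_
    refine le_trans (le_of_eq ?_) ((mul_le_mul_of_nonneg_left (hXk k) hG.le).trans (hrec k))
    rw [← Real.rpow_mul hη.le]
    simp only [a]
    ring
  have hfin : h t₀ y₀ ^ p ≤ Q := by
    have h1 : Tendsto (fun η : ℝ ↦ η ^ p) (𝓝[<] h t₀ y₀) (𝓝 (h t₀ y₀ ^ p)) :=
      (Real.continuousAt_rpow_const _ _ (Or.inr hp0.le)).tendsto.mono_left nhdsWithin_le_nhds
    refine le_of_tendsto h1 ?_
    filter_upwards [Ioo_mem_nhdsLT (hh0 t₀ y₀)] with η hη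
    exact hlower η hη.1 hη.2
  refine hfin.trans ?_
  have hX0 : X 0 ≤ ∫ s in (0 : ℝ)..t₀, ∫ y, h s y ^ p * w s y ∂ν := by
    have hc : Continuous fun s ↦ ∫ y, h s y ^ p * w s y ∂ν :=
      continuous_integral_of_compact _ ((hha _).mul hw)
    have hnn (s : ℝ) : 0 ≤ ∫ y, h s y ^ p * w s y ∂ν := integral_nonneg fun y ↦
      mul_nonneg (Real.rpow_nonneg (hh0 s y).le _) (hw0 s y).le
    have h0 : 0 ≤ t₀ * cutoffLevel 0 := by
      have := quarter_le_cutoffLevel 0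
      nlinarith
    refine le_trans ?_ (intervalIntegral.integral_mono_interval h0
      ((hle 0).trans (by linarith)) le_rfl (Eventually.of_forall hnn) (hc.intervalIntegrable _ _))
    refine intervalIntegral.integral_mono_on ((hle 0).trans (by linarith))
      ((hJ 0).intervalIntegrable _ _) (hc.intervalIntegrable _ _) fun t _ ↦ ?_
    have ha : a 0 = p := by simp [a]
    simp only [J, ha]
    exact setIntegral_le_integral_of_le ((hhs t _).mul (hws t))
      ((hhs t _).mul (hws t)) (hV 0) (fun _ _ ↦ le_rfl)
      fun y ↦ mul_nonneg (Real.rpow_nonneg (hh0 t y).le _) (hw0 t y).le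
  have hβ1 : β - 1 = 2 / d := by simp [β]
  have he1 : 1 / (β - 1) = d / 2 := by rw [hβ1, one_div_div]
  have he2 : β / (β - 1) = (d + 2) / 2 := by
    rw [hβ1]
    simp only [β]
    field_simp
  have hQe : Q = moserConst d p γ L * D ^ (-(d / 2)) * (E₁ + (1 + E₂) / t₀) ^ ((d + 2) / 2) * X 0 := by
    simp only [Q, G, W]
    rw [he1, he2, hβ1, Real.mul_rpow (by positivity) (by positivity), moserConst]
    ring
  rw [hQe]
  refine mul_le_mul_of_nonneg_left hX0 ?_
  simp only [moserConst]
  positivity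

end MoserIteration

end Iteration

/-! ### Regularized powers, constant below `δ`. -/

section Regularizing

section Regularization

/-- At the corner `s = δ` the function is dominated by `|z - δ| ^ (k+1)`, whose derivative there
vanishes because `k ≥ 1`. -/
lemma hasDerivAt_max_sub_pow (δ s : ℝ) {k : ℕ} (hk : 1 ≤ k) :
    HasDerivAt (fun s ↦ max (s - δ) 0 ^ (k + 1)) ((k + 1) * max (s - δ) 0 ^ k) s := by
  rcases lt_trichotomy s δ with h | rfl | h
  · have h1 : (fun s ↦ max (s - δ) 0 ^ (k + 1)) =ᶠ[𝓝 s] fun _ ↦ 0 := by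
      filter_upwards [Iio_mem_nhds h] with z hz
      rw [max_eq_right (sub_nonpos.2 (le_of_lt hz)), zero_pow (by omega)]
    rw [max_eq_right (sub_nonpos.2 h.le), zero_pow (by omega), mul_zero]
    exact (hasDerivAt_const s (0 : ℝ)).congr_of_eventuallyEq h1
  · rw [sub_self, max_self, zero_pow (by omega), mul_zero]
    have hz : HasDerivAt (fun z : ℝ ↦ |z - s| ^ (k + 1)) 0 s := by
      have h1 : HasDerivAt (fun z : ℝ ↦ (z - s) ^ (k + 1)) 0 s := by
        have := ((hasDerivAt_id s).sub_const s).pow (k + 1)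
        refine this.congr_deriv ?_
        simp [zero_pow (by omega : k ≠ 0)]
      rw [hasDerivAt_iff_isLittleO] at h1 ⊢
      simpa [← abs_pow] using h1.abs_left
    rw [hasDerivAt_iff_isLittleO] at hz ⊢
    refine (Asymptotics.IsBigO.of_norm_le fun z ↦ ?_).trans_isLittleO hz
    simp only [sub_self, max_self, smul_zero, sub_zero, abs_zero]
    rw [zero_pow (by omega : k + 1 ≠ 0), sub_zero, Real.norm_of_nonneg (by positivity), sub_zero]
    exact pow_le_pow_left₀ (le_max_right _ _) (max_le (le_abs_self _) (abs_nonneg _)) _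
  · have h1 : (fun s ↦ max (s - δ) 0 ^ (k + 1)) =ᶠ[𝓝 s] fun z ↦ (z - δ) ^ (k + 1) := by
      filter_upwards [Ioi_mem_nhds h] with z hz
      rw [max_eq_left (sub_nonneg.2 (le_of_lt hz))]
    rw [max_eq_left (sub_nonneg.2 h.le)]
    refine HasDerivAt.congr_of_eventuallyEq ?_ h1
    exact (((hasDerivAt_id s).sub_const δ).pow (k + 1)).congr_deriv (by simp)

/-- A `C²` regularization of the cube of the positive part, bounded below by `δ³`. -/
def regCube (δ s : ℝ) : ℝ := δ ^ 3 + max (s - δ) 0 ^ 3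

/-- The regularized power `s ↦ s ^ (a / 2)`. -/
def regPow (δ a s : ℝ) : ℝ := regCube δ s ^ (a / 6)

/-- The derivative of `regPow`. -/
def regPowDeriv (δ a s : ℝ) : ℝ := a / 2 * max (s - δ) 0 ^ 2 * regCube δ s ^ (a / 6 - 1)

/-- The derivative of `regPow ^ 2`. -/
def regTest (δ a s : ℝ) : ℝ := a * max (s - δ) 0 ^ 2 * regCube δ s ^ (a / 3 - 1)

/-- The derivative of `regTest`. -/
def regTestDeriv (δ a s : ℝ) : ℝ :=
  a * (2 * max (s - δ) 0) * regCube δ s ^ (a / 3 - 1) +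
    a * max (s - δ) 0 ^ 2 * (3 * max (s - δ) 0 ^ 2 * (a / 3 - 1) * regCube δ s ^ (a / 3 - 1 - 1))

lemma regCube_pos {δ : ℝ} (hδ : 0 < δ) (s : ℝ) : 0 < regCube δ s := by
  simp only [regCube]
  positivity

/-- The cube is the lowest integer power of the positive part whose derivative is again `C¹`. This
makes `regTest` a `C¹` function, as Green's formula requires of a test function. -/
lemma hasDerivAt_regCube (δ s : ℝ) : HasDerivAt (regCube δ) (3 * max (s - δ) 0 ^ 2) s := by
  have := (hasDerivAt_max_sub_pow δ s (k := 2) (by norm_num)).const_add (δ ^ 3)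
  exact this.congr_deriv (by norm_num)

lemma continuous_regCube (δ : ℝ) : Continuous (regCube δ) := by
  exact (by fun_prop : Continuous fun s ↦ δ ^ 3 + max (s - δ) 0 ^ 3)

lemma continuous_regCube_rpow {δ : ℝ} (hδ : 0 < δ) (e : ℝ) : Continuous fun s ↦ regCube δ s ^ e :=
  (continuous_regCube δ).rpow_const fun s ↦ Or.inl (regCube_pos hδ s).ne'

lemma regPow_sq {δ : ℝ} (hδ : 0 < δ) (a s : ℝ) : regPow δ a s ^ 2 = regCube δ s ^ (a / 3) := by
  rw [regPow, ← Real.rpow_natCast, ← Real.rpow_mul (regCube_pos hδ s).le]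
  congr 1
  push_cast
  ring

lemma hasDerivAt_regPow {δ : ℝ} (hδ : 0 < δ) (a s : ℝ) : HasDerivAt (regPow δ a) (regPowDeriv δ a s) s := by
  have := (hasDerivAt_regCube δ s).rpow_const (p := a / 6) (Or.inl (regCube_pos hδ s).ne')
  refine this.congr_deriv ?_
  simp only [regPowDeriv]
  ring

lemma hasDerivAt_regPow_sq {δ : ℝ} (hδ : 0 < δ) (a s : ℝ) : HasDerivAt (fun s ↦ regPow δ a s ^ 2) (regTest δ a s) s := by
  simp only [regPow_sq hδ]
  have := (hasDerivAt_regCube δ s).rpow_const (p := a / 3) (Or.inl (regCube_pos hδ s).ne')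
  refine this.congr_deriv ?_
  simp only [regTest]
  ring

lemma hasDerivAt_regTest {δ : ℝ} (hδ : 0 < δ) (a s : ℝ) : HasDerivAt (regTest δ a) (regTestDeriv δ a s) s := by
  have h1 := (hasDerivAt_regCube δ s).rpow_const (p := a / 3 - 1)
    (Or.inl (regCube_pos hδ s).ne')
  have h2 := (hasDerivAt_max_sub_pow δ s (k := 1) le_rfl).const_mul a
  have := h2.mul h1
  norm_num at this
  refine this.congr_deriv ?_
  simp only [regTestDeriv]

lemma contDiff_regPow {δ : ℝ} (hδ : 0 < δ) (a : ℝ) : ContDiff ℝ 1 (regPow δ a) := by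
  refine contDiff_one_iff_deriv.2 ⟨fun s ↦ (hasDerivAt_regPow hδ a s).differentiableAt, ?_⟩
  rw [show deriv (regPow δ a) = regPowDeriv δ a from
    funext fun s ↦ (hasDerivAt_regPow hδ a s).deriv]
  have := continuous_regCube_rpow hδ (a / 6 - 1)
  exact (by fun_prop : Continuous fun s ↦
    a / 2 * max (s - δ) 0 ^ 2 * regCube δ s ^ (a / 6 - 1))

lemma contDiff_regTest {δ : ℝ} (hδ : 0 < δ) (a : ℝ) : ContDiff ℝ 1 (regTest δ a) := by
  refine contDiff_one_iff_deriv.2 ⟨fun s ↦ (hasDerivAt_regTest hδ a s).differentiableAt, ?_⟩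
  rw [show deriv (regTest δ a) = regTestDeriv δ a from
    funext fun s ↦ (hasDerivAt_regTest hδ a s).deriv]
  have h1 := continuous_regCube_rpow hδ (a / 3 - 1)
  have h2 := continuous_regCube_rpow hδ (a / 3 - 1 - 1)
  exact (by fun_prop : Continuous fun s ↦
    a * (2 * max (s - δ) 0) * regCube δ s ^ (a / 3 - 1) +
      a * max (s - δ) 0 ^ 2 *
        (3 * max (s - δ) 0 ^ 2 * (a / 3 - 1) * regCube δ s ^ (a / 3 - 1 - 1)))

lemma regTest_eq {δ : ℝ} (hδ : 0 < δ) (a s : ℝ) : regTest δ a s = 2 * regPow δ a s * regPowDeriv δ a s := by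
  simp only [regTest, regPow, regPowDeriv]
  have : regCube δ s ^ (a / 3 - 1) = regCube δ s ^ (a / 6) * regCube δ s ^ (a / 6 - 1) := by
    rw [← Real.rpow_add (regCube_pos hδ s)]
    congr 1
    ring
  rw [this]
  ring

/-- For the pure power `v = s^{a/2}` there is equality, `(v²)'' = 4 (a-1)/a · v'²`. The
regularization only adds the nonnegative term coming from `2 a m δ³`, with `m` the positive part of
`s - δ`, so the constant does not depend on `δ`. -/
lemma regPowDeriv_sq_le {δ : ℝ} (hδ : 0 < δ) (s : ℝ) {a : ℝ} (ha : 0 < a) :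
    4 * (a - 1) / a * regPowDeriv δ a s ^ 2 ≤ regTestDeriv δ a s := by
  have hP := regCube_pos hδ s
  set m := max (s - δ) 0
  have hm : 0 ≤ m := le_max_right _ _
  have h1 : regCube δ s ^ (a / 3 - 1) = regCube δ s * regCube δ s ^ (a / 3 - 1 - 1) := by
    rw [Real.rpow_sub_one hP.ne' (a / 3 - 1)]
    field_simp
  have h2 : (regCube δ s ^ (a / 6 - 1)) ^ 2 = regCube δ s ^ (a / 3 - 1 - 1) := by
    rw [← Real.rpow_natCast, ← Real.rpow_mul hP.le]
    congr 1
    push_cast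
    ring
  have h3 : 4 * (a - 1) / a * regPowDeriv δ a s ^ 2 =
      a * (a - 1) * m ^ 4 * regCube δ s ^ (a / 3 - 1 - 1) := by
    simp only [regPowDeriv]
    rw [mul_pow, h2]
    field_simp
    ring
  have h4 : regTestDeriv δ a s =
      a * m * (2 * regCube δ s + (a - 3) * m ^ 3) * regCube δ s ^ (a / 3 - 1 - 1) := by
    simp only [regTestDeriv]
    rw [h1]
    ring
  rw [h3, h4]
  refine mul_le_mul_of_nonneg_right ?_ (Real.rpow_nonneg hP.le _)
  have h5 : regCube δ s = δ ^ 3 + m ^ 3 := rfl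
  rw [h5]
  have : 0 ≤ a * m * δ ^ 3 := by positivity
  nlinarith

/-- Controls the term with `u f`. A pure power would give `a`; the factor two pays for the shift by
`δ`, through `(m + δ) m² ≤ 2 (δ³ + m³)` with `m` the positive part of `s - δ`. -/
lemma mul_regTest_le {δ : ℝ} (hδ : 0 < δ) (s : ℝ) {a : ℝ} (ha : 0 < a) : s * regTest δ a s ≤ 2 * a * regPow δ a s ^ 2 := by
  have hP := regCube_pos hδ s
  set m := max (s - δ) 0
  have hm : 0 ≤ m := le_max_right _ _
  have h1 : regCube δ s ^ (a / 3) = regCube δ s * regCube δ s ^ (a / 3 - 1) := by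
    rw [Real.rpow_sub_one hP.ne']
    field_simp
  rw [regPow_sq hδ, h1]
  have h2 : s * regTest δ a s = a * (s * m ^ 2) * regCube δ s ^ (a / 3 - 1) := by
    simp only [regTest]
    ring
  rw [h2, show 2 * a * (regCube δ s * regCube δ s ^ (a / 3 - 1)) =
    a * (2 * regCube δ s) * regCube δ s ^ (a / 3 - 1) by ring]
  refine mul_le_mul_of_nonneg_right (mul_le_mul_of_nonneg_left ?_ ha.le) (Real.rpow_nonneg hP.le _)
  have h5 : regCube δ s = δ ^ 3 + m ^ 3 := rfl
  have h6 : s ≤ m + δ := by linarith [le_max_left (s - δ) 0]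
  have h7 : s * m ^ 2 ≤ (m + δ) * m ^ 2 := mul_le_mul_of_nonneg_right h6 (sq_nonneg m)
  rw [h5]
  rcases le_total m δ with h | h
  · have : m ^ 2 * δ ≤ δ ^ 2 * δ := mul_le_mul_of_nonneg_right (pow_le_pow_left₀ hm h 2) hδ.le
    nlinarith [pow_nonneg hm 3, pow_pos hδ 3]
  · have : m ^ 2 * δ ≤ m ^ 2 * m := mul_le_mul_of_nonneg_left h (sq_nonneg m)
    nlinarith [pow_nonneg hm 3, pow_pos hδ 3]

lemma regTest_nonneg {δ : ℝ} (hδ : 0 < δ) {a : ℝ} (ha : 0 ≤ a) (s : ℝ) : 0 ≤ regTest δ a s := by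
  have := regCube_pos hδ s
  simp only [regTest]
  positivity

lemma regTest_eq_zero {δ : ℝ} (a : ℝ) {s : ℝ} (hs : s ≤ δ) : regTest δ a s = 0 := by
  simp [regTest, max_eq_right (sub_nonpos.2 hs)]

lemma regCube_of_le {δ s : ℝ} (hs : s ≤ δ) : regCube δ s = δ ^ 3 := by
  simp [regCube, max_eq_right (sub_nonpos.2 hs)]

end Regularization

end Regularizing

/-! ### The energy estimate on a time slice. -/

section Caccioppoli

variable {n : ℕ} {M : Type*} [TopologicalSpace M] [ChartedSpace (EuclideanSpace ℝ (Fin n)) M]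
  [IsManifold (𝓡 n) ∞ M]

lemma gradPair_quadratic_nonneg (g : SmoothMetric n M) (h k : M → ℝ) (y : M) (a b : ℝ) :
    0 ≤ a ^ 2 * gradPair g h h y + 2 * a * b * gradPair g h k y + b ^ 2 * gradPair g k k y := by
  have h1 := innerM_self_nonneg g y (a • gradVec g h y + b • gradVec g k y)
  simp only [map_add, map_smul, add_apply, smul_apply, smul_eq_mul] at h1
  rw [← gradPair_eq_inner, ← gradPair_eq_inner, ← gradPair_eq_inner, ← gradPair_eq_inner,
    gradPair_comm g k h] at h1
  linarith

section Truncation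

variable {χ : ℝ → ℝ} {δ c : ℝ} {f : M → ℝ} {y : M}

/-- Where `f ≤ 0 < δ` the composite is locally constant, and no regularity of `f` beyond continuity
is needed; elsewhere `f > 0` and the chain rule applies. -/
lemma contMDiffAt_comp_of_const_below (hχ : ContDiff ℝ 1 χ) (hδ : 0 < δ)
    (hconst : ∀ s ≤ δ, χ s = c) (hfc : ContinuousAt f y)
    (hf : 0 < f y → ContMDiffAt (𝓡 n) 𝓘(ℝ, ℝ) 2 f y) :
    ContMDiffAt (𝓡 n) 𝓘(ℝ, ℝ) 1 (fun y ↦ χ (f y)) y := by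
  rcases lt_or_ge 0 (f y) with h | h
  · exact hχ.contMDiff.contMDiffAt.comp y ((hf h).of_le (by exact_mod_cast one_le_two))
  · refine (contMDiffAt_const (c := c)).congr_of_eventuallyEq ?_
    filter_upwards [hfc.eventually (Iio_mem_nhds (h.trans_lt hδ))] with z hz
    exact hconst _ (le_of_lt hz)

lemma dM_comp_of_const_below {χ' : ℝ} (hδ : 0 < δ) (hconst : ∀ s ≤ δ, χ s = c)
    (hfc : ContinuousAt f y) (hf : 0 < f y → ContMDiffAt (𝓡 n) 𝓘(ℝ, ℝ) 2 f y)
    (hχ : HasDerivAt χ χ' (f y)) :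
    dM (n := n) (fun y ↦ χ (f y)) y = χ' • dM f y := by
  rcases lt_or_ge 0 (f y) with h | h
  · exact dM_comp (mdifferentiableAt_of_contMDiffAt (by exact_mod_cast one_le_two) (hf h)) hχ
  · have h1 : χ =ᶠ[𝓝 (f y)] fun _ ↦ c := by
      filter_upwards [Iio_mem_nhds (h.trans_lt hδ)] with z hz
      exact hconst _ (le_of_lt hz)
    have h2 : χ' = 0 := (hχ.congr_of_eventuallyEq h1.symm).unique (hasDerivAt_const _ c)
    rw [h2, zero_smul, ← dM_const c y]
    exact dM_congr (hfc.eventually h1)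

end Truncation

variable [T2Space M]

/-- The pointwise inequality behind the energy estimate. -/
lemma gradient_terms_le {p r q η v v' H' H'' θ : ℝ}
    (hq : ∀ a b : ℝ, 0 ≤ a ^ 2 * p + 2 * a * b * r + b ^ 2 * q)
    (hH' : H' = 2 * v * v') (hH'' : θ * v' ^ 2 ≤ H'') (hθ : 0 < θ) (hθ4 : θ ≤ 4) :
    -(2 * η * H' * r + η ^ 2 * H'' * q) ≤
      -(θ / 4) * (v ^ 2 * p + 2 * (η * v * v') * r + η ^ 2 * v' ^ 2 * q) +
        (2 + 8 / θ) * (v ^ 2 * p) := by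
  have hp0 : 0 ≤ p := by simpa using hq 1 0
  have hq0 : 0 ≤ q := by simpa using hq 0 1
  -- Two completed squares. The first absorbs the cross term `4 η v v' r` at the cost `8/θ · v² p`;
  -- the second converts part of the remaining energy of `v` into that of the product `η v`. The
  -- condition `θ ≤ 4` pays for what is left of `v² p`.
  have h1 := mul_nonneg (by positivity : 0 ≤ θ / 2) (hq (4 * v / θ) (η * v'))
  have h2 := mul_nonneg (by positivity : 0 ≤ θ / 4) (hq (-v) (η * v'))
  have h3 : 0 ≤ (2 - θ / 2) * (v ^ 2 * p) := mul_nonneg (by linarith) (by positivity)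
  have h4 : θ * v' ^ 2 * (η ^ 2 * q) ≤ H'' * (η ^ 2 * q) :=
    mul_le_mul_of_nonneg_right hH'' (by positivity)
  have h5 : θ / 2 * ((4 * v / θ) ^ 2 * p + 2 * (4 * v / θ) * (η * v') * r + (η * v') ^ 2 * q) =
      8 / θ * (v ^ 2 * p) + 4 * (η * v * v') * r + θ / 2 * (η ^ 2 * v' ^ 2 * q) := by
    field_simp
    ring
  rw [h5] at h1
  rw [hH']
  nlinarith

variable [SecondCountableTopology M] [MeasurableSpace M] [BorelSpace M]

/-- The energy estimate on a time slice. -/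
theorem caccioppoli (g : SmoothMetric n M) {B : Set M} (hB : IsOpen B) {f F U η : M → ℝ}
    (hfc : ContinuousOn f B) (hf : ∀ y ∈ B, 0 < f y → ContMDiffAt (𝓡 n) 𝓘(ℝ, ℝ) 2 f y)
    (hF : ∀ y ∈ B, 0 < f y → F y ≤ laplacian g f y + U y * f y)
    (hFc : ContinuousOn F {y | y ∈ B ∧ 0 < f y}) (hU0 : ∀ y ∈ B, 0 ≤ U y)
    (hUi : IntegrableOn U (tsupport η) (vol g)) (hη : ContMDiff (𝓡 n) 𝓘(ℝ, ℝ) ∞ η)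
    (hηc : HasCompactSupport η) (hηB : tsupport η ⊆ B) {a θ δ : ℝ} (hδ : 0 < δ) (ha : 0 < a)
    (hθ : 0 < θ) (hθ4 : θ ≤ 4) (hθa : θ ≤ 4 * (a - 1) / a) :
    ∫ y, η y ^ 2 * regTest δ a (f y) * F y ∂vol g ≤
      -(θ / 4) * ∫ y, gradPair g (fun y ↦ η y * regPow δ a (f y))
        (fun y ↦ η y * regPow δ a (f y)) y ∂vol g +
      (2 + 8 / θ) * ∫ y, regPow δ a (f y) ^ 2 * gradPair g η η y ∂vol g +
      2 * a * ∫ y, U y * (η y * regPow δ a (f y)) ^ 2 ∂vol g := by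
  set O := {y | y ∈ B ∧ 0 < f y}
  have hO : IsOpen O := hfc.isOpen_inter_preimage hB isOpen_Ioi
  have hfat {y : M} (hy : y ∈ B) : ContinuousAt f y := hfc.continuousAt (hB.mem_nhds hy)
  have hη1 : ContMDiff (𝓡 n) 𝓘(ℝ, ℝ) 1 η := hη.of_le (by simp)
  have hηd (y : M) : MDifferentiableAt (𝓡 n) 𝓘(ℝ, ℝ) η y :=
    mdifferentiableAt_of_contMDiffAt le_rfl (hη1 y)
  have hTc : ∀ s ≤ δ, regTest δ a s = 0 := fun s hs ↦ regTest_eq_zero a hs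
  have hvc : ∀ s ≤ δ, regPow δ a s = (δ ^ 3) ^ (a / 6) := fun s hs ↦ by
    rw [regPow, regCube_of_le hs]
  have hT1 : ∀ y ∈ B, ContMDiffAt (𝓡 n) 𝓘(ℝ, ℝ) 1 (fun y ↦ regTest δ a (f y)) y := fun y hy ↦
    contMDiffAt_comp_of_const_below (contDiff_regTest hδ a) hδ hTc (hfat hy) (hf y hy)
  have hv1 : ∀ y ∈ B, ContMDiffAt (𝓡 n) 𝓘(ℝ, ℝ) 1 (fun y ↦ regPow δ a (f y)) y := fun y hy ↦
    contMDiffAt_comp_of_const_below (contDiff_regPow hδ a) hδ hvc (hfat hy) (hf y hy)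
  have hTd : ∀ y ∈ B, dM (n := n) (fun y ↦ regTest δ a (f y)) y = regTestDeriv δ a (f y) • dM f y :=
    fun y hy ↦ dM_comp_of_const_below hδ hTc (hfat hy) (hf y hy) (hasDerivAt_regTest hδ a _)
  have hvd : ∀ y ∈ B, dM (n := n) (fun y ↦ regPow δ a (f y)) y = regPowDeriv δ a (f y) • dM f y :=
    fun y hy ↦ dM_comp_of_const_below hδ hvc (hfat hy) (hf y hy) (hasDerivAt_regPow hδ a _)
  have hvcont : ContinuousOn (fun y ↦ regPow δ a (f y)) B := fun y hy ↦
    (hv1 y hy).continuousAt.continuousWithinAt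
  set φ : M → ℝ := fun y ↦ η y * regPow δ a (f y)
  set ψ : M → ℝ := fun y ↦ η y ^ 2 * regTest δ a (f y)
  have hφ : ContMDiff (𝓡 n) 𝓘(ℝ, ℝ) 1 φ := contMDiff_mul_of_tsupport hη1 hηB hv1
  have hη2s : tsupport (fun y ↦ η y ^ 2) ⊆ tsupport η :=
    closure_mono fun y hy ↦ by
      rw [Function.mem_support] at hy ⊢
      exact fun h ↦ hy (by simp [h])
  have hψ : ContMDiff (𝓡 n) 𝓘(ℝ, ℝ) 1 ψ :=
    contMDiff_mul_of_tsupport (hη1.pow 2) (hη2s.trans hηB) hT1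
  have hφs : tsupport φ ⊆ tsupport η := tsupport_mul_subset_left
  have hψs : tsupport ψ ⊆ tsupport η := tsupport_mul_subset_left.trans hη2s
  have hφc : HasCompactSupport φ := hηc.mul_right
  have hψc : HasCompactSupport ψ := hηc.of_isClosed_subset (isClosed_tsupport _) hψs
  -- The test function vanishes where `f ≤ δ`, so its support lies in the closed region `f ≥ δ`,
  -- inside the open set where `f` is `C²` and Green's formula holds.
  have hψO : tsupport ψ ⊆ O := by
    have hcl : IsClosed (tsupport η ∩ f ⁻¹' Ici δ) :=
      (hfc.mono hηB).preimage_isClosed_of_isClosed (isClosed_tsupport η) isClosed_Ici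
    refine (closure_minimal (fun y hy ↦ ?_) hcl).trans
      fun y hy ↦ ⟨hηB hy.1, hδ.trans_le hy.2⟩
    rw [Function.mem_support] at hy
    refine ⟨hψs (subset_closure hy), ?_⟩
    by_contra h
    exact hy (by simp only [ψ]; rw [hTc _ (not_le.1 h).le, mul_zero])
  have hout {y : M} (hy : y ∉ tsupport η) : η y = 0 := image_eq_zero_of_notMem_tsupport hy
  have hint {G : M → ℝ} (hG : Continuous G) (h0 : ∀ y ∉ tsupport η, G y = 0) :
      Integrable G (vol g) :=
    hG.integrable_of_hasCompactSupport (HasCompactSupport.intro hηc h0)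
  have hO1 : ∀ y ∈ O, ContMDiffAt (𝓡 n) 𝓘(ℝ, ℝ) 1 f y := fun y hy ↦
    (hf y hy.1 hy.2).of_le (by exact_mod_cast one_le_two)
  have hi1 : Integrable (fun y ↦ ψ y * F y) (vol g) :=
    hint (continuous_mul_of_tsupport hO hψ.continuous hψO hFc) fun y hy ↦ by simp [ψ, hout hy]
  have hi2 : Integrable (fun y ↦ ψ y * laplacian g f y) (vol g) :=
    hint (continuous_mul_of_tsupport hO hψ.continuous hψO
      (continuousOn_laplacian g hO fun y hy ↦ hf y hy.1 hy.2)) fun y hy ↦ by simp [ψ, hout hy]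
  have hi3 : Integrable (fun y ↦ U y * φ y ^ 2) (vol g) :=
    (hUi.mul_continuousOn (hφ.continuous.pow 2).continuousOn
      hηc).integrable_of_forall_notMem_eq_zero fun y hy ↦ by simp [φ, hout hy]
  have hi4 : Integrable (gradPair g ψ f) (vol g) :=
    (continuous_gradPair_of_tsupport g hO hO1 hψO hψ).integrable_of_hasCompactSupport
      (hasCompactSupport_gradPair g hψc)
  have hi5 : Integrable (gradPair g φ φ) (vol g) :=
    (continuous_gradPair_of_tsupport g isOpen_univ (fun y _ ↦ hφ y) (subset_univ _)
      hφ).integrable_of_hasCompactSupport (hasCompactSupport_gradPair g hφc)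
  have hi6 : Integrable (fun y ↦ regPow δ a (f y) ^ 2 * gradPair g η η y) (vol g) := by
    have h1 : Continuous (gradPair g η η) :=
      continuous_gradPair_of_tsupport g isOpen_univ (fun y _ ↦ hη1 y) (subset_univ _) hη1
    have h2 : tsupport (gradPair g η η) ⊆ tsupport η :=
      closure_minimal (fun y hy ↦ by
        by_contra h
        exact hy (gradPair_eq_zero_of_notMem_tsupport g η h)) (isClosed_tsupport η)
    have h3 := continuous_mul_of_tsupport hB h1 (h2.trans hηB) (hvcont.pow 2)
    simp only [mul_comm (regPow δ a (f _) ^ 2)]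
    exact hint h3 fun y hy ↦ by simp [gradPair_eq_zero_of_notMem_tsupport g η hy]
  have hpt1 (y : M) : ψ y * F y ≤ ψ y * laplacian g f y + 2 * a * (U y * φ y ^ 2) := by
    by_cases hy : y ∈ tsupport η
    · have hyB := hηB hy
      have hU := hU0 y hyB
      rcases le_or_gt (f y) δ with h | h
      · have : ψ y = 0 := by simp only [ψ]; rw [hTc _ h, mul_zero]
        rw [this, zero_mul, zero_mul, zero_add]
        positivity
      · have h1 := hF y hyB (hδ.trans h)
        have hψ0 : 0 ≤ ψ y := mul_nonneg (sq_nonneg _) (regTest_nonneg hδ ha.le _)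
        have h2 := mul_le_mul_of_nonneg_left h1 hψ0
        have h3 : ψ y * (U y * f y) ≤ 2 * a * (U y * φ y ^ 2) := by
          have h4 := mul_regTest_le hδ (f y) ha
          calc ψ y * (U y * f y) = U y * η y ^ 2 * (f y * regTest δ a (f y)) := by
                simp only [ψ]; ring
            _ ≤ U y * η y ^ 2 * (2 * a * regPow δ a (f y) ^ 2) :=
                mul_le_mul_of_nonneg_left h4 (mul_nonneg hU (sq_nonneg _))
            _ = _ := by simp only [φ]; ring
        linarith
    · simp [ψ, φ, hout hy]
  have hpt2 (y : M) : -gradPair g ψ f y ≤ -(θ / 4) * gradPair g φ φ y +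
      (2 + 8 / θ) * (regPow δ a (f y) ^ 2 * gradPair g η η y) := by
    by_cases hy : y ∈ tsupport η
    · have hyB := hηB hy
      have hvm := mdifferentiableAt_of_contMDiffAt le_rfl (hv1 y hyB)
      have hTm := mdifferentiableAt_of_contMDiffAt le_rfl (hT1 y hyB)
      have hdφ : dM (n := n) φ y = (η y * regPowDeriv δ a (f y)) • dM f y + regPow δ a (f y) • dM η y := by
        simp only [φ]
        rw [dM_mul (hηd y) hvm, hvd y hyB, smul_smul]
      have hdη2 : dM (n := n) (fun y ↦ η y ^ 2) y = (2 * η y) • dM η y :=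
        dM_comp (χ := fun s ↦ s ^ 2) (hηd y) (by simpa using hasDerivAt_pow 2 (η y))
      have hdψ : dM (n := n) ψ y = (η y ^ 2 * regTestDeriv δ a (f y)) • dM f y +
          (regTest δ a (f y) * (2 * η y)) • dM η y := by
        simp only [ψ]
        rw [dM_mul (mdifferentiableAt_of_contMDiffAt le_rfl ((hη1.pow 2) y)) hTm, hTd y hyB, hdη2,
          smul_smul, smul_smul]
      have e1 (k : M → ℝ) : gradPair g φ k y = η y * regPowDeriv δ a (f y) * gradPair g f k y +
          regPow δ a (f y) * gradPair g η k y := by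
        rw [gradPair_eq_dM, hdφ, gradPair_eq_dM, gradPair_eq_dM]
        rfl
      have e2 : gradPair g ψ f y = 2 * η y * regTest δ a (f y) * gradPair g η f y +
          η y ^ 2 * regTestDeriv δ a (f y) * gradPair g f f y := by
        rw [gradPair_eq_dM, hdψ, gradPair_eq_dM, gradPair_eq_dM]
        simp only [add_apply, smul_apply, smul_eq_mul]
        ring
      have e3 : gradPair g φ φ y = regPow δ a (f y) ^ 2 * gradPair g η η y +
          2 * (η y * regPow δ a (f y) * regPowDeriv δ a (f y)) * gradPair g η f y +
          η y ^ 2 * regPowDeriv δ a (f y) ^ 2 * gradPair g f f y := by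
        rw [e1, gradPair_comm g f φ, gradPair_comm g η φ, e1, e1, gradPair_comm g f η]
        ring
      rw [e2, e3]
      refine gradient_terms_le (gradPair_quadratic_nonneg g η f y) (regTest_eq hδ a _) ?_ hθ hθ4
      exact (mul_le_mul_of_nonneg_right hθa (sq_nonneg _)).trans (regPowDeriv_sq_le hδ _ ha)
    · rw [gradPair_eq_zero_of_notMem_tsupport g f fun h ↦ hy (hψs h),
        gradPair_eq_zero_of_notMem_tsupport g φ fun h ↦ hy (hφs h),
        gradPair_eq_zero_of_notMem_tsupport g η hy]
      simp
  calc ∫ y, ψ y * F y ∂vol g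
      ≤ ∫ y, (ψ y * laplacian g f y + 2 * a * (U y * φ y ^ 2)) ∂vol g :=
        integral_mono hi1 (hi2.add (hi3.const_mul _)) hpt1
    _ = ∫ y, -gradPair g ψ f y ∂vol g + 2 * a * ∫ y, U y * φ y ^ 2 ∂vol g := by
        rw [integral_add hi2 (hi3.const_mul _), integral_const_mul, integral_neg,
          green g hO (fun y hy ↦ hf y hy.1 hy.2) hψc hψO hψ]
    _ ≤ ∫ y, (-(θ / 4) * gradPair g φ φ y +
          (2 + 8 / θ) * (regPow δ a (f y) ^ 2 * gradPair g η η y)) ∂vol g +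
          2 * a * ∫ y, U y * φ y ^ 2 ∂vol g := by
        exact add_le_add
          (integral_mono hi4.neg ((hi5.const_mul _).add (hi6.const_mul _)) hpt2) le_rfl
    _ = _ := by
        rw [integral_add (hi5.const_mul _) (hi6.const_mul _), integral_const_mul,
          integral_const_mul]

end Caccioppoli

/-! ### Interpolation of the potential term; differentiation under the integral. -/

section Interpolation

/-- Hölder's inequality interpolating between `L¹` and `L^{d/(d-2)}`. -/
lemma lintegral_mul_le_interpolation {α : Type*} [MeasurableSpace α] {ν : Measure α}
    {U F : α → ℝ≥0∞} (hU : AEMeasurable U ν) (hF : AEMeasurable F ν) {d q : ℝ} (hd : 2 < d)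
    (hq : d < q) :
    ∫⁻ y, U y * F y ∂ν ≤ (∫⁻ y, U y ^ (q / 2) ∂ν) ^ (2 / q) * (∫⁻ y, F y ∂ν) ^ (1 - d / q) *
      (∫⁻ y, F y ^ (d / (d - 2)) ∂ν) ^ ((d - 2) / q) := by
  have hd0 : 0 < d := by linarith
  have hd2 : 0 < d - 2 := by linarith
  have hq0 : 0 < q := by linarith
  have hdq : 0 ≤ 1 - d / q := by
    rw [sub_nonneg, div_le_one hq0]
    exact hq.le
  -- Hölder with three factors and weights `2/q`, `1 - d/q`, `(d-2)/q`. They sum to one, and `F`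
  -- appears with total power `(1 - d/q) + d/q = 1`.
  have h := ENNReal.lintegral_prod_norm_pow_le (μ := ν) (Finset.univ : Finset (Fin 3))
    (f := ![fun y ↦ U y ^ (q / 2), F, fun y ↦ F y ^ (d / (d - 2))])
    (p := ![2 / q, 1 - d / q, (d - 2) / q])
    (by
      intro i _
      fin_cases i
      · exact hU.pow_const _
      · exact hF
      · exact hF.pow_const _)
    (by
      simp only [Fin.sum_univ_three, Matrix.cons_val]
      field_simp
      ring)
    (by
      intro i _
      fin_cases i
      · exact (by positivity : 0 ≤ 2 / q)
      · exact hdq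
      · exact (by positivity : 0 ≤ (d - 2) / q))
  simp only [Fin.prod_univ_three, Matrix.cons_val] at h
  refine le_trans (lintegral_mono fun y ↦ le_of_eq ?_) h
  rw [← ENNReal.rpow_mul, ← ENNReal.rpow_mul, div_mul_div_cancel₀ two_ne_zero, div_self hq0.ne',
    ENNReal.rpow_one, div_mul_div_cancel₀ hd2.ne', mul_assoc,
    ← ENNReal.rpow_add_of_nonneg _ _ hdq (by positivity), sub_add_cancel, ENNReal.rpow_one]

/-- The bound on `U` is imposed on the lower integral, where it carries integrability with it; a
Bochner integral would be zero in the non-integrable case. -/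
lemma integral_mul_le_interpolation {α : Type*} [MeasurableSpace α] {ν : Measure α}
    {U F : α → ℝ} (hU : AEMeasurable U ν) (hU0 : ∀ᵐ y ∂ν, 0 ≤ U y) (hF0 : ∀ y, 0 ≤ F y) {d q m : ℝ}
    (hd : 2 < d) (hq : d < q) (hm : 0 ≤ m) (hF : Integrable F ν)
    (hFd : Integrable (fun y ↦ F y ^ (d / (d - 2))) ν)
    (hUq : (∫⁻ y, ENNReal.ofReal (U y) ^ (q / 2) ∂ν) ^ (2 / q) ≤ ENNReal.ofReal m) :
    ∫ y, U y * F y ∂ν ≤ m * (∫ y, F y ∂ν) ^ (1 - d / q) *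
      (∫ y, F y ^ (d / (d - 2)) ∂ν) ^ ((d - 2) / q) := by
  have hd0 : 0 < d := by linarith
  have hd2 : 0 < d - 2 := by linarith
  have hq0 : 0 < q := by linarith
  have hdq : 0 ≤ 1 - d / q := by
    rw [sub_nonneg, div_le_one hq0]
    exact hq.le
  have hFd0 (y : α) : 0 ≤ F y ^ (d / (d - 2)) := Real.rpow_nonneg (hF0 y) _
  have hX : 0 ≤ ∫ y, F y ∂ν := integral_nonneg hF0
  have hS : 0 ≤ ∫ y, F y ^ (d / (d - 2)) ∂ν := integral_nonneg hFd0
  rw [integral_eq_lintegral_of_nonneg_ae (hU0.mono fun y hy ↦ mul_nonneg hy (hF0 y))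
    (hU.mul hF.aemeasurable).aestronglyMeasurable]
  refine ENNReal.toReal_le_of_le_ofReal (by positivity) ?_
  calc ∫⁻ y, ENNReal.ofReal (U y * F y) ∂ν
      = ∫⁻ y, ENNReal.ofReal (U y) * ENNReal.ofReal (F y) ∂ν :=
        lintegral_congr_ae (hU0.mono fun y hy ↦ ENNReal.ofReal_mul hy)
    _ ≤ _ := lintegral_mul_le_interpolation hU.ennreal_ofReal hF.aemeasurable.ennreal_ofReal hd hq
    _ ≤ ENNReal.ofReal m * ENNReal.ofReal (∫ y, F y ∂ν) ^ (1 - d / q) *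
        ENNReal.ofReal (∫ y, F y ^ (d / (d - 2)) ∂ν) ^ ((d - 2) / q) := by
      have h1 : ∫⁻ y, ENNReal.ofReal (F y) ^ (d / (d - 2)) ∂ν =
          ENNReal.ofReal (∫ y, F y ^ (d / (d - 2)) ∂ν) := by
        rw [ofReal_integral_eq_lintegral_ofReal hFd (Eventually.of_forall hFd0)]
        exact lintegral_congr fun y ↦ ENNReal.ofReal_rpow_of_nonneg (hF0 y) (by positivity)
      rw [h1, ← ofReal_integral_eq_lintegral_ofReal hF (Eventually.of_forall hF0)]
      gcongr
    _ = _ := by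
      rw [ENNReal.ofReal_rpow_of_nonneg hX hdq, ENNReal.ofReal_rpow_of_nonneg hS (by positivity),
        ← ENNReal.ofReal_mul hm, ← ENNReal.ofReal_mul (mul_nonneg hm (Real.rpow_nonneg hX _))]

/-- Young's inequality with a small constant in front of the second factor. -/
lemma mul_rpow_mul_rpow_le {K X S ε e : ℝ} (hK : 0 ≤ K) (hX : 0 ≤ X) (hS : 0 ≤ S) (hε : 0 < ε)
    (he : 0 < e) (he1 : e < 1) :
    K * X ^ (1 - e) * S ^ e ≤ ε * S + K ^ (1 / (1 - e)) * ε ^ (-(e / (1 - e))) * X := by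
  have h1e : 0 < 1 - e := by linarith
  -- Chosen so that the weighted geometric mean of `P` and `ε S` is exactly the left-hand side.
  set P := K ^ (1 / (1 - e)) * ε ^ (-(e / (1 - e))) * X
  have hP : 0 ≤ P := by positivity
  have h := Real.geom_mean_le_arith_mean2_weighted h1e.le he.le hP
    (mul_nonneg hε.le hS) (by ring)
  have h1 : P ^ (1 - e) * (ε * S) ^ e = K * X ^ (1 - e) * S ^ e := by
    simp only [P]
    rw [Real.mul_rpow (by positivity) hX, Real.mul_rpow (by positivity) (by positivity),
      ← Real.rpow_mul hK, ← Real.rpow_mul hε.le, Real.mul_rpow hε.le hS,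
      one_div_mul_cancel h1e.ne', Real.rpow_one, neg_mul, div_mul_cancel₀ _ h1e.ne']
    calc _ = K * X ^ (1 - e) * S ^ e * (ε ^ (-e) * ε ^ e) := by ring
      _ = _ := by rw [← Real.rpow_add hε, neg_add_cancel, Real.rpow_zero, mul_one]
  rw [h1] at h
  have h2 : (1 - e) * P ≤ P := mul_le_of_le_one_left hP (by linarith)
  have h3 : e * (ε * S) ≤ ε * S := mul_le_of_le_one_left (by positivity) he1.le
  linarith

/-- Differentiation under the integral sign over a compact set. -/
lemma hasDerivAt_setIntegral_of_compact {X : Type*} [TopologicalSpace X] [T2Space X]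
    [MeasurableSpace X] [BorelSpace X] {m : Measure X} [IsFiniteMeasureOnCompacts m] {K : Set X}
    (hK : IsCompact K) {G G' : ℝ → X → ℝ} {T t : ℝ} (ht : t ∈ Ioo 0 T)
    (hG : ContinuousOn (fun z : X × ℝ ↦ G z.2 z.1) (K ×ˢ Ioo 0 T))
    (hG' : ContinuousOn (fun z : X × ℝ ↦ G' z.2 z.1) (K ×ˢ Ioo 0 T))
    (hd : ∀ s ∈ Ioo 0 T, ∀ y ∈ K, HasDerivAt (G · y) (G' s y) s) :
    IntegrableOn (G' t) K m ∧
      HasDerivAt (fun s ↦ ∫ y in K, G s y ∂m) (∫ y in K, G' t y ∂m) t := by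
  obtain ⟨ρ, hρ, hρT⟩ := Metric.nhds_basis_closedBall.mem_iff.1 (isOpen_Ioo.mem_nhds ht)
  have hslice {H : ℝ → X → ℝ} (hH : ContinuousOn (fun z : X × ℝ ↦ H z.2 z.1) (K ×ˢ Ioo 0 T))
      {s : ℝ} (hs : s ∈ Ioo 0 T) : ContinuousOn (H s) K :=
    hH.comp (by fun_prop : ContinuousOn (fun y : X ↦ (y, s)) K) fun y hy ↦ ⟨hy, hs⟩
  obtain ⟨b, hb⟩ := (hK.prod (isCompact_closedBall t ρ)).exists_bound_of_continuousOn
    (hG'.mono (prod_mono_right hρT))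
  have hKm := hK.measurableSet
  refine hasDerivAt_integral_of_dominated_loc_of_deriv_le (bound := fun _ ↦ b)
    (Metric.closedBall_mem_nhds t hρ) ?_ ((hslice hG ht).integrableOn_compact hK)
    ((hslice hG' ht).aestronglyMeasurable hKm) ?_ (integrableOn_const hK.measure_lt_top.ne) ?_
  · filter_upwards [isOpen_Ioo.mem_nhds ht] with s hs
    exact (hslice hG hs).aestronglyMeasurable hKm
  · exact (ae_restrict_iff' hKm).2 (Eventually.of_forall fun y hy s hs ↦ hb (y, s) ⟨hy, hs⟩)
  · exact (ae_restrict_iff' hKm).2 (Eventually.of_forall fun y hy s hs ↦ hd s (hρT hs) y hy)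

variable {n : ℕ} {M : Type*} [TopologicalSpace M] [ChartedSpace (EuclideanSpace ℝ (Fin n)) M]
  [IsManifold (𝓡 n) ∞ M] [T2Space M] [SecondCountableTopology M] [MeasurableSpace M] [BorelSpace M]

lemma integral_vol_eq (g₀ g : SmoothMetric n M) (F : M → ℝ) :
    ∫ y, F y ∂vol g = ∫ y, F y * densRatio g₀ g y ∂vol g₀ := by
  rw [vol_eq_withDensity g₀ g, integral_withDensity_eq_integral_toReal_smul
    (continuous_densRatio g₀ g).measurable.ennreal_ofReal
    (Eventually.of_forall fun _ ↦ ENNReal.ofReal_lt_top)]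
  refine integral_congr_ae (Eventually.of_forall fun y ↦ ?_)
  simp only [smul_eq_mul]
  rw [ENNReal.toReal_ofReal (densRatio_pos g₀ g y).le, mul_comm]

lemma setIntegral_densRatio (g₀ g : SmoothMetric n M) {F : M → ℝ} {K : Set M}
    (hF : ∀ y ∉ K, F y = 0) :
    ∫ y in K, F y * densRatio g₀ g y ∂vol g₀ = ∫ y, F y ∂vol g := by
  rw [integral_vol_eq g₀ g]
  exact setIntegral_eq_integral_of_forall_compl_eq_zero fun y hy ↦ by rw [hF y hy, zero_mul]

lemma integrableOn_of_lintegral_rpow {g : SmoothMetric n M} {U : M → ℝ} {B K : Set M} {e m : ℝ}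
    (hU : AEMeasurable U ((vol g).restrict B)) (hK : IsCompact K) (hKB : K ⊆ B) (hU0 : ∀ y ∈ B, 0 ≤ U y)
    (he : 1 ≤ e)
    (h : (∫⁻ y in B, ENNReal.ofReal (U y) ^ e ∂vol g) ^ (1 / e) ≤ ENNReal.ofReal m) :
    IntegrableOn U K (vol g) := by
  have he0 : 0 < e := by linarith
  have hfin : IsFiniteMeasure ((vol g).restrict K) := ⟨by
    rw [Measure.restrict_apply_univ]
    exact hK.measure_lt_top⟩
  have hmem : MemLp U (ENNReal.ofReal e) ((vol g).restrict K) := by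
    refine ⟨(hU.mono_measure (Measure.restrict_mono hKB le_rfl)).aestronglyMeasurable, ?_⟩
    rw [eLpNorm_eq_lintegral_rpow_enorm_toReal (by simpa using he0) ENNReal.ofReal_ne_top,
      ENNReal.toReal_ofReal he0.le]
    refine lt_of_le_of_lt ?_ (h.trans_lt ENNReal.ofReal_lt_top)
    gcongr 1
    calc ∫⁻ y in K, ‖U y‖ₑ ^ e ∂vol g = ∫⁻ y in K, ENNReal.ofReal (U y) ^ e ∂vol g := by
          refine setLIntegral_congr_fun hK.measurableSet fun y hy ↦ ?_
          rw [Real.enorm_eq_ofReal (hU0 y (hKB hy))]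
      _ ≤ _ := lintegral_mono_set hKB
  exact hmem.integrable (by simpa using ENNReal.ofReal_le_ofReal he)

end Interpolation

/-! ### The energy inequality for powers of a subsolution. -/

section Energy

variable {n : ℕ} {M : Type*} [TopologicalSpace M] [ChartedSpace (EuclideanSpace ℝ (Fin n)) M]
  [IsManifold (𝓡 n) ∞ M] [T2Space M] [SecondCountableTopology M]

namespace IsSubsolution

variable {g : ℝ → SmoothMetric n M} {B : Set M} {T : ℝ} {u f : ℝ → M → ℝ}

lemma continuousOn_slice (hf : IsSubsolution g B T u f) {t : ℝ} (ht : t ∈ Icc 0 T) :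
    ContinuousOn (f t) B :=
  hf.continuousOn.comp (by fun_prop : ContinuousOn (fun y : M ↦ (y, t)) B) fun _ hy ↦ ⟨hy, ht⟩

lemma continuousAt_time (hf : IsSubsolution g B T u f) {t : ℝ} (ht : t ∈ Ioo 0 T) {y : M}
    (hy : y ∈ B) : ContinuousAt (fun s ↦ f s y) t := by
  have h : ContinuousOn (fun s ↦ f s y) (Icc 0 T) :=
    hf.continuousOn.comp (by fun_prop : ContinuousOn (fun s : ℝ ↦ (y, s)) (Icc 0 T))
      fun _ hs ↦ ⟨hy, hs⟩
  exact h.continuousAt (Icc_mem_nhds ht.1 ht.2)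

/-- Where `f` vanishes it stays below `δ` for nearby times, so the regularized power is constant
there. The value of `deriv` at such a point is irrelevant, as `regTest` multiplies it by zero. -/
lemma hasDerivAt_regPow_sq (hf : IsSubsolution g B T u f) {δ : ℝ} (hδ : 0 < δ) (a : ℝ) {t : ℝ}
    (ht : t ∈ Ioo 0 T) {y : M} (hy : y ∈ B) :
    HasDerivAt (fun s ↦ regPow δ a (f s y) ^ 2)
      (regTest δ a (f t y) * deriv (fun s ↦ f s y) t) t := by
  rcases lt_or_ge 0 (f t y) with h | h
  · exact (MoserFlow.hasDerivAt_regPow_sq hδ a (f t y)).comp t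
      (hf.differentiableAt_time t ht y hy h).hasDerivAt
  · rw [regTest_eq_zero a (h.trans hδ.le), zero_mul]
    refine (hasDerivAt_const t (((δ ^ 3) ^ (a / 6)) ^ 2)).congr_of_eventuallyEq ?_
    filter_upwards [(hf.continuousAt_time ht hy).eventually (Iio_mem_nhds (h.trans_lt hδ))]
      with s hs
    rw [regPow, regCube_of_le (le_of_lt hs)]

/-- The time derivative is uncontrolled near the zero set of `f`, but the factor `regTest` vanishes
wherever `f ≤ δ`. -/
lemma continuousOn_regTest_mul_deriv (hf : IsSubsolution g B T u f) (hB : IsOpen B) {δ : ℝ}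
    (hδ : 0 < δ) (a : ℝ) :
    ContinuousOn (fun z : M × ℝ ↦ regTest δ a (f z.2 z.1) * deriv (fun s ↦ f s z.1) z.2)
      (B ×ˢ Ioo 0 T) := by
  have hO : IsOpen (B ×ˢ Ioo 0 T) := hB.prod isOpen_Ioo
  have hfc : ContinuousOn (fun z : M × ℝ ↦ f z.2 z.1) (B ×ˢ Ioo 0 T) :=
    hf.continuousOn.mono (prod_mono_right Ioo_subset_Icc_self)
  intro z hz
  have hfz : ContinuousAt (fun z : M × ℝ ↦ f z.2 z.1) z := hfc.continuousAt (hO.mem_nhds hz)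
  refine ContinuousAt.continuousWithinAt ?_
  rcases lt_or_ge 0 (f z.2 z.1) with h | h
  · have hmem : {z : M × ℝ | z.1 ∈ B ∧ z.2 ∈ Ioo 0 T ∧ 0 < f z.2 z.1} ∈ 𝓝 z := by
      filter_upwards [hO.mem_nhds hz, hfz.eventually (Ioi_mem_nhds h)] with w hw hw'
      exact ⟨hw.1, hw.2, hw'⟩
    have h1 : ContinuousAt (fun z : M × ℝ ↦ regTest δ a (f z.2 z.1)) z :=
      ContinuousAt.comp (f := fun z : M × ℝ ↦ f z.2 z.1)
        (contDiff_regTest hδ a).continuous.continuousAt hfz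
    exact h1.mul (hf.continuousOn_deriv_time.continuousAt hmem)
  · refine (continuousAt_const (y := (0 : ℝ))).congr ?_
    filter_upwards [hfz.eventually (Iio_mem_nhds (h.trans_lt hδ))] with w hw
    rw [regTest_eq_zero a (le_of_lt hw), zero_mul]

end IsSubsolution

variable [MeasurableSpace M] [BorelSpace M]

/-- The energy inequality for the powers of a subsolution. -/
theorem energy_inequality (hn : 3 ≤ n) (g₀ : SmoothMetric n M) {g : ℝ → SmoothMetric n M}
    {B : Set M} (hB : IsOpen B) {T A μ q c : ℝ} {u f : ℝ → M → ℝ} (hq : (n : ℝ) < q) (hA : 0 < A)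
    (hμ : 0 ≤ μ) (hc : 0 ≤ c) (hg : SmoothFamily g T) {t : ℝ} (ht : t ∈ Ioo 0 T)
    (hS : SobolevOn (g t) B A) (hu0 : ∀ y ∈ B, 0 ≤ u t y)
    (hum : AEMeasurable (u t) ((vol (g t)).restrict B)) (hV : VolumeGrowth g B T c u)
    (huq : (∫⁻ y in B, ENNReal.ofReal (u t y) ^ (q / 2) ∂vol (g t)) ^ (2 / q) ≤
      ENNReal.ofReal (μ * t ^ (-((q - n) / q))))
    (hf : IsSubsolution g B T u f) {η : M → ℝ} (hη : ContMDiff (𝓡 n) 𝓘(ℝ, ℝ) ∞ η)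
    {K : Set M} (hK : IsCompact K) (hKB : K ⊆ B) (hηK : tsupport η ⊆ K) {a θ δ : ℝ} (hδ : 0 < δ)
    (ha : 1 ≤ a) (hθ : 0 < θ) (hθ4 : θ ≤ 4) (hθa : θ ≤ 4 * (a - 1) / a) :
    ∃ I', HasDerivAt (fun s ↦ ∫ y in K, η y ^ 2 * regPow δ a (f s y) ^ 2 *
        densRatio g₀ (g s) y ∂vol g₀) I' t ∧
      I' ≤ -(θ / (8 * A)) * (∫ y in K, (η y ^ 2 * regPow δ a (f t y) ^ 2) ^ ((n : ℝ) / (n - 2)) *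
          densRatio g₀ (g t) y ∂vol g₀) ^ (((n : ℝ) - 2) / n) +
        (2 + 8 / θ) * ∫ y in K, gradPair (g t) η η y * regPow δ a (f t y) ^ 2 *
          densRatio g₀ (g t) y ∂vol g₀ +
        ((2 + c) * a * (μ * t ^ (-((q - n) / q)))) ^ (q / (q - n)) *
          (θ / (8 * A)) ^ (-(n / (q - n))) *
          ∫ y in K, η y ^ 2 * regPow δ a (f t y) ^ 2 * densRatio g₀ (g t) y ∂vol g₀ := by
  have hn3 : (3 : ℝ) ≤ n := by exact_mod_cast hn
  have hn0 : (0 : ℝ) < n := by linarith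
  have hn2 : (0 : ℝ) < n - 2 := by linarith
  have hq0 : 0 < q := by linarith
  have hqn : 0 < q - n := by linarith
  have ha0 : 0 < a := by linarith
  have htI : t ∈ Icc 0 T := Ioo_subset_Icc_self ht
  have hηB : tsupport η ⊆ B := hηK.trans hKB
  have hηc : HasCompactSupport η := hK.of_isClosed_subset (isClosed_tsupport η) hηK
  have hη1 : ContMDiff (𝓡 n) 𝓘(ℝ, ℝ) 1 η := hη.of_le (by simp)
  have hout {y : M} (hy : y ∉ K) : η y = 0 :=
    image_eq_zero_of_notMem_tsupport fun h ↦ hy (hηK h)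
  have hvcont : Continuous (regPow δ a) := (contDiff_regPow hδ a).continuous
  have hUi : IntegrableOn (u t) K (vol (g t)) := by
    refine integrableOn_of_lintegral_rpow hum hK hKB hu0 (e := q / 2) (by linarith) ?_
      (m := μ * t ^ (-((q - n) / q)))
    rwa [one_div_div]
  have hfK : ContinuousOn (fun z : M × ℝ ↦ f z.2 z.1) (K ×ˢ Ioo 0 T) :=
    hf.continuousOn.mono (prod_mono hKB Ioo_subset_Icc_self)
  have hwK : ContinuousOn (fun z : M × ℝ ↦ densRatio g₀ (g z.2) z.1) (K ×ˢ Ioo 0 T) :=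
    (continuousOn_densRatio g₀ hg).mono (prod_mono (subset_univ _) Ioo_subset_Icc_self)
  have hwK' : ContinuousOn (fun z : M × ℝ ↦ deriv (fun s ↦ densRatio g₀ (g s) z.1) z.2)
      (K ×ˢ Ioo 0 T) :=
    (continuousOn_deriv_densRatio g₀ hg).mono (prod_mono_left (subset_univ _))
  have hη2K : ContinuousOn (fun z : M × ℝ ↦ η z.1 ^ 2) (K ×ˢ Ioo 0 T) :=
    ((hη.continuous.comp continuous_fst).pow 2).continuousOn
  have hvK : ContinuousOn (fun z : M × ℝ ↦ regPow δ a (f z.2 z.1) ^ 2) (K ×ˢ Ioo 0 T) :=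
    (hvcont.comp_continuousOn hfK).pow 2
  have hTK := (hf.continuousOn_regTest_mul_deriv hB hδ a).mono
    (prod_mono_left (t := Ioo 0 T) hKB)
  set F : M → ℝ := fun y ↦ deriv (fun s ↦ f s y) t
  set w' : M → ℝ := fun y ↦ deriv (fun s ↦ densRatio g₀ (g s) y) t
  -- The derivative has two parts: one from `∂_t f`, estimated by `caccioppoli`, and one from `∂_t
  -- dv_t`, which the volume growth bounds by `c ∫ u φ²`, a term of the same kind as the potential
  -- term.
  obtain ⟨-, hder⟩ := hasDerivAt_setIntegral_of_compact (m := vol g₀) hK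
    (G := fun s y ↦ η y ^ 2 * regPow δ a (f s y) ^ 2 * densRatio g₀ (g s) y)
    (G' := fun s y ↦ η y ^ 2 * (regTest δ a (f s y) * deriv (fun s ↦ f s y) s) *
        densRatio g₀ (g s) y + η y ^ 2 * regPow δ a (f s y) ^ 2 *
        deriv (fun s ↦ densRatio g₀ (g s) y) s) ht
    ((hη2K.mul hvK).mul hwK) (((hη2K.mul hTK).mul hwK).add ((hη2K.mul hvK).mul hwK'))
    fun s hs y hy ↦ ((hf.hasDerivAt_regPow_sq hδ a hs (hKB hy)).const_mul (η y ^ 2)).mul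
      (differentiableAt_densRatio g₀ hg y hs).hasDerivAt
  refine ⟨_, hder, ?_⟩
  have hslice {H : M × ℝ → ℝ} (hH : ContinuousOn H (K ×ˢ Ioo 0 T)) :
      ContinuousOn (fun y ↦ H (y, t)) K :=
    hH.comp (by fun_prop : ContinuousOn (fun y : M ↦ (y, t)) K) fun y hy ↦ ⟨hy, ht⟩
  have hs1 : IntegrableOn (fun y ↦ η y ^ 2 * (regTest δ a (f t y) * F y) * densRatio g₀ (g t) y) K
      (vol g₀) := (hslice ((hη2K.mul hTK).mul hwK)).integrableOn_compact hK
  have hs2 : IntegrableOn (fun y ↦ η y ^ 2 * regPow δ a (f t y) ^ 2 * w' y) K (vol g₀) :=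
    (hslice ((hη2K.mul hvK).mul hwK')).integrableOn_compact hK
  have hs3 : ContinuousOn (fun y ↦ η y ^ 2 * regPow δ a (f t y) ^ 2) K := hslice (hη2K.mul hvK)
  set φ : M → ℝ := fun y ↦ η y * regPow δ a (f t y)
  have hφ2 (y : M) : η y ^ 2 * regPow δ a (f t y) ^ 2 = φ y ^ 2 := (mul_pow _ _ 2).symm
  have hfat : ∀ y ∈ B, 0 < f t y → ContMDiffAt (𝓡 n) 𝓘(ℝ, ℝ) 2 (f t) y :=
    hf.contMDiffAt_space t ht
  have hφ : ContMDiff (𝓡 n) 𝓘(ℝ, ℝ) 1 φ := contMDiff_mul_of_tsupport hη1 hηB fun y hy ↦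
    contMDiffAt_comp_of_const_below (contDiff_regPow hδ a) hδ
      (fun s hs ↦ by rw [regPow, regCube_of_le hs])
      ((hf.continuousOn_slice htI).continuousAt (hB.mem_nhds hy)) (hfat y hy)
  have hφc : HasCompactSupport φ := hηc.mul_right
  have hφs : tsupport φ ⊆ tsupport η := tsupport_mul_subset_left
  have hcac := caccioppoli (g t) hB (hf.continuousOn_slice htI) hfat (F := F) (U := u t)
    (hf.inequality t ht) (by
      have h1 : ContinuousOn (fun y : M ↦ ((y, t) : M × ℝ)) {y | y ∈ B ∧ 0 < f t y} := by fun_prop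
      exact hf.continuousOn_deriv_time.comp h1 fun y hy ↦ ⟨hy.1, ht, hy.2⟩) hu0
    (hUi.mono_set hηK) hη hηc hηB hδ ha0 hθ hθ4 hθa
  have hfirst : ∫ y in K, η y ^ 2 * (regTest δ a (f t y) * F y) * densRatio g₀ (g t) y ∂vol g₀ =
      ∫ y, η y ^ 2 * regTest δ a (f t y) * F y ∂vol (g t) := by
    rw [setIntegral_densRatio g₀ (g t) fun y hy ↦ by rw [hout hy]; simp]
    simp only [mul_assoc]
  have hsecond : ∫ y in K, η y ^ 2 * regPow δ a (f t y) ^ 2 * w' y ∂vol g₀ ≤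
      c * ∫ y, u t y * φ y ^ 2 ∂vol (g t) := by
    rw [← setIntegral_densRatio (K := K) g₀ (g t) fun y hy ↦ by simp [φ, hout hy],
      ← integral_const_mul]
    have hUw : IntegrableOn (fun y ↦ u t y * φ y ^ 2 * densRatio g₀ (g t) y) K (vol g₀) := by
      have h1 : IntegrableOn (fun y ↦ u t y * φ y ^ 2) K (vol (g t)) :=
        hUi.mul_continuousOn (hφ.continuous.pow 2).continuousOn hK
      rw [vol_eq_withDensity g₀ (g t), IntegrableOn, restrict_withDensity hK.measurableSet,
        integrable_withDensity_iff_integrable_smul'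
          (continuous_densRatio g₀ (g t)).measurable.ennreal_ofReal
          (Eventually.of_forall fun _ ↦ ENNReal.ofReal_lt_top)] at h1
      refine h1.congr (Eventually.of_forall fun y ↦ ?_)
      simp only [smul_eq_mul]
      rw [ENNReal.toReal_ofReal (densRatio_pos g₀ (g t) y).le, mul_comm]
    refine setIntegral_mono_on hs2 (hUw.const_mul c) hK.measurableSet fun y hy ↦ ?_
    have h1 := deriv_densRatio_le g₀ hg hV ht (hKB hy)
    calc η y ^ 2 * regPow δ a (f t y) ^ 2 * w' y
        ≤ η y ^ 2 * regPow δ a (f t y) ^ 2 * (c * u t y * densRatio g₀ (g t) y) :=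
          mul_le_mul_of_nonneg_left h1 (by positivity)
      _ = _ := by rw [hφ2]; ring
  set X := ∫ y, φ y ^ 2 ∂vol (g t)
  set S := (∫ y, (φ y ^ 2) ^ ((n : ℝ) / (n - 2)) ∂vol (g t)) ^ (((n : ℝ) - 2) / n)
  have hX0 : 0 ≤ X := integral_nonneg fun y ↦ sq_nonneg _
  have hS0 : 0 ≤ S := Real.rpow_nonneg (integral_nonneg fun y ↦
    Real.rpow_nonneg (sq_nonneg _) _) _
  have hφ2c : HasCompactSupport fun y ↦ φ y ^ 2 := HasCompactSupport.intro hφc fun y hy ↦ by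
    simp [image_eq_zero_of_notMem_tsupport hy]
  have hφnc : HasCompactSupport fun y ↦ (φ y ^ 2) ^ ((n : ℝ) / (n - 2)) :=
    HasCompactSupport.intro hφc fun y hy ↦ by
      rw [image_eq_zero_of_notMem_tsupport hy, zero_pow two_ne_zero,
        Real.zero_rpow (by positivity)]
  have hφ2i : Integrable (fun y ↦ φ y ^ 2) (vol (g t)) :=
    (hφ.continuous.pow 2).integrable_of_hasCompactSupport hφ2c
  have hφni : Integrable (fun y ↦ (φ y ^ 2) ^ ((n : ℝ) / (n - 2))) (vol (g t)) :=
    ((hφ.continuous.pow 2).rpow_const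
      fun _ ↦ Or.inr (by positivity)).integrable_of_hasCompactSupport hφnc
  -- `φ` is known to be `C¹` only, so the extended form of the Sobolev inequality is needed.
  have hsob : S ≤ A * ∫ y, gradPair (g t) φ φ y ∂vol (g t) := by
    refine le_trans (le_of_eq ?_)
      (hS.le_of_contMDiff_one hn hA.le hB hφ hφc (hφs.trans hηB))
    simp only [S]
    congr 2 with y
    rw [← sq_abs, ← Real.rpow_natCast, ← Real.rpow_mul (abs_nonneg _)]
    congr 1
    push_cast
    ring
  have hm0 : 0 ≤ μ * t ^ (-((q - n) / q)) := mul_nonneg hμ (Real.rpow_nonneg ht.1.le _)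
  have hpot : ∫ y, u t y * φ y ^ 2 ∂vol (g t) ≤
      μ * t ^ (-((q - n) / q)) * X ^ (1 - n / q) * S ^ (n / q) := by
    have hBr {G : M → ℝ} (hG : ∀ y ∉ tsupport η, G y = 0) :
        ∫ y in B, G y ∂vol (g t) = ∫ y, G y ∂vol (g t) :=
      setIntegral_eq_integral_of_forall_compl_eq_zero fun y hy ↦ hG y fun h ↦ hy (hηB h)
    have hφ0 {y : M} (hy : y ∉ tsupport η) : φ y = 0 :=
      image_eq_zero_of_notMem_tsupport fun h ↦ hy (hφs h)
    have h1 := integral_mul_le_interpolation (F := fun y ↦ φ y ^ 2) hum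
      ((ae_restrict_iff' hB.measurableSet).2 (Eventually.of_forall hu0)) (fun y ↦ sq_nonneg _)
      (by linarith : (2 : ℝ) < n) hq hm0 hφ2i.integrableOn hφni.integrableOn huq
    rw [hBr fun y hy ↦ by simp [hφ0 hy], hBr fun y hy ↦ by simp [hφ0 hy],
      hBr fun y hy ↦ by rw [hφ0 hy, zero_pow two_ne_zero, Real.zero_rpow (by positivity)]] at h1
    refine h1.trans_eq ?_
    simp only [S]
    rw [← Real.rpow_mul (integral_nonneg fun y ↦ Real.rpow_nonneg (sq_nonneg _) _),
      div_mul_div_cancel₀ hn0.ne']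
  -- The gradient term supplies `θ / (4A)` times the Sobolev norm; half of it is spent here on the
  -- potential term. The factor `(2 + c) a` bounds `2a + c` because `a ≥ 1`.
  have hyoung := mul_rpow_mul_rpow_le (K := (2 + c) * a * (μ * t ^ (-((q - n) / q))))
    (ε := θ / (8 * A)) (e := n / q) (by positivity) hX0 hS0 (by positivity) (by positivity)
    ((div_lt_one hq0).2 hq)
  have he1 : 1 / (1 - n / q) = q / (q - n) := by field_simp
  have he2 : n / q / (1 - n / q) = n / (q - n) := by field_simp
  rw [he1, he2] at hyoung
  have hgradv : ∫ y, regPow δ a (f t y) ^ 2 * gradPair (g t) η η y ∂vol (g t) =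
      ∫ y in K, gradPair (g t) η η y * regPow δ a (f t y) ^ 2 * densRatio g₀ (g t) y ∂vol g₀ := by
    rw [setIntegral_densRatio g₀ (g t) fun y hy ↦ by
      rw [gradPair_eq_zero_of_notMem_tsupport (g t) η fun h ↦ hy (hηK h), zero_mul]]
    simp only [mul_comm]
  have hXe : ∫ y in K, η y ^ 2 * regPow δ a (f t y) ^ 2 * densRatio g₀ (g t) y ∂vol g₀ = X := by
    rw [setIntegral_densRatio g₀ (g t) fun y hy ↦ by simp [hout hy]]
    simp only [hφ2, X]
  have hSe : ∫ y in K, (η y ^ 2 * regPow δ a (f t y) ^ 2) ^ ((n : ℝ) / (n - 2)) *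
      densRatio g₀ (g t) y ∂vol g₀ = ∫ y, (φ y ^ 2) ^ ((n : ℝ) / (n - 2)) ∂vol (g t) := by
    rw [setIntegral_densRatio g₀ (g t) fun y hy ↦ by
      rw [hout hy, zero_pow two_ne_zero, zero_mul, Real.zero_rpow (by positivity)]]
    simp only [hφ2]
  rw [hXe, hSe, ← hgradv]
  have hsum : ∫ y in K, (η y ^ 2 * (regTest δ a (f t y) * F y) * densRatio g₀ (g t) y +
      η y ^ 2 * regPow δ a (f t y) ^ 2 * w' y) ∂vol g₀ ≤
      -(θ / 4) * ∫ y, gradPair (g t) φ φ y ∂vol (g t) +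
      (2 + 8 / θ) * ∫ y, regPow δ a (f t y) ^ 2 * gradPair (g t) η η y ∂vol (g t) +
      (2 * a + c) * ∫ y, u t y * φ y ^ 2 ∂vol (g t) := by
    rw [integral_add hs1 hs2, hfirst, add_mul]
    linarith
  refine hsum.trans ?_
  have h1 : (2 * a + c) * ∫ y, u t y * φ y ^ 2 ∂vol (g t) ≤
      (2 + c) * a * (μ * t ^ (-((q - n) / q))) * X ^ (1 - n / q) * S ^ (n / q) := by
    have h2 : 2 * a + c ≤ (2 + c) * a := by nlinarith
    have h3 : 0 ≤ ∫ y, u t y * φ y ^ 2 ∂vol (g t) := integral_nonneg fun y ↦ by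
      by_cases hy : y ∈ B
      · exact mul_nonneg (hu0 y hy) (sq_nonneg _)
      · simp only [φ]
        rw [show η y = 0 from image_eq_zero_of_notMem_tsupport fun h ↦ hy (hηB h)]
        simp
    calc _ ≤ (2 + c) * a * ∫ y, u t y * φ y ^ 2 ∂vol (g t) :=
          mul_le_mul_of_nonneg_right h2 h3
      _ ≤ (2 + c) * a * (μ * t ^ (-((q - n) / q)) * X ^ (1 - n / q) * S ^ (n / q)) :=
          mul_le_mul_of_nonneg_left hpot (by positivity)
      _ = _ := by ring
  have h2 : -(θ / 4) * ∫ y, gradPair (g t) φ φ y ∂vol (g t) ≤ -(2 * (θ / (8 * A))) * S := by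
    have h3 := mul_le_mul_of_nonneg_left hsob (by positivity : 0 ≤ 2 * (θ / (8 * A)))
    have h4 : 2 * (θ / (8 * A)) * (A * ∫ y, gradPair (g t) φ φ y ∂vol (g t)) =
        θ / 4 * ∫ y, gradPair (g t) φ φ y ∂vol (g t) := by
      field_simp
      ring
    linarith
  linarith

end Energy

/-! ### The mean value inequality and the limit `δ → 0`. -/

section MeanValue

/-- With `regCube_rpow_le` this places the regularized identity between the positive part of `s - δ`
and `s + δ` for `s ≥ 0`, which is what the limit `δ → 0` uses. -/
lemma max_sub_le_regCube_rpow {δ : ℝ} (hδ : 0 < δ) (s : ℝ) :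
    max (s - δ) 0 ≤ regCube δ s ^ (1 / 3 : ℝ) := by
  have h0 : 0 ≤ max (s - δ) 0 := le_max_right _ _
  calc max (s - δ) 0 = (max (s - δ) 0 ^ 3) ^ (1 / 3 : ℝ) := by
        rw [← Real.rpow_natCast, ← Real.rpow_mul h0]
        norm_num
    _ ≤ _ := Real.rpow_le_rpow (by positivity)
      (by simp only [regCube]; linarith [pow_pos hδ 3]) (by norm_num)

lemma regCube_rpow_le {δ s : ℝ} (hδ : 0 < δ) (hs : 0 ≤ s) : regCube δ s ^ (1 / 3 : ℝ) ≤ s + δ := by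
  have h0 : 0 ≤ s + δ := by positivity
  have h1 : regCube δ s ≤ (s + δ) ^ 3 := by
    simp only [regCube]
    rcases le_total (s - δ) 0 with h | h
    · rw [max_eq_right h]
      have : δ ^ 3 ≤ (s + δ) ^ 3 := pow_le_pow_left₀ hδ.le (by linarith) 3
      simpa using this
    · rw [max_eq_left h]
      have h2 : δ ^ 3 + (s - δ) ^ 3 ≤ (δ + (s - δ)) ^ 3 := by
        nlinarith [mul_nonneg (mul_nonneg hδ.le h) (by linarith : 0 ≤ s)]
      exact h2.trans (pow_le_pow_left₀ (by linarith) (by linarith) 3)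
  calc regCube δ s ^ (1 / 3 : ℝ) ≤ ((s + δ) ^ 3) ^ (1 / 3 : ℝ) :=
        Real.rpow_le_rpow (regCube_pos hδ s).le h1 (by norm_num)
    _ = s + δ := by
        rw [← Real.rpow_natCast, ← Real.rpow_mul h0]
        norm_num

variable {n : ℕ} {M : Type*} [TopologicalSpace M] [ChartedSpace (EuclideanSpace ℝ (Fin n)) M]
  [IsManifold (𝓡 n) ∞ M]

/-- Since `u ≥ 0`, the condition weakens as `c` grows; a negative `c` may thus be replaced by zero.
-/
lemma VolumeGrowth.mono {g : ℝ → SmoothMetric n M} {B : Set M} {T c c' : ℝ} {u : ℝ → M → ℝ}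
    (h : VolumeGrowth g B T c u) (hu : ∀ t ∈ Icc 0 T, ∀ y ∈ B, 0 ≤ u t y) (hc : c ≤ c') :
    VolumeGrowth g B T c' u := by
  intro t ht y hy
  refine (h t ht y hy).trans (mul_le_mul_of_nonneg_right
    (mul_le_mul_of_nonneg_right hc (hu t (Ioo_subset_Icc_self ht) y hy)) ?_)
  exact Real.sqrt_nonneg _

/-- Completeness is assumed for `g`, not for `g₀`. From `g ≤ 2 g₀`, a `g₀`-ball lies in the `g`-ball
of radius larger by `√2`, which is compact by the Hopf–Rinow argument. -/
lemma isCompact_rdist_le_of_twoEquivalent [T2Space M] {g₀ g : SmoothMetric n M}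
    (hg : IsCompleteMetric g) (hgg : TwoEquivalent g₀ g) (x : M) {R : ℝ} (hR : 0 ≤ R) :
    IsCompact {y | rdist g₀ x y ≤ ENNReal.ofReal R} := by
  have : LocallyCompactSpace M := ChartedSpace.locallyCompactSpace (Coord n) M
  refine (isCompact_rdist_le g hg x (R := √2 * R) (by positivity)).of_isClosed_subset
    (isClosed_le (continuous_rdist g₀ x) continuous_const) fun y hy ↦ ?_
  have h1 := rdist_le_of_inner_le (g := g) (g' := g₀) (L := √2) (by positivity)
    (fun y v ↦ by rw [Real.sq_sqrt zero_le_two]; exact (hgg y v).2) x y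
  calc rdist g x y ≤ ENNReal.ofReal √2 * rdist g₀ x y := h1
    _ ≤ ENNReal.ofReal √2 * ENNReal.ofReal R := mul_le_mul_right hy _
    _ = _ := (ENNReal.ofReal_mul (by positivity)).symm

lemma gradPair_comp (g : SmoothMetric n M) {χ : ℝ → ℝ} {χ' : ℝ} {κ : M → ℝ} {y : M}
    (hκ : MDifferentiableAt (𝓡 n) 𝓘(ℝ, ℝ) κ y) (hχ : HasDerivAt χ χ' (κ y)) :
    gradPair g (fun y ↦ χ (κ y)) (fun y ↦ χ (κ y)) y = χ' ^ 2 * gradPair g κ κ y := by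
  simp only [gradPair, dM_comp hκ hχ, smul_apply, smul_eq_mul, Finset.mul_sum]
  refine Finset.sum_congr rfl fun i _ ↦ Finset.sum_congr rfl fun j _ ↦ ?_
  ring

variable [T2Space M] [SecondCountableTopology M] [MeasurableSpace M] [BorelSpace M]

/-- The norm of a Bochner integral never exceeds the lower integral of the norm, so no measurability
or integrability of `f` is required, and the right-hand side may be infinite. -/
lemma ofReal_integral_densRatio_le (g₀ : SmoothMetric n M) (g : ℝ → SmoothMetric n M) {K B : Set M}
    (hK : MeasurableSet K) (hKB : K ⊆ B) {t T p : ℝ} (ht : t ∈ Ioc 0 T) (hp : 0 ≤ p)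
    {f : ℝ → M → ℝ} (hf : ∀ s ∈ Icc 0 T, ∀ y ∈ B, 0 ≤ f s y) :
    ENNReal.ofReal (∫ s in (0 : ℝ)..t, ∫ y in K, f s y ^ p * densRatio g₀ (g s) y ∂vol g₀) ≤
      ∫⁻ s in Icc 0 T, ∫⁻ y in B, ENNReal.ofReal (f s y) ^ p ∂vol (g s) := by
  have hsub : Ioc 0 t ⊆ Icc 0 T := fun s hs ↦ ⟨hs.1.le, hs.2.trans ht.2⟩
  rw [intervalIntegral.integral_of_le ht.1.le]
  refine (Real.ofReal_le_enorm _).trans ((enorm_integral_le_lintegral_enorm _).trans ?_)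
  refine le_trans ?_ (lintegral_mono_set hsub)
  refine setLIntegral_mono' measurableSet_Ioc fun s hs ↦ ?_
  refine (enorm_integral_le_lintegral_enorm _).trans ?_
  refine le_trans ?_ (lintegral_mono_set hKB)
  rw [vol_eq_withDensity g₀ (g s), restrict_withDensity hK,
    lintegral_withDensity_eq_lintegral_mul_non_measurable _
      (continuous_densRatio g₀ (g s)).measurable.ennreal_ofReal
      (Eventually.of_forall fun _ ↦ ENNReal.ofReal_lt_top)]
  refine setLIntegral_mono' hK fun y hy ↦ ?_
  have h0 := hf s (hsub hs) y (hKB hy)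
  rw [Pi.mul_apply, Real.enorm_of_nonneg (mul_nonneg (Real.rpow_nonneg h0 _)
    (densRatio_pos g₀ (g s) y).le), ENNReal.ofReal_mul (Real.rpow_nonneg h0 _),
    ENNReal.ofReal_rpow_of_nonneg h0 hp, mul_comm]

set_option maxHeartbeats 1000000 in
/-- The mean value inequality for the regularized powers of a subsolution, on the support of a
cutoff function. -/
theorem regCube_rpow_le_integral (hn : 3 ≤ n) (g₀ : SmoothMetric n M) {g : ℝ → SmoothMetric n M}
    {B : Set M} (hB : IsOpen B) {T A μ q c p : ℝ} {u f : ℝ → M → ℝ} (hq : (n : ℝ) < q) (hp : 1 < p)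
    (hA : 0 < A) (hμ : 0 ≤ μ) (hc : 0 ≤ c) (hg : SmoothFamily g T)
    (hgg : ∀ t ∈ Icc 0 T, TwoEquivalent g₀ (g t)) (hS : ∀ t ∈ Icc 0 T, SobolevOn (g t) B A)
    (hu0 : ∀ t ∈ Icc 0 T, ∀ y ∈ B, 0 ≤ u t y)
    (hum : ∀ t ∈ Ioc 0 T, AEMeasurable (u t) ((vol (g t)).restrict B)) (hV : VolumeGrowth g B T c u)
    (huq : ∀ t ∈ Ioc 0 T, (∫⁻ y in B, ENNReal.ofReal (u t y) ^ (q / 2) ∂vol (g t)) ^ (2 / q) ≤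
      ENNReal.ofReal (μ * t ^ (-((q - n) / q))))
    (hf : IsSubsolution g B T u f) {κ : M → ℝ} (hκ : ContMDiff (𝓡 n) 𝓘(ℝ, ℝ) ∞ κ)
    (hκc : HasCompactSupport κ) (hκB : tsupport κ ⊆ B) {x : M} (hκx : κ x = 1) {e : ℝ} (he : 0 ≤ e)
    (hκe : ∀ y, gradPair g₀ κ κ y ≤ e) {L : ℝ} (hL : ∀ s, |deriv Real.smoothTransition s| ≤ L)
    {δ : ℝ} (hδ : 0 < δ) {t : ℝ} (ht : t ∈ Ioc 0 T) {θ : ℝ} (hθ : θ = 4 * (p - 1) / p) :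
    (regCube δ (f t x) ^ (1 / 3 : ℝ)) ^ p ≤
      moserConst n p (q / (q - n)) L * (θ / (8 * A)) ^ (-((n : ℝ) / 2)) *
        ((2 + 8 / θ) * (2 * e) +
          (1 + (2 + c) ^ (q / (q - n)) * μ ^ (q / (q - n)) * (θ / (8 * A)) ^ (-(n / (q - n)))) / t) ^
          (((n : ℝ) + 2) / 2) *
        ∫ s in (0 : ℝ)..t, ∫ y in tsupport κ, (regCube δ (f s y) ^ (1 / 3 : ℝ)) ^ p *
          densRatio g₀ (g s) y ∂vol g₀ := by
  have hn3 : (3 : ℝ) ≤ n := by exact_mod_cast hn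
  have hq0 : 0 < q := by linarith
  have hqn : 0 < q - n := by linarith
  have hp0 : 0 < p := by linarith
  have hT : 0 ≤ T := ht.1.le.trans ht.2
  have hθ0 : 0 < θ := by rw [hθ]; exact div_pos (by linarith) hp0
  set K := tsupport κ
  have hK : IsCompact K := hκc
  have : CompactSpace K := isCompact_iff_compactSpace.1 hK
  have hKm : MeasurableSet K := hK.measurableSet
  -- The iteration runs on the compact space `K`, where continuity gives all integrability.
  set ν : Measure K := (vol g₀).comap Subtype.val
  have hνfin : IsFiniteMeasure ν := ⟨by
    rw [comap_subtype_coe_apply hKm, image_univ, Subtype.range_coe]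
    exact hK.measure_lt_top⟩
  have hxU : x ∈ Function.support κ := by simp [hκx]
  set x' : K := ⟨x, subset_tsupport κ hxU⟩
  have hνpos : ∀ U ∈ 𝓝 x', 0 < ν U := by
    intro U hU
    obtain ⟨V, hVU, hVo, hxV⟩ := mem_nhds_iff.1 hU
    obtain ⟨W, hWo, rfl⟩ := isOpen_induced_iff.1 hVo
    -- `K` is only closed, but the set `κ ≠ 0` is open in `M` and contains `x`, so a neighbourhood
    -- of `x` in `K` contains a nonempty open set of `M`.
    have hO : IsOpen (W ∩ Function.support κ) := hWo.inter hκ.continuous.isOpen_support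
    refine lt_of_lt_of_le (hO.measure_pos (vol g₀) ⟨x, hxV, hxU⟩) (le_trans ?_ (measure_mono hVU))
    rw [comap_subtype_coe_apply hKm]
    exact measure_mono fun y hy ↦ ⟨⟨y, subset_tsupport κ hy.2⟩, hy.1, rfl⟩
  -- Time is clamped to `[0, T]`, so that the functions are continuous for all real times, as
  -- `moser_iteration` asks; on the times that matter the clamp is the identity.
  set cl : ℝ → ℝ := fun s ↦ projIcc 0 T hT s
  have hcl : Continuous cl := continuous_subtype_val.comp continuous_projIcc
  have hclm (s : ℝ) : cl s ∈ Icc 0 T := (projIcc 0 T hT s).2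
  have hcle {s : ℝ} (hs : s ∈ Icc 0 T) : cl s = s := by simp only [cl, projIcc_of_mem hT hs]
  have hpair : Continuous fun z : ℝ × K ↦ ((z.2 : M), cl z.1) :=
    (continuous_subtype_val.comp continuous_snd).prodMk (hcl.comp continuous_fst)
  have hfc : Continuous fun z : ℝ × K ↦ f (cl z.1) z.2 :=
    hf.continuousOn.comp_continuous hpair fun z ↦ ⟨hκB z.2.2, hclm _⟩
  have hw : Continuous fun z : ℝ × K ↦ densRatio g₀ (g (cl z.1)) z.2 :=
    (continuousOn_densRatio g₀ hg).comp_continuous hpair fun z ↦ ⟨mem_univ _, hclm _⟩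
  have hh : Continuous fun z : ℝ × K ↦ regCube δ (f (cl z.1) z.2) ^ (1 / 3 : ℝ) :=
    (continuous_regCube_rpow hδ _).comp hfc
  have hsq (a s : ℝ) : (regCube δ s ^ (1 / 3 : ℝ)) ^ a = regPow δ a s ^ 2 := by
    rw [regPow_sq hδ, ← Real.rpow_mul (regCube_pos hδ s).le]
    congr 1
    ring
  have hmain := moser_iteration (ν := ν) (y₀ := x') hνpos (κ := fun y ↦ κ y)
    (hκ.continuous.comp continuous_subtype_val) hκx (d := n) (p := p) (γ := q / (q - n))
    (by linarith) hp.le (by positivity) hL (D := θ / (8 * A)) (E₁ := (2 + 8 / θ) * (2 * e))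
    (E₂ := (2 + c) ^ (q / (q - n)) * μ ^ (q / (q - n)) * (θ / (8 * A)) ^ (-(n / (q - n))))
    (by positivity) (by positivity) (by positivity) ht.1
    (h := fun s y ↦ regCube δ (f (cl s) y) ^ (1 / 3 : ℝ))
    (w := fun s y ↦ densRatio g₀ (g (cl s)) y) hh hw
    (fun _ _ ↦ Real.rpow_pos_of_pos (regCube_pos hδ _) _) (fun _ _ ↦ densRatio_pos _ _ _) ?_
  · simp only [hcle (Ioc_subset_Icc_self ht)] at hmain
    refine hmain.trans_eq ?_
    congr 1
    refine intervalIntegral.integral_congr fun s hs ↦ ?_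
    rw [uIcc_of_le ht.1.le] at hs
    simp only [hcle ⟨hs.1, hs.2.trans ht.2⟩]
    exact integral_subtype_comap hKm
      fun y ↦ (regCube δ (f s y) ^ (1 / 3 : ℝ)) ^ p * densRatio g₀ (g s) y
  · intro a ha χ hχ hχ0 s hs
    have ha0 : 0 < a := hp0.trans_le ha
    have hsT : s ∈ Ioo 0 T := ⟨hs.1, hs.2.trans_le ht.2⟩
    have hsI : s ∈ Icc 0 T := Ioo_subset_Icc_self hsT
    have hχs : ContMDiff (𝓡 n) 𝓘(ℝ, ℝ) ∞ fun y ↦ χ (κ y) := hχ.contMDiff.comp hκ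
    have hχ1 : ContMDiff (𝓡 n) 𝓘(ℝ, ℝ) 1 fun y ↦ χ (κ y) := hχs.of_le (by simp)
    -- The cutoffs vanish at levels below `1/4`, in particular at `0`, hence wherever `κ` does.
    have hχK : tsupport (fun y ↦ χ (κ y)) ⊆ K :=
      closure_mono fun y hy hy' ↦ hy (by simp only [hy', hχ0 0 (by norm_num)])
    -- `4 (a-1)/a` increases with `a`, so its value at `a = p`, positive because `p > 1`, serves for
    -- all exponents of the iteration.
    have hθa : θ ≤ 4 * (a - 1) / a := by
      rw [hθ, div_le_div_iff₀ hp0 ha0]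
      nlinarith
    have hθ4 : θ ≤ 4 := by
      rw [hθ, div_le_iff₀ hp0]
      linarith
    obtain ⟨I', hI, hle⟩ := energy_inequality hn g₀ hB hq hA hμ hc hg hsT (hS s hsI) (hu0 s hsI)
      (hum s ⟨hs.1, hsT.2.le⟩) hV (huq s ⟨hs.1, hsT.2.le⟩) hf hχs hK hκB hχK hδ (hp.le.trans ha)
      hθ0 hθ4 hθa
    have hsub (G : M → ℝ) : ∫ y : K, G y ∂ν = ∫ y in K, G y ∂vol g₀ := integral_subtype_comap hKm G
    refine ⟨I', hI.congr_of_eventuallyEq ?_, hle.trans ?_⟩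
    · filter_upwards [Ioo_mem_nhds hsT.1 hsT.2] with s hs
      simp only [hcle (Ioo_subset_Icc_self hs), hsq]
      exact hsub fun y ↦ χ (κ y) ^ 2 * regPow δ a (f s y) ^ 2 * densRatio g₀ (g s) y
    · simp only [hcle hsI, hsq]
      rw [hsub fun y ↦ (χ (κ y) ^ 2 * regPow δ a (f s y) ^ 2) ^ ((n : ℝ) / (n - 2)) *
          densRatio g₀ (g s) y,
        hsub fun y ↦ deriv χ (κ y) ^ 2 * regPow δ a (f s y) ^ 2 * densRatio g₀ (g s) y,
        hsub fun y ↦ χ (κ y) ^ 2 * regPow δ a (f s y) ^ 2 * densRatio g₀ (g s) y]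
      have hvK : ContinuousOn (fun y ↦ regPow δ a (f s y) ^ 2) K :=
        ((contDiff_regPow hδ a).continuous.comp_continuousOn
          ((hf.continuousOn_slice hsI).mono hκB)).pow 2
      have hwK := (continuous_densRatio g₀ (g s)).continuousOn (s := K)
      have hgrad : ∫ y in K, gradPair (g s) (fun y ↦ χ (κ y)) (fun y ↦ χ (κ y)) y *
          regPow δ a (f s y) ^ 2 * densRatio g₀ (g s) y ∂vol g₀ ≤
          2 * e * ∫ y in K, deriv χ (κ y) ^ 2 * regPow δ a (f s y) ^ 2 *
            densRatio g₀ (g s) y ∂vol g₀ := by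
        rw [← integral_const_mul]
        have hdχ : Continuous fun y ↦ deriv χ (κ y) ^ 2 :=
          ((hχ.continuous_deriv (by simp)).comp hκ.continuous).pow 2
        refine setIntegral_mono_on ?_ ?_ hKm fun y _ ↦ ?_
        · exact ((((continuousOn_gradPair (g s) isOpen_univ (fun y _ ↦ hχ1 y)
            fun y _ ↦ hχ1 y).mono (subset_univ K)).mul hvK).mul
            hwK).integrableOn_compact hK
        · exact (((hdχ.continuousOn.mul hvK).mul hwK).integrableOn_compact hK).const_mul _
        · have h1 : gradPair (g s) (fun y ↦ χ (κ y)) (fun y ↦ χ (κ y)) y ≤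
              2 * e * deriv χ (κ y) ^ 2 := by
            rw [gradPair_comp (g s) (mdifferentiableAt_of_contMDiffAt (by simp) (hκ y))
              (hχ.differentiable (by simp) _).hasDerivAt]
            have h2 := gradPair_self_le_of_twoEquivalent (hgg s hsI) κ y
            have h3 : gradPair (g s) κ κ y ≤ 2 * e := by linarith [hκe y]
            rw [mul_comm]
            exact mul_le_mul_of_nonneg_right h3 (sq_nonneg _)
          calc _ ≤ 2 * e * deriv χ (κ y) ^ 2 * regPow δ a (f s y) ^ 2 * densRatio g₀ (g s) y :=
                mul_le_mul_of_nonneg_right (mul_le_mul_of_nonneg_right h1 (sq_nonneg _))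
                  (densRatio_pos _ _ _).le
            _ = _ := by ring
      -- The exponents of the time factor are reciprocal up to sign, so Young's inequality leaves
      -- exactly `1 / s`, and `a` enters with power `γ = q / (q - n)`.
      have hcoef : ((2 + c) * a * (μ * s ^ (-((q - n) / q)))) ^ (q / (q - n)) *
          (θ / (8 * A)) ^ (-(n / (q - n))) = (2 + c) ^ (q / (q - n)) * μ ^ (q / (q - n)) *
            (θ / (8 * A)) ^ (-(n / (q - n))) * a ^ (q / (q - n)) / s := by
        have hs0 := hs.1
        have h1 : (s ^ (-((q - n) / q))) ^ (q / (q - n)) = s⁻¹ := by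
          rw [← Real.rpow_mul hs0.le, ← Real.rpow_neg_one]
          congr 1
          field_simp
        rw [Real.mul_rpow (by positivity) (by positivity), Real.mul_rpow (by positivity) ha0.le,
          Real.mul_rpow hμ (by positivity), h1]
        ring
      rw [hcoef]
      have h4 := mul_le_mul_of_nonneg_left hgrad (by positivity : 0 ≤ 2 + 8 / θ)
      linarith

set_option maxHeartbeats 1000000 in
/-- The mean value inequality for a subsolution, on the support of a cutoff function. -/
theorem rpow_le_integral (hn : 3 ≤ n) (g₀ : SmoothMetric n M) {g : ℝ → SmoothMetric n M}
    {B : Set M} (hB : IsOpen B) {T A μ q c p : ℝ} {u f : ℝ → M → ℝ} (hq : (n : ℝ) < q) (hp : 1 < p)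
    (hA : 0 < A) (hμ : 0 ≤ μ) (hc : 0 ≤ c) (hg : SmoothFamily g T)
    (hgg : ∀ t ∈ Icc 0 T, TwoEquivalent g₀ (g t)) (hS : ∀ t ∈ Icc 0 T, SobolevOn (g t) B A)
    (hu0 : ∀ t ∈ Icc 0 T, ∀ y ∈ B, 0 ≤ u t y)
    (hum : ∀ t ∈ Ioc 0 T, AEMeasurable (u t) ((vol (g t)).restrict B)) (hV : VolumeGrowth g B T c u)
    (huq : ∀ t ∈ Ioc 0 T, (∫⁻ y in B, ENNReal.ofReal (u t y) ^ (q / 2) ∂vol (g t)) ^ (2 / q) ≤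
      ENNReal.ofReal (μ * t ^ (-((q - n) / q))))
    (hf : IsSubsolution g B T u f) {κ : M → ℝ} (hκ : ContMDiff (𝓡 n) 𝓘(ℝ, ℝ) ∞ κ)
    (hκc : HasCompactSupport κ) (hκB : tsupport κ ⊆ B) {x : M} (hκx : κ x = 1) {e : ℝ} (he : 0 ≤ e)
    (hκe : ∀ y, gradPair g₀ κ κ y ≤ e) {L : ℝ} (hL : ∀ s, |deriv Real.smoothTransition s| ≤ L)
    {t : ℝ} (ht : t ∈ Ioc 0 T) {θ : ℝ} (hθ : θ = 4 * (p - 1) / p) :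
    f t x ^ p ≤
      moserConst n p (q / (q - n)) L * (θ / (8 * A)) ^ (-((n : ℝ) / 2)) *
        ((2 + 8 / θ) * (2 * e) +
          (1 + (2 + c) ^ (q / (q - n)) * μ ^ (q / (q - n)) * (θ / (8 * A)) ^ (-(n / (q - n)))) / t) ^
          (((n : ℝ) + 2) / 2) *
        ∫ s in (0 : ℝ)..t, ∫ y in tsupport κ, f s y ^ p * densRatio g₀ (g s) y ∂vol g₀ := by
  have hqn : 0 < q - n := by linarith
  have hq0 : 0 < q := by linarith [n.cast_nonneg (α := ℝ)]
  have hp0 : 0 < p := by linarith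
  have hT : 0 ≤ T := ht.1.le.trans ht.2
  have hθ0 : 0 < θ := by rw [hθ]; exact div_pos (by linarith) hp0
  have htI : t ∈ Icc 0 T := Ioc_subset_Icc_self ht
  have hxB : x ∈ B := hκB (subset_tsupport κ (by simp [hκx]))
  set K := tsupport κ
  have hK : IsCompact K := hκc
  have : CompactSpace K := isCompact_iff_compactSpace.1 hK
  have hKm : MeasurableSet K := hK.measurableSet
  have hKfin : IsFiniteMeasure ((vol g₀).comap (Subtype.val : K → M)) := ⟨by
    rw [comap_subtype_coe_apply hKm, image_univ, Subtype.range_coe]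
    exact hK.measure_lt_top⟩
  set G := moserConst n p (q / (q - n)) L * (θ / (8 * A)) ^ (-((n : ℝ) / 2)) *
        ((2 + 8 / θ) * (2 * e) +
          (1 + (2 + c) ^ (q / (q - n)) * μ ^ (q / (q - n)) * (θ / (8 * A)) ^ (-(n / (q - n)))) / t) ^
          (((n : ℝ) + 2) / 2)
  have hG : 0 ≤ G := by
    have := ht.1
    simp only [G, moserConst]
    positivity
  set cl : ℝ → ℝ := fun s ↦ projIcc 0 T hT s
  have hcl : Continuous cl := continuous_subtype_val.comp continuous_projIcc
  have hclm (s : ℝ) : cl s ∈ Icc 0 T := (projIcc 0 T hT s).2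
  have hcle {s : ℝ} (hs : s ∈ Icc 0 T) : cl s = s := by simp only [cl, projIcc_of_mem hT hs]
  have hpair : Continuous fun z : (ℝ × ℝ) × K ↦ ((z.2 : M), cl z.1.2) :=
    (continuous_subtype_val.comp continuous_snd).prodMk
      (hcl.comp (continuous_snd.comp continuous_fst))
  have hfc : Continuous fun z : (ℝ × ℝ) × K ↦ f (cl z.1.2) z.2 :=
    hf.continuousOn.comp_continuous hpair fun z ↦ ⟨hκB z.2.2, hclm _⟩
  have hw : Continuous fun z : (ℝ × ℝ) × K ↦ densRatio g₀ (g (cl z.1.2)) z.2 :=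
    (continuousOn_densRatio g₀ hg).comp_continuous hpair fun z ↦ ⟨mem_univ _, hclm _⟩
  -- The right-hand side with `regCube` replaced by its upper bound `f + δ`; unlike the former it is
  -- continuous down to `δ = 0`, by joint continuity over a compact set.
  set Φ : ℝ → ℝ := fun δ ↦ ∫ s in (0 : ℝ)..t, ∫ y : K, (f (cl s) y + δ) ^ p *
    densRatio g₀ (g (cl s)) y ∂(vol g₀).comap Subtype.val
  have hΦc : Continuous Φ := by
    refine intervalIntegral.continuous_parametric_intervalIntegral_of_continuous' ?_ 0 t
    have h1 : Continuous fun z : (ℝ × ℝ) × K ↦ (f (cl z.1.2) z.2 + z.1.1) ^ p *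
        densRatio g₀ (g (cl z.1.2)) z.2 :=
      ((hfc.add (continuous_fst.comp continuous_fst)).rpow_const fun _ ↦ Or.inr hp0.le).mul hw
    exact continuous_integral_of_compact (F := fun (z : ℝ × ℝ) (y : K) ↦
      (f (cl z.2) y + z.1) ^ p * densRatio g₀ (g (cl z.2)) y) _ h1
  have hΦ (δ : ℝ) : Φ δ = ∫ s in (0 : ℝ)..t, ∫ y in K, (f s y + δ) ^ p *
      densRatio g₀ (g s) y ∂vol g₀ := by
    refine intervalIntegral.integral_congr fun s hs ↦ ?_
    rw [uIcc_of_le ht.1.le] at hs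
    simp only [hcle ⟨hs.1, hs.2.trans ht.2⟩]
    exact integral_subtype_comap hKm fun y ↦ (f s y + δ) ^ p * densRatio g₀ (g s) y
  have hle : ∀ δ > 0, max (f t x - δ) 0 ^ p ≤ G * Φ δ := by
    intro δ hδ
    have h1 := regCube_rpow_le_integral hn g₀ hB hq hp hA hμ hc hg hgg hS hu0 hum hV huq hf hκ hκc
      hκB hκx he hκe hL hδ ht hθ
    refine ((Real.rpow_le_rpow (le_max_right _ _) (max_sub_le_regCube_rpow hδ _) hp0.le).trans
      h1).trans (mul_le_mul_of_nonneg_left ?_ hG)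
    rw [hΦ]
    have hcts {F : ℝ → ℝ} (hF : Continuous F) : ContinuousOn (fun s ↦ ∫ y in K, F (f s y) *
        densRatio g₀ (g s) y ∂vol g₀) (Icc 0 t) := by
      have h2 : Continuous fun s ↦ ∫ y : K, F (f (cl s) y) *
          densRatio g₀ (g (cl s)) y ∂(vol g₀).comap Subtype.val := by
        have h3 : Continuous fun z : ℝ × K ↦ (((0 : ℝ), z.1), z.2) := by fun_prop
        exact continuous_integral_of_compact (F := fun (s : ℝ) (y : K) ↦ F (f (cl s) y) *
          densRatio g₀ (g (cl s)) y) _ (((hF.comp hfc).mul hw).comp h3)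
      refine h2.continuousOn.congr fun s hs ↦ ?_
      simp only [hcle ⟨hs.1, hs.2.trans ht.2⟩]
      exact (integral_subtype_comap hKm fun y ↦ F (f s y) * densRatio g₀ (g s) y).symm
    have hF1 : Continuous fun s ↦ (regCube δ s ^ (1 / 3 : ℝ)) ^ p :=
      (continuous_regCube_rpow hδ _).rpow_const fun _ ↦ Or.inr hp0.le
    have hF2 : Continuous fun s : ℝ ↦ (s + δ) ^ p :=
      (continuous_id.add continuous_const).rpow_const fun _ ↦ Or.inr hp0.le
    refine intervalIntegral.integral_mono_on ht.1.le
      ((hcts hF1).intervalIntegrable_of_Icc ht.1.le)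
      ((hcts hF2).intervalIntegrable_of_Icc ht.1.le) fun s hs ↦ ?_
    have hsI : s ∈ Icc 0 T := ⟨hs.1, hs.2.trans ht.2⟩
    have hint {F : ℝ → ℝ} (hF : Continuous F) : IntegrableOn (fun y ↦ F (f s y) *
        densRatio g₀ (g s) y) K (vol g₀) :=
      ((hF.comp_continuousOn ((hf.continuousOn_slice hsI).mono hκB)).mul
        (continuous_densRatio g₀ (g s)).continuousOn).integrableOn_compact hK
    refine setIntegral_mono_on (hint hF1) (hint hF2) hKm fun y hy ↦ ?_
    refine mul_le_mul_of_nonneg_right ?_ (densRatio_pos _ _ _).le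
    exact Real.rpow_le_rpow (Real.rpow_nonneg (regCube_pos hδ _).le _)
      (regCube_rpow_le hδ (hf.nonneg s hsI y (hκB hy))) hp0.le
  have hlim1 : Tendsto (fun δ ↦ max (f t x - δ) 0 ^ p) (𝓝[>] 0) (𝓝 (f t x ^ p)) := by
    have h1 : Continuous fun δ ↦ max (f t x - δ) 0 ^ p :=
      ((continuous_const.sub continuous_id).max continuous_const).rpow_const
        fun _ ↦ Or.inr hp0.le
    have h2 := h1.tendsto 0
    rw [sub_zero, max_eq_left (hf.nonneg t htI x hxB)] at h2
    exact h2.mono_left nhdsWithin_le_nhds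
  have hlim2 : Tendsto (fun δ ↦ G * Φ δ) (𝓝[>] 0) (𝓝 (G * Φ 0)) :=
    ((hΦc.tendsto 0).const_mul G).mono_left nhdsWithin_le_nhds
  have h3 := le_of_tendsto_of_tendsto hlim1 hlim2 (eventually_nhdsWithin_of_forall hle)
  rw [hΦ] at h3
  simpa only [add_zero] using h3

/-- Splitting `(θ/(8A))^{-s}` as `(8/θ)^s A^s` isolates the powers of `A` in the theorem and leaves
constants depending only on `n`, `q`, `p`, `c`. The number `72` is `2 · 36`, from the cutoff bound
`36/r²` and the comparison of `g(t)` with `g₀`. -/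
lemma coefficient_le {d θ A e γ b K₁ Λ τ μ c : ℝ} (hd : 0 ≤ d) (hθ : 0 < θ) (hA : 0 < A) (he : 0 ≤ e)
    (hμ : 0 ≤ μ) (hc : 0 ≤ c) (hτ : 0 < τ) (hΛ : Λ = A ^ b * μ ^ γ)
    (hK : K₁ = (2 + 8 / θ) * 72 + 1 + (2 + c) ^ γ * (8 / θ) ^ b) :
    (θ / (8 * A)) ^ (-(d / 2)) * ((2 + 8 / θ) * (2 * (36 * e)) +
        (1 + (2 + c) ^ γ * μ ^ γ * (θ / (8 * A)) ^ (-b)) / τ) ^ ((d + 2) / 2) ≤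
      (8 / θ) ^ (d / 2) * K₁ ^ ((d + 2) / 2) * A ^ (d / 2) * ((1 + Λ) / τ + e) ^ ((d + 2) / 2) := by
  have hinv (s : ℝ) : (θ / (8 * A)) ^ (-s) = (8 / θ) ^ s * A ^ s := by
    rw [Real.rpow_neg (by positivity), ← Real.inv_rpow (by positivity),
      ← Real.mul_rpow (by positivity) hA.le]
    congr 1
    field_simp
  rw [hinv, hinv, mul_assoc _ (A ^ (d / 2)), mul_assoc ((8 / θ) ^ (d / 2)),
    mul_assoc ((8 / θ) ^ (d / 2)), mul_assoc]
  refine mul_le_mul_of_nonneg_left ?_ (by positivity)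
  have hΛ0 : 0 ≤ Λ := hΛ ▸ by positivity
  have hK0 : 0 ≤ K₁ := hK ▸ by positivity
  rw [mul_comm (K₁ ^ _) (A ^ _ : ℝ), mul_assoc, ← Real.mul_rpow hK0 (by positivity)]
  refine mul_le_mul_of_nonneg_left (Real.rpow_le_rpow (by positivity) ?_ (by positivity))
    (by positivity)
  set P := (2 + c) ^ γ * (8 / θ) ^ b
  have hP : 0 ≤ P := by positivity
  have h1 : (2 + c) ^ γ * (μ ^ γ * ((8 / θ) ^ b * A ^ b)) = P * Λ := by rw [hΛ]; ring
  have h2 : (2 + 8 / θ) * 72 ≤ K₁ := by rw [hK]; linarith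
  have h3 : P ≤ K₁ := by
    rw [hK]
    have : 0 ≤ (2 + 8 / θ) * 72 := by positivity
    linarith
  have h4 : 1 ≤ K₁ := by
    rw [hK]
    have : 0 ≤ (2 + 8 / θ) * 72 := by positivity
    linarith
  have h5 : (1 + P * Λ) / τ ≤ K₁ * ((1 + Λ) / τ) := by
    rw [← mul_div_assoc]
    refine div_le_div_of_nonneg_right ?_ hτ.le
    nlinarith [mul_le_mul_of_nonneg_right h3 hΛ0]
  rw [h1]
  nlinarith [mul_le_mul_of_nonneg_right h2 he]

end MeanValue

end MoserFlow

end

/-! ### The theorem: choice of the constant and passage to extended integrals. -/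

open MoserFlow

theorem theorem2p1 (n : ℕ) (hn : 3 ≤ n) (c q p : ℝ) (hq : (n : ℝ) < q) (hp : 1 < p) :
    ∃ C : ℝ, 0 < C ∧
      ∀ (M : Type*) [TopologicalSpace M] [T2Space M] [SecondCountableTopology M]
        [MeasurableSpace M] [BorelSpace M]
        [ChartedSpace (EuclideanSpace ℝ (Fin n)) M] [IsManifold (𝓡 n) ∞ M]
        (g₀ : SmoothMetric n M) (g : ℝ → SmoothMetric n M) (x : M) (r T A μ : ℝ)
        (u f : ℝ → M → ℝ),
        0 < r → 0 < T → 0 < A → 0 < μ →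
        SmoothFamily g T →
        (∀ t ∈ Icc 0 T, IsCompleteMetric (g t)) →
        (∀ t ∈ Icc 0 T, TwoEquivalent g₀ (g t)) →
        (∀ t ∈ Icc 0 T, SobolevOn (g t) (ball g₀ x r) A) →
        (∀ t ∈ Icc 0 T, ∀ y ∈ ball g₀ x r, 0 ≤ u t y) →
        (∀ t ∈ Ioc 0 T, AEMeasurable (u t) ((vol (g t)).restrict (ball g₀ x r))) →
        VolumeGrowth g (ball g₀ x r) T c u →
        (∀ t ∈ Ioc 0 T,
          (∫⁻ y in ball g₀ x r, ENNReal.ofReal (u t y) ^ (q / 2) ∂(vol (g t))) ^ (2 / q) ≤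
            ENNReal.ofReal (μ * t ^ (-((q - n) / q)))) →
        IsSubsolution g (ball g₀ x r) T u f →
        ∀ t ∈ Ioc 0 T,
          ENNReal.ofReal (f t x) ≤
            ENNReal.ofReal (C * A ^ ((n : ℝ) / (2 * p)) *
              ((1 + A ^ ((n : ℝ) / (q - n)) * μ ^ (q / (q - n))) / t + 1 / r ^ 2)
                ^ (((n : ℝ) + 2) / (2 * p))) *
            (∫⁻ s in Icc 0 T, ∫⁻ y in ball g₀ x r, ENNReal.ofReal (f s y) ^ p ∂(vol (g s)))
              ^ (1 / p) := by
  have hqn : 0 < q - n := by linarith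
  have hq0 : 0 < q := by linarith [n.cast_nonneg (α := ℝ)]
  have hp0 : 0 < p := by linarith
  obtain ⟨L, hL⟩ := exists_abs_deriv_smoothTransition_le
  set θ : ℝ := 4 * (p - 1) / p with hθ
  have hθ0 : 0 < θ := div_pos (by linarith) hp0
  -- The estimates require a nonnegative constant in the volume growth.
  set c' : ℝ := max c 0
  have hc' : 0 ≤ c' := le_max_right _ _
  set K₁ : ℝ := (2 + 8 / θ) * 72 + 1 + (2 + c') ^ (q / (q - n)) * (8 / θ) ^ (n / (q - n)) with hK₁
  have hK₁0 : 0 < K₁ := by positivity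
  have hmc : 0 < moserConst n p (q / (q - n)) L := by
    simp only [moserConst]
    positivity
  set C₀ : ℝ := moserConst n p (q / (q - n)) L *
    ((8 / θ) ^ ((n : ℝ) / 2) * K₁ ^ (((n : ℝ) + 2) / 2))
  have hC₀ : 0 < C₀ := by positivity
  refine ⟨C₀ ^ (1 / p), by positivity, ?_⟩
  intro M _ _ _ _ _ _ _ g₀ g x r T A μ u f hr hT hA hμ hg hcomp hgg hS hu0 hum hV huq hf t ht
  have : LocallyCompactSpace M := ChartedSpace.locallyCompactSpace (Coord n) M
  have h0T : (0 : ℝ) ∈ Icc 0 T := ⟨le_rfl, hT.le⟩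
  have ht0 : 0 < t := ht.1
  -- Completeness is used only here, and only at time `0`, to have a compact closed ball of half the
  -- radius.
  obtain ⟨κ, hκ, hκc, hκB, hκx, hκe⟩ := exists_cutoff g₀ x hr
    (isCompact_rdist_le_of_twoEquivalent (hcomp 0 h0T) (hgg 0 h0T) x (by positivity))
  have hκe' : ∀ y, gradPair g₀ κ κ y ≤ 36 * (1 / r ^ 2) := fun y ↦ by
    rw [mul_one_div]
    exact hκe y
  have hmain := rpow_le_integral hn g₀ (isOpen_ball g₀ x r) hq hp hA hμ.le hc' hg hgg hS hu0 hum
    (hV.mono hu0 (le_max_left _ _)) huq hf hκ hκc hκB hκx (by positivity) hκe' hL ht hθ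
  set I := ∫ s in (0 : ℝ)..t, ∫ y in tsupport κ, f s y ^ p * densRatio g₀ (g s) y ∂vol g₀
  set Z := (1 + A ^ ((n : ℝ) / (q - n)) * μ ^ (q / (q - n))) / t + 1 / r ^ 2
  have hZ : 0 ≤ Z := by positivity
  have hxB : x ∈ ball g₀ x r := hκB (subset_tsupport κ (by simp [hκx]))
  have hI : 0 ≤ I := intervalIntegral.integral_nonneg ht0.le fun s hs ↦
    setIntegral_nonneg (isClosed_tsupport κ).measurableSet fun y hy ↦
      mul_nonneg (Real.rpow_nonneg (hf.nonneg s ⟨hs.1, hs.2.trans ht.2⟩ y (hκB hy)) _)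
        (densRatio_pos _ _ _).le
  have hfx : 0 ≤ f t x := hf.nonneg t (Ioc_subset_Icc_self ht) x hxB
  have hbound : f t x ^ p ≤ C₀ * A ^ ((n : ℝ) / 2) * Z ^ (((n : ℝ) + 2) / 2) * I := by
    refine hmain.trans (mul_le_mul_of_nonneg_right ?_ hI)
    have h1 := coefficient_le (d := n) (θ := θ) (A := A) (e := 1 / r ^ 2) (γ := q / (q - n))
      (b := n / (q - n)) (τ := t) (μ := μ) (c := c') n.cast_nonneg hθ0 hA (by positivity) hμ.le hc'
      ht0 rfl hK₁
    calc _ = moserConst n p (q / (q - n)) L * _ := mul_assoc _ _ _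
      _ ≤ moserConst n p (q / (q - n)) L * _ := mul_le_mul_of_nonneg_left h1 hmc.le
      _ = _ := by ring
  have hroot : f t x ≤ C₀ ^ (1 / p) * A ^ ((n : ℝ) / (2 * p)) * Z ^ (((n : ℝ) + 2) / (2 * p)) *
      I ^ (1 / p) := by
    have h1 := Real.rpow_le_rpow (by positivity) hbound (by positivity : 0 ≤ 1 / p)
    rw [← Real.rpow_mul hfx, mul_one_div_cancel hp0.ne', Real.rpow_one,
      Real.mul_rpow (by positivity) hI, Real.mul_rpow (by positivity) (by positivity),
      Real.mul_rpow hC₀.le (by positivity), ← Real.rpow_mul hA.le, ← Real.rpow_mul hZ] at h1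
    convert h1 using 5 <;> field_simp
  calc ENNReal.ofReal (f t x)
      ≤ ENNReal.ofReal (C₀ ^ (1 / p) * A ^ ((n : ℝ) / (2 * p)) *
          Z ^ (((n : ℝ) + 2) / (2 * p)) * I ^ (1 / p)) := ENNReal.ofReal_le_ofReal hroot
    _ = ENNReal.ofReal (C₀ ^ (1 / p) * A ^ ((n : ℝ) / (2 * p)) *
          Z ^ (((n : ℝ) + 2) / (2 * p))) * ENNReal.ofReal I ^ (1 / p) := by
        rw [ENNReal.ofReal_mul (by positivity), ENNReal.ofReal_rpow_of_nonneg hI (by positivity)]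
    _ ≤ _ := by
        refine mul_le_mul_right (ENNReal.rpow_le_rpow ?_ (by positivity)) _
        exact ofReal_integral_densRatio_le g₀ g (isClosed_tsupport κ).measurableSet hκB ht hp0.le
          hf.nonneg
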